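/- **Setting.** Fix integers $p\ge 0$, $m\ge 1$. Observe $y_i=f_1(x_{i1})+f_2(x_{i2})+\varepsilon_i$, $i=1,\dots,n$, where the covariates $(x_{i1},x_{i2})$ are i.i.d. on $(0,1)^2$ with a joint density $q$ bounded above and bounded away from $0$, and $E[f_j(x_{ij})]=0$ for $j=1,2$. Given the covariates, the errors $\varepsilon_i$ are independent with mean $0$ and variance $\sigma^2(x_{i1},x_{i2})$, where $\sigma^2$ is bounded above and bounded away from $0$ on $(0,1)^2$. Let $K_n\ge 1$ be integers, and let $B(x)=(B_{-p+1}(x),\dots,B_{K_n}(x))'$ be the vector of B-splines of degree $p$ on the knots $k/K_n$, $k\in\mathbb Z$. Let $X_j$ be the $n\times(K_n+p)$ matrix with rows $B(x_{ij})'$, let $Q_m=D_m'D_m$ with $D_m$ the matrix of $m$-th order differences, let $\lambda_{jn}\ge 0$, and let $\Lambda_j=X_j'X_j+\lambda_{jn}Q_m$. The penalized spline estimators are $\hat f_j(x_j)=B(x_j)'b_j^{(\infty)}$, where $b_j^{(\infty)}=\lim_{\ell\to\infty}b_j^{(\ell)}$ is the limit of the backfitting algorithm $$b_1^{(\ell)}=\Lambda_1^{-1}X_1'(y-X_2b_2^{(\ell-1)}),\qquad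 b_2^{(\ell)}=\Lambda_2^{-1}X_2'(y-X_1b_1^{(\ell)}).$$ The initial value $b_2^{(0)}$, which may depend on $n$ and on the covariates, is asymptotically centred: $\frac1n\sum_{i=1}^n B(x_{i2})'b_2^{(0)}=o_P((K_n/n)^{1/2})$ (for example $b_2^{(0)}=0$). Let $V$ denote the $2\times 2$ covariance matrix of $(\hat f_1(x_1),\hat f_2(x_2))'$ given the covariates. **Theorem.** Suppose that for some $\delta>0$ the conditional moments $E[|\varepsilon_i|^{2+\delta}]$ given the covariates are bounded uniformly in $i$ and in the covariates, that $f_j\in C^{p+1}([0,1])$, that $K_n\asymp n^\gamma$ with $1/3<\gamma<1/2$, and that $\lambda_{jn}=o((nK_n^{-1})^{1/2})$ for $j=1,2$. Then for every fixed $(x_1,x_2)\in(0,1)^2$, as $n\to\infty$, $$V^{-1/2}\begin{pmatrix}\hat f_1(x_1)-f_1(x_1)\\ \hat f_2(x_2)-f_2(x_2)\end{pmatrix}\xrightarrow{D}N_2(0,I_2).$$ In particular the two component estimators are asymptotically independent: the pair $\big((\hat f_1(x_1)-f_1(x_1))/V_{11}^{1/2},\,(\hat f_2(x_2)-f_2(x_2))/V_{22}^{1/2}\big)$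 converges in distribution to a pair of independent standard normal variables. -/

import Mathlib

open MeasureTheory ProbabilityTheory Filter Topology Asymptotics Set
open scoped ENNReal NNReal Matrix MatrixOrder

namespace PSpline

/-- The equidistant knots `κ_k = k / K`, for all integers `k`. -/
noncomputable def knot (K : ℕ) (k : ℤ) : ℝ := (k : ℝ) / (K : ℝ)

/-- The B-spline `B_k^{[p]}` on the knots `k / K`; `bspline K p k x` is its value at `x`. -/
noncomputable def bspline (K : ℕ) : ℕ → ℤ → ℝ → ℝ
  | 0, k, x => if knot K (k - 1) < x ∧ x ≤ knot K k then 1 else 0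
  | d + 1, k, x =>
      (x - knot K (k - 1)) / (knot K (k + d) - knot K (k - 1)) * bspline K d k x +
        (knot K (k + d + 1) - x) / (knot K (k + d + 1) - knot K k) * bspline K d (k + 1) x

/-- The vector `B(x)` of the `K + p` basis functions `B_{-p+1}, …, B_K` of degree `p` at `x`
(the position `a = 0, …, K + p - 1` stands for the index `k = -p + 1 + a`). -/
noncomputable def basis (p K : ℕ) (x : ℝ) : Fin (K + p) → ℝ :=
  fun a => bspline K p (-(p : ℤ) + 1 + (a : ℕ)) x

/-- The design matrix `X_j`, whose `i`-th row is `B(x_{ij})`. -/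
noncomputable def designMatrix (p K : ℕ) {n : ℕ} (z : Fin n → Fin 2 → ℝ) (j : Fin 2) :
    Matrix (Fin n) (Fin (K + p)) ℝ :=
  Matrix.of fun i => basis p K (z i j)

/-- The `m`-th order difference operator, `(D b)_i = ∑_r (-1)^(m-r) (m choose r) b_{i+r}`. -/
def diffOp (m N : ℕ) : Matrix (Fin (N - m)) (Fin N) ℝ :=
  Matrix.of fun i j =>
    if (i : ℕ) ≤ j then (-1 : ℝ) ^ (m + ((j : ℕ) - i)) * (m.choose ((j : ℕ) - i) : ℝ) else 0

/-- The penalty matrix `Q_m = Dᵀ D`, so that `bᵀ Q_m b` is the sum of the squared `m`-th order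
differences of `b`. -/
def penalty (m N : ℕ) : Matrix (Fin N) (Fin N) ℝ := (diffOp m N)ᵀ * diffOp m N

/-- `Λ_j = X_jᵀ X_j + λ_j Q_m`. -/
noncomputable def Lam (p m K : ℕ) (lam : Fin 2 → ℝ) {n : ℕ} (z : Fin n → Fin 2 → ℝ) (j : Fin 2) :
    Matrix (Fin (K + p)) (Fin (K + p)) ℝ :=
  (designMatrix p K z j)ᵀ * designMatrix p K z j + lam j • penalty m (K + p)

/-- The update `Λ_j⁻¹ X_jᵀ r` for the vector `r` of partial residuals. -/
noncomputable def update (p m K : ℕ) (lam : Fin 2 → ℝ) {n : ℕ} (z : Fin n → Fin 2 → ℝ)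
    (j : Fin 2) (r : Fin n → ℝ) : Fin (K + p) → ℝ :=
  (Lam p m K lam z j)⁻¹ *ᵥ ((designMatrix p K z j)ᵀ *ᵥ r)

/-- The backfitting algorithm started at `b₂ = b0`: the pair `(b₁, b₂)` at stage `ℓ`, where
`b₁^(ℓ+1) = Λ₁⁻¹ X₁ᵀ (y - X₂ b₂^(ℓ))` and `b₂^(ℓ+1) = Λ₂⁻¹ X₂ᵀ (y - X₁ b₁^(ℓ+1))`.
The first component at stage `0` is never used. -/
noncomputable def backfit (p m K : ℕ) (lam : Fin 2 → ℝ) {n : ℕ} (z : Fin n → Fin 2 → ℝ)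
    (y : Fin n → ℝ) (b0 : Fin (K + p) → ℝ) :
    ℕ → (Fin (K + p) → ℝ) × (Fin (K + p) → ℝ)
  | 0 => (0, b0)
  | l + 1 =>
      let b1 := update p m K lam z 0 (y - designMatrix p K z 1 *ᵥ (backfit p m K lam z y b0 l).2)
      (b1, update p m K lam z 1 (y - designMatrix p K z 0 *ᵥ b1))

/-- The limit `(b₁^(∞), b₂^(∞))` of the backfitting algorithm. For nonnegative smoothing
parameters the limit always exists, since the smoothers `S_j = X_j Λ_j⁻¹ X_jᵀ` are symmetric with
eigenvalues in `[0, 1]`. -/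
noncomputable def backfitLimit (p m K : ℕ) (lam : Fin 2 → ℝ) {n : ℕ} (z : Fin n → Fin 2 → ℝ)
    (y : Fin n → ℝ) (b0 : Fin (K + p) → ℝ) : (Fin (K + p) → ℝ) × (Fin (K + p) → ℝ) :=
  limUnder atTop (backfit p m K lam z y b0)

/-- The penalized spline estimators at the point `x = (x₁, x₂)`:
`(B(x₁)ᵀ b₁^(∞), B(x₂)ᵀ b₂^(∞))`. -/
noncomputable def estimator (p m K : ℕ) (lam : Fin 2 → ℝ) {n : ℕ} (z : Fin n → Fin 2 → ℝ)
    (y : Fin n → ℝ) (b0 : Fin (K + p) → ℝ) (x : Fin 2 → ℝ) : Fin 2 → ℝ :=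
  ![basis p K (x 0) ⬝ᵥ (backfitLimit p m K lam z y b0).1,
    basis p K (x 1) ⬝ᵥ (backfitLimit p m K lam z y b0).2]

/-- The responses `y_i = f₁(x_{i1}) + f₂(x_{i2}) + ε_i`. -/
def response (f : Fin 2 → ℝ → ℝ) {n : ℕ} (z : Fin n → Fin 2 → ℝ) (e : Fin n → ℝ) : Fin n → ℝ :=
  fun i => f 0 (z i 0) + f 1 (z i 1) + e i

/-- The estimator at `x` computed from the first `n` observations, as a function of the
covariates `z` and the errors `e`; the initial value `b0` may depend on the covariates. -/
noncomputable def fhat (p m : ℕ) (K : ℕ → ℕ) (lam : Fin 2 → ℕ → ℝ) (f : Fin 2 → ℝ → ℝ)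
    (b0 : ∀ n, (Fin n → Fin 2 → ℝ) → Fin (K n + p) → ℝ) (x : Fin 2 → ℝ) (n : ℕ)
    (z : ℕ → Fin 2 → ℝ) (e : ℕ → ℝ) : Fin 2 → ℝ :=
  let zn : Fin n → Fin 2 → ℝ := fun i => z i
  estimator p m (K n) (fun j => lam j n) zn (response f zn (fun i => e i)) (b0 n zn) x

/-- The covariance matrix of a random vector `T` in `ℝ²` under the law `P`. -/
noncomputable def covMatrix {E : Type*} [MeasurableSpace E] (T : E → Fin 2 → ℝ) (P : Measure E) :
    Matrix (Fin 2) (Fin 2) ℝ :=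
  Matrix.of fun j k => cov[fun e => T e j, fun e => T e k; P]

/-- The inverse square root of a positive definite matrix: the positive semidefinite square root
of the inverse. -/
noncomputable def invSqrt (V : Matrix (Fin 2) (Fin 2) ℝ) : Matrix (Fin 2) (Fin 2) ℝ :=
  CFC.sqrt V⁻¹

/-- The open unit square. -/
def unitSquare : Set (Fin 2 → ℝ) := Set.pi Set.univ fun _ => Set.Ioo 0 1

/-- A version of the conditional law of the whole error sequence, given that the sequence of
covariates is `z`. -/
noncomputable def errorLaw {Ω : Type*} [MeasurableSpace Ω] (μ : Measure Ω) [IsFiniteMeasure μ]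
    (X : ℕ → Ω → Fin 2 → ℝ) (ε : ℕ → Ω → ℝ) : Kernel (ℕ → Fin 2 → ℝ) (ℕ → ℝ) :=
  condDistrib (fun ω i => ε i ω) (fun ω i => X i ω) μ

end PSpline

/-! Write h = n / K_n, the order of the Gram matrices X_j'X_j. The rows of a B-spline design sum to
one, so the additive design kills the direction (1, -1) and the normal equations are singular. Each
penalized smoother reproduces constants, hence a backfitting sweep preserves the sample mean of the
second component. Adding the rank-one form of that mean to the normal equations yields a definite
matrix, `jointMatrix`. Backfitting contracts geometrically on centred vectors, and its limit is the
solution whose second component has the mean of the initial value (`tendsto_backfit`).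

Definiteness of order h is the first stochastic input. For a density bounded below, additive
functions are stable once the mean of one component is recorded (`additive_lower`), and B-splines
are stable with a constant of order 1/K (`exists_basis_form_lower`). The squared deviation of the
sample Gram matrix and column sums from their means has expectation at most 6n, which is negligible
against h² because K²/n tends to 0; this is where γ < 1/2 enters.

The second input is locality. The matrix Λ_j is banded and well conditioned, so Λ_j⁻¹B(x_j) decays
exponentially away from x_j (`abs_inv_apply_le_of_banded`). The entries of X_1'X_2 are of order
n/K², smaller by a factor K than those of X_j'X_j. By `weight_eq` the weights of the errors in one
component are those of a one-component smoother, up to a remainder of relative squared size 1/K.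
Consequently the variances are of order 1/h, the covariance is o(1/h), and single weights are
O(1/h). The bias consists of O(1/K) from spline approximation, O(λ/h) from the penalty, and a
centring constant made of O(n^(-1/2)), O(1/K) and the mean of the initial value. Multiplied by √h
all of this vanishes, since n/K³ tends to 0 (from γ > 1/3), λ = o(√h), K tends to infinity and the
initial value is asymptotically centred. `Linearized` collects these bounds.

Given the covariates, the estimator is then affine in independent errors with uniformly small
weights, and a Lyapunov estimate with moments of order 2 + δ controls the conditional characteristic
function. After standardization its limit does not depend on the covariates, so integration over
them and Lévy's theorem give the unconditional limit. Because hV is nearly diagonal, V^(-1/2) and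
the diagonal matrix of the V_jj^(-1/2) both standardize; `IsStandardizer` lets one argument serve
both conclusions. -/

namespace PSpline

/-! ### Quadratic forms and coercive matrices -/

section QuadraticForms
variable {ι κ : Type*} [Fintype ι] [Fintype κ]

theorem dotProduct_sq_le (x y : ι → ℝ) : (x ⬝ᵥ y) ^ 2 ≤ (x ⬝ᵥ x) * (y ⬝ᵥ y) := by
  simpa [dotProduct, sq] using Finset.sum_mul_sq_le_sq_mul_sq Finset.univ x y

theorem dotProduct_self_nonneg' (x : ι → ℝ) : 0 ≤ x ⬝ᵥ x :=
  Finset.sum_nonneg fun i _ => mul_self_nonneg (x i)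

theorem sq_apply_le_dotProduct_self (x : ι → ℝ) (i : ι) : x i ^ 2 ≤ x ⬝ᵥ x := by
  rw [sq]
  exact Finset.single_le_sum (f := fun i => x i * x i) (fun i _ => mul_self_nonneg (x i))
    (Finset.mem_univ i)

theorem dotProduct_self_add_le (x y : ι → ℝ) :
    (x + y) ⬝ᵥ (x + y) ≤ 2 * (x ⬝ᵥ x) + 2 * (y ⬝ᵥ y) := by
  simp only [dotProduct, Finset.mul_sum, ← Finset.sum_add_distrib, Pi.add_apply]
  exact Finset.sum_le_sum fun i _ => by nlinarith [sq_nonneg (x i - y i)]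

/-- Cauchy-Schwarz for the form `⟨x, A y⟩` of a symmetric positive semidefinite matrix. -/
theorem dotProduct_mulVec_sq_le {A : Matrix ι ι ℝ} (hA : Aᵀ = A)
    (h0 : ∀ x, 0 ≤ x ⬝ᵥ A *ᵥ x) (x y : ι → ℝ) :
    (x ⬝ᵥ A *ᵥ y) ^ 2 ≤ (x ⬝ᵥ A *ᵥ x) * (y ⬝ᵥ A *ᵥ y) := by
  have hs : y ⬝ᵥ A *ᵥ x = x ⬝ᵥ A *ᵥ y := by
    rw [Matrix.dotProduct_mulVec, ← Matrix.mulVec_transpose, hA, dotProduct_comm]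
  have key : ∀ t : ℝ, 0 ≤ (y ⬝ᵥ A *ᵥ y) * (t * t) + (2 * (x ⬝ᵥ A *ᵥ y)) * t + x ⬝ᵥ A *ᵥ x := by
    intro t
    have h := h0 (x + t • y)
    simp only [Matrix.mulVec_add, Matrix.mulVec_smul, dotProduct_add, add_dotProduct,
      dotProduct_smul, smul_dotProduct, smul_eq_mul, hs] at h
    linarith
  have := discrim_le_zero key
  rw [discrim] at this
  nlinarith

/-- The Euclidean operator norm of a symmetric positive semidefinite matrix is at most `q` if its
quadratic form is at most `q`. -/
theorem mulVec_dotProduct_self_le {A : Matrix ι ι ℝ} (hA : Aᵀ = A)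
    (h0 : ∀ x, 0 ≤ x ⬝ᵥ A *ᵥ x) {q : ℝ} (hq : 0 ≤ q) (h1 : ∀ x, x ⬝ᵥ A *ᵥ x ≤ q * (x ⬝ᵥ x))
    (x : ι → ℝ) : (A *ᵥ x) ⬝ᵥ (A *ᵥ x) ≤ q ^ 2 * (x ⬝ᵥ x) := by
  -- Cauchy-Schwarz for the form of A at the pair (Ax, x): the left side is |Ax|⁴, and both factors
  -- on the right are controlled by q.
  have h := dotProduct_mulVec_sq_le hA h0 (A *ᵥ x) x
  set s := (A *ᵥ x) ⬝ᵥ (A *ᵥ x) with hs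
  have hsn : 0 ≤ s := dotProduct_self_nonneg' _
  have h2 := h1 (A *ᵥ x)
  have h3 := h1 x
  have h4 : s ^ 2 ≤ (q * s) * (q * (x ⬝ᵥ x)) :=
    h.trans (mul_le_mul h2 h3 (h0 x) (mul_nonneg hq hsn))
  have hx := dotProduct_self_nonneg' x
  rcases hsn.eq_or_lt with h5 | h5
  · rw [← h5]; positivity
  · have : s * s ≤ s * (q ^ 2 * (x ⬝ᵥ x)) := by nlinarith
    exact le_of_mul_le_mul_left this h5

theorem dotProduct_gram (A : Matrix κ ι ℝ) (x y : ι → ℝ) :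
    x ⬝ᵥ (Aᵀ * A) *ᵥ y = (A *ᵥ x) ⬝ᵥ (A *ᵥ y) := by
  rw [← Matrix.mulVec_mulVec, Matrix.dotProduct_mulVec, Matrix.vecMul_transpose]

theorem isUnit_det_of_form_lower [DecidableEq ι] {A : Matrix ι ι ℝ} {c : ℝ} (hc : 0 < c)
    (h : ∀ x, c * (x ⬝ᵥ x) ≤ x ⬝ᵥ A *ᵥ x) : IsUnit A.det := by
  rw [isUnit_iff_ne_zero]
  intro h0
  obtain ⟨v, hv, hv0⟩ := Matrix.exists_mulVec_eq_zero_iff.mpr h0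
  have := h v
  rw [hv0, dotProduct_zero] at this
  have h2 : v ⬝ᵥ v ≤ 0 := by nlinarith
  exact hv (dotProduct_self_eq_zero.mp (le_antisymm h2 (dotProduct_self_nonneg' v)))

/-- With y = Au this bounds A⁻¹y. Phrasing it through u avoids the inverse and needs no symmetry:
coercivity and Cauchy-Schwarz give c|u|² ≤ |u||Au|. -/
theorem dotProduct_self_le_of_form_lower {A : Matrix ι ι ℝ} {c : ℝ} (hc : 0 < c)
    (h : ∀ x, c * (x ⬝ᵥ x) ≤ x ⬝ᵥ A *ᵥ x) (u : ι → ℝ) :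
    u ⬝ᵥ u ≤ (A *ᵥ u ⬝ᵥ A *ᵥ u) / c ^ 2 := by
  rw [le_div_iff₀ (by positivity)]
  have h1 := h u
  have h2 := dotProduct_sq_le u (A *ᵥ u)
  have hn := dotProduct_self_nonneg' u
  have hp := dotProduct_self_nonneg' (A *ᵥ u)
  rcases hn.eq_or_lt with h5 | h5
  · rw [← h5]; simpa using hp
  · have h6 : (c * (u ⬝ᵥ u)) ^ 2 ≤ (u ⬝ᵥ A *ᵥ u) ^ 2 := by
      apply pow_le_pow_left₀ (by positivity) h1
    have : (u ⬝ᵥ u) * (u ⬝ᵥ u * c ^ 2) ≤ (u ⬝ᵥ u) * (A *ᵥ u ⬝ᵥ A *ᵥ u) := by nlinarith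
    exact le_of_mul_le_mul_left this h5

theorem dotProduct_mulVec_le_of_form_lower {A : Matrix ι ι ℝ} {c : ℝ} (hc : 0 < c)
    (h : ∀ x, c * (x ⬝ᵥ x) ≤ x ⬝ᵥ A *ᵥ x) (u : ι → ℝ) :
    u ⬝ᵥ A *ᵥ u ≤ (A *ᵥ u ⬝ᵥ A *ᵥ u) / c := by
  have h1 := dotProduct_self_le_of_form_lower hc h u
  have h2 := dotProduct_sq_le u (A *ᵥ u)
  have hp := dotProduct_self_nonneg' (A *ᵥ u)
  have h3 : (u ⬝ᵥ A *ᵥ u) ^ 2 ≤ ((A *ᵥ u ⬝ᵥ A *ᵥ u) / c) ^ 2 := by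
    calc _ ≤ _ := h2
      _ ≤ (A *ᵥ u ⬝ᵥ A *ᵥ u) / c ^ 2 * (A *ᵥ u ⬝ᵥ A *ᵥ u) := by gcongr
      _ = _ := by field_simp
  exact (le_abs_self _).trans (abs_le_of_sq_le_sq h3 (by positivity))

end QuadraticForms

/-! ### Exponential decay of inverses of banded matrices -/

section Banded

/-- Bandwidths add under multiplication, by the triangle inequality for the distance of indices. -/
theorem banded_pow {N w : ℕ} {E : Matrix (Fin N) (Fin N) ℝ}
    (hE : ∀ i j : Fin N, w < Nat.dist i j → E i j = 0) (J : ℕ) :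
    ∀ i j : Fin N, J * w < Nat.dist i j → (E ^ J) i j = 0 := by
  induction J with
  | zero =>
    intro i j h
    rw [pow_zero, Matrix.one_apply_ne]
    rintro rfl
    simp [Nat.dist_self] at h
  | succ J ih =>
    intro i j h
    rw [pow_succ, Matrix.mul_apply]
    refine Finset.sum_eq_zero fun l _ => ?_
    by_cases h1 : J * w < Nat.dist i l
    · rw [ih i l h1, zero_mul]
    · rw [hE l j, mul_zero]
      rw [Nat.succ_mul] at h
      unfold Nat.dist at h h1 ⊢
      omega

/-- The inverse of a well-conditioned banded symmetric matrix decays exponentially off the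
diagonal. -/
theorem abs_inv_apply_le_of_banded {N w : ℕ} (hw : 0 < w) {A : Matrix (Fin N) (Fin N) ℝ}
    (hA : Aᵀ = A) (hband : ∀ i j : Fin N, w < Nat.dist i j → A i j = 0) {c C : ℝ} (hc : 0 < c)
    (hcC : c ≤ C) (hlow : ∀ x, c * (x ⬝ᵥ x) ≤ x ⬝ᵥ A *ᵥ x)
    (hup : ∀ x, x ⬝ᵥ A *ᵥ x ≤ C * (x ⬝ᵥ x)) (i j : Fin N) :
    |A⁻¹ i j| ≤ c⁻¹ * (1 - c / C) ^ (Nat.dist i j / w) := by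
  have hC : 0 < C := hc.trans_le hcC
  have hdet := isUnit_det_of_form_lower hc hlow
  set q := 1 - c / C with hq
  have hq0 : 0 ≤ q := by rw [hq, sub_nonneg, div_le_one hC]; exact hcC
  -- E is banded like A and its form lies between 0 and q|x|², so it contracts by q. In the Neumann
  -- expansion of A⁻¹ in powers of E, the low powers do not reach the entry (i, j) and only a
  -- geometrically small remainder is left.
  set E : Matrix (Fin N) (Fin N) ℝ := 1 - C⁻¹ • A with hEdef
  have hEs : Eᵀ = E := by rw [hEdef, Matrix.transpose_sub, Matrix.transpose_smul, hA]; simp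
  have hEform : ∀ x, x ⬝ᵥ E *ᵥ x = x ⬝ᵥ x - C⁻¹ * (x ⬝ᵥ A *ᵥ x) := by
    intro x
    rw [hEdef, Matrix.sub_mulVec, Matrix.one_mulVec, Matrix.smul_mulVec, dotProduct_sub,
      dotProduct_smul, smul_eq_mul]
  have hE0 : ∀ x, 0 ≤ x ⬝ᵥ E *ᵥ x := by
    intro x
    rw [hEform, sub_nonneg, inv_mul_le_iff₀ hC]
    exact hup x
  have hE1 : ∀ x, x ⬝ᵥ E *ᵥ x ≤ q * (x ⬝ᵥ x) := by
    intro x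
    rw [hEform, hq]
    have := mul_le_mul_of_nonneg_left (hlow x) (inv_nonneg.mpr hC.le)
    have e : C⁻¹ * (c * (x ⬝ᵥ x)) = c / C * (x ⬝ᵥ x) := by field_simp
    linarith
  have hEband : ∀ i j : Fin N, w < Nat.dist i j → E i j = 0 := by
    intro i j h
    have hne : i ≠ j := by rintro rfl; simp [Nat.dist_self] at h
    simp [hEdef, hband i j h, Matrix.one_apply_ne hne]
  have hpow : ∀ (J : ℕ) (x : Fin N → ℝ),
      ((E ^ J) *ᵥ x) ⬝ᵥ ((E ^ J) *ᵥ x) ≤ (q ^ J) ^ 2 * (x ⬝ᵥ x) := by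
    intro J
    induction J with
    | zero => intro x; simp
    | succ J ih =>
      intro x
      rw [pow_succ', ← Matrix.mulVec_mulVec]
      calc _ ≤ q ^ 2 * _ := mulVec_dotProduct_self_le hEs hE0 hq0 hE1 _
        _ ≤ q ^ 2 * ((q ^ J) ^ 2 * (x ⬝ᵥ x)) := by gcongr; exact ih x
        _ = _ := by ring
  have hident : ∀ J : ℕ, A⁻¹ = C⁻¹ • ∑ k ∈ Finset.range J, E ^ k + E ^ J * A⁻¹ := by
    intro J
    induction J with
    | zero => simp
    | succ J ih =>
      have h1 : A⁻¹ = C⁻¹ • (1 : Matrix (Fin N) (Fin N) ℝ) + E * A⁻¹ := by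
        rw [hEdef, Matrix.sub_mul, Matrix.one_mul, Matrix.smul_mul, Matrix.mul_nonsing_inv _ hdet]
        abel
      rw [Finset.sum_range_succ, smul_add, add_assoc]
      have h2 : C⁻¹ • E ^ J + E ^ (J + 1) * A⁻¹ = E ^ J * A⁻¹ := by
        conv_rhs => rw [h1]
        rw [Matrix.mul_add, Matrix.mul_smul, Matrix.mul_one, pow_succ, Matrix.mul_assoc]
      rw [h2]
      exact ih
  -- Every power E^k with k < J has bandwidth kw strictly below the distance of i and j.
  set J := Nat.dist i j / w with hJ
  have hz : (∑ k ∈ Finset.range J, E ^ k) i j = 0 := by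
    rw [Matrix.sum_apply]
    refine Finset.sum_eq_zero fun k hk => banded_pow hEband k i j ?_
    have : k < J := Finset.mem_range.mp hk
    calc k * w < J * w := Nat.mul_lt_mul_of_pos_right this hw
      _ ≤ _ := Nat.div_mul_le_self _ _
  have hij : A⁻¹ i j = ((E ^ J) *ᵥ (A⁻¹ *ᵥ Pi.single j 1)) i := by
    conv_lhs => rw [hident J]
    rw [Matrix.add_apply, Matrix.smul_apply, hz, smul_zero, zero_add, Matrix.mulVec_mulVec]
    simp
  set u := A⁻¹ *ᵥ Pi.single j 1 with hu
  have hAu : A *ᵥ u = Pi.single j 1 := by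
    rw [hu, Matrix.mulVec_mulVec, Matrix.mul_nonsing_inv _ hdet, Matrix.one_mulVec]
  have hun : u ⬝ᵥ u ≤ (c⁻¹) ^ 2 := by
    have := dotProduct_self_le_of_form_lower hc hlow u
    rw [hAu] at this
    simpa using this
  rw [hij]
  refine abs_le_of_sq_le_sq ?_ (by positivity)
  calc _ ≤ _ := sq_apply_le_dotProduct_self _ i
    _ ≤ (q ^ J) ^ 2 * (u ⬝ᵥ u) := hpow J u
    _ ≤ (q ^ J) ^ 2 * (c⁻¹) ^ 2 := by gcongr
    _ = _ := by ring

/-- The exponent takes each value w times, so the sum is at most w times a geometric series;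
enlarging the range to n * w completes the blocks. -/
theorem sum_range_pow_div_le {q : ℝ} (h0 : 0 ≤ q) (h1 : q < 1) {w : ℕ} (hw : 0 < w) (n : ℕ) :
    ∑ d ∈ Finset.range n, q ^ (d / w) ≤ w / (1 - q) := by
  have key : ∀ J : ℕ, ∑ d ∈ Finset.range (J * w), q ^ (d / w) = w * ∑ k ∈ Finset.range J, q ^ k := by
    intro J
    induction J with
    | zero => simp
    | succ J ih =>
      rw [Nat.succ_mul, Finset.sum_range_add, ih, Finset.sum_range_succ, mul_add]
      congr 1
      rw [Finset.sum_congr rfl (g := fun _ => q ^ J)]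
      · simp
      · intro x hx
        rw [mul_comm, Nat.mul_add_div hw, Nat.div_eq_of_lt (Finset.mem_range.mp hx), add_zero]
  calc ∑ d ∈ Finset.range n, q ^ (d / w) ≤ ∑ d ∈ Finset.range (n * w), q ^ (d / w) :=
        Finset.sum_le_sum_of_subset_of_nonneg
          (Finset.range_subset_range.mpr (Nat.le_mul_of_pos_right n hw)) fun _ _ _ => by positivity
    _ = w * ∑ k ∈ Finset.range n, q ^ k := key n
    _ ≤ w * (1 - q)⁻¹ := by
        gcongr
        have h2 : 0 < 1 - q := by linarith
        rw [geom_sum_eq h1.ne, ← neg_div_neg_eq, inv_eq_one_div]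
        have : 0 ≤ q ^ n := by positivity
        rw [neg_sub, neg_sub]
        gcongr
        linarith
    _ = _ := by rw [div_eq_mul_inv]

/-- The sum splits at l into two one-sided sums, each bounded by the geometric estimate. The bound
does not involve N. -/
theorem sum_pow_dist_div_le {q : ℝ} (h0 : 0 ≤ q) (h1 : q < 1) {w : ℕ} (hw : 0 < w) {N : ℕ}
    (l : Fin N) : ∑ k : Fin N, q ^ (Nat.dist k l / w) ≤ 2 * (w / (1 - q)) := by
  rw [Fin.sum_univ_eq_sum_range (fun k => q ^ (Nat.dist k l / w)) N]
  have hl := l.2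
  obtain ⟨r, hr⟩ := Nat.exists_eq_add_of_lt hl
  have hN : N = l.1 + (r + 1) := by omega
  have e1 : ∑ k ∈ Finset.range (l : ℕ), q ^ (Nat.dist k l / w)
      ≤ ∑ d ∈ Finset.range ((l : ℕ) + 1), q ^ (d / w) := by
    rw [Finset.sum_range_succ', ← Finset.sum_range_reflect]
    have : ∑ k ∈ Finset.range (l : ℕ), q ^ (Nat.dist (l.1 - 1 - k) l / w)
        = ∑ k ∈ Finset.range (l : ℕ), q ^ ((k + 1) / w) := by
      refine Finset.sum_congr rfl fun k hk => ?_
      have := Finset.mem_range.mp hk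
      congr 2
      unfold Nat.dist
      omega
    rw [this]
    exact le_add_of_nonneg_right (by positivity)
  have e2 : ∑ k ∈ Finset.range (r + 1), q ^ (Nat.dist (l.1 + k) l / w)
      = ∑ d ∈ Finset.range (r + 1), q ^ (d / w) := by
    refine Finset.sum_congr rfl fun k _ => ?_
    congr 2
    unfold Nat.dist
    omega
  rw [Finset.sum_congr (show Finset.range N = Finset.range (l.1 + (r + 1)) by rw [← hN])
    (fun _ _ => rfl), Finset.sum_range_add, e2]
  have b1 := sum_range_pow_div_le h0 h1 hw (l.1 + 1)
  have b2 := sum_range_pow_div_le h0 h1 hw (r + 1)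
  linarith

end Banded

/-! ### B-splines on one cell: derivative, partition of unity, stability -/

section CellPolynomials
open Polynomial

/-- The polynomial which gives the B-spline `B_k^{[d]}` on the knots `ℤ` on the cell `(0, 1]`. -/
noncomputable def cellPoly : ℕ → ℤ → ℝ[X]
  | 0, k => if k = 1 then 1 else 0
  | d + 1, k => C ((d : ℝ) + 1)⁻¹ *
      ((X - C ((k : ℝ) - 1)) * cellPoly d k + (C ((k : ℝ) + d + 1) - X) * cellPoly d (k + 1))

/-- The recursion is invariant under the affine map taking the cell to (0, 1]. Splines on every cell
are thus given by the same polynomials, independent of K, which makes the later constants uniform in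
K. -/
theorem bspline_eq_eval_cellPoly {K : ℕ} (hK : 0 < K) {j : ℤ} {x : ℝ}
    (h1 : knot K (j - 1) < x) (h2 : x ≤ knot K j) (d : ℕ) (k : ℤ) :
    bspline K d k x = (cellPoly d (k - j + 1)).eval (K * x - (j - 1)) := by
  have hK' : (0 : ℝ) < K := by exact_mod_cast hK
  induction d generalizing k with
  | zero =>
    unfold bspline cellPoly
    unfold knot at *
    rw [div_lt_iff₀ hK'] at h1
    rw [le_div_iff₀ hK'] at h2
    push_cast at h1
    by_cases hkj : k = j
    · subst hkj
      rw [if_pos, if_pos] <;> simp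
      rw [div_lt_iff₀ hK', le_div_iff₀ hK']
      exact ⟨h1, h2⟩
    · rw [if_neg, if_neg (by omega)]
      · simp
      · rintro ⟨h3, h4⟩
        rw [div_lt_iff₀ hK'] at h3
        rw [le_div_iff₀ hK'] at h4
        push_cast at h3
        have a1 : (j : ℝ) - 1 < k := by linarith
        have a2 : (k : ℝ) - 1 < j := by linarith
        have a3 : j - 1 < k := by exact_mod_cast a1
        have a4 : k - 1 < j := by exact_mod_cast a2
        omega
  | succ d ih =>
    rw [bspline, cellPoly, ih k, ih (k + 1)]
    have e : k + 1 - j + 1 = k - j + 1 + 1 := by ring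
    rw [e]
    simp only [eval_mul, eval_add, eval_sub, eval_C, eval_X, knot]
    push_cast
    have hd : (d : ℝ) + 1 ≠ 0 := by positivity
    have e1 : ((k : ℝ) + d) / K - (k - 1) / K = (d + 1) / K := by ring
    have e2 : ((k : ℝ) + d + 1) / K - k / K = (d + 1) / K := by ring
    rw [e1, e2]
    field_simp
    ring

theorem cellPoly_eq_zero (d : ℕ) (k : ℤ) (h : k < 1 - d ∨ 1 < k) : cellPoly d k = 0 := by
  induction d generalizing k with
  | zero =>
    rw [cellPoly, if_neg]
    push_cast at h
    omega
  | succ d ih =>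
    push_cast at h
    rw [cellPoly, ih k (by omega), ih (k + 1) (by omega)]
    simp

/-- The derivative formula for splines with unit knot spacing. It lowers the degree in the proof of
linear independence. -/
theorem derivative_cellPoly (d : ℕ) (k : ℤ) :
    derivative (cellPoly (d + 1) k) = cellPoly d k - cellPoly d (k + 1) := by
  induction d generalizing k with
  | zero =>
    have h0 : ∀ k, derivative (cellPoly 0 k) = 0 := by
      intro k; unfold cellPoly; split_ifs <;> simp
    rw [cellPoly.eq_2]
    simp only [derivative_mul, derivative_add, derivative_sub, derivative_C, derivative_X, h0]
    simp
    ring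
  | succ d ih =>
    rw [cellPoly]
    simp only [derivative_mul, derivative_add, derivative_sub, derivative_C, derivative_X, ih]
    have hd : ((d : ℝ) + 1) ≠ 0 := by positivity
    have hd2 : ((d : ℝ) + 1 + 1) ≠ 0 := by positivity
    have c1 : ∀ k, C ((d : ℝ) + 1) * cellPoly (d + 1) k =
        (X - C ((k : ℝ) - 1)) * cellPoly d k + (C ((k : ℝ) + d + 1) - X) * cellPoly d (k + 1) := by
      intro k
      rw [cellPoly, ← mul_assoc, ← C_mul, mul_inv_cancel₀ hd, C_1, one_mul]
    -- Clearing the denominator d + 2 of the recursion leaves an identity of polynomials in the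
    -- lower-degree functions.
    have hinj : ∀ a b : ℝ[X], C ((d : ℝ) + 1 + 1) * a = C ((d : ℝ) + 1 + 1) * b → a = b := by
      intro a b h
      exact mul_left_cancel₀ (C_ne_zero.mpr hd2) h
    apply hinj
    push_cast
    simp only [← mul_assoc, zero_mul, zero_add]
    rw [← C_mul, mul_inv_cancel₀ hd2, C_1, one_mul]
    have h1 := c1 k
    have h2 := c1 (k + 1)
    have e : C ((d : ℝ) + 1 + 1) = C ((d : ℝ) + 1) + 1 := by simp
    rw [e, add_mul, one_mul, mul_sub (C ((d : ℝ) + 1)), h1, h2]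
    push_cast
    simp only [C_add, C_sub, C_1]
    ring

/-- Summation by parts: differentiating a spline differences its coefficients. The two boundary
terms belong to functions that vanish on the cell. -/
theorem sum_cellPoly_shift (d : ℕ) (c : ℕ → ℝ) :
    derivative (∑ a ∈ Finset.range (d + 2), C (c a) * cellPoly (d + 1) (1 - (d + 1 : ℕ) + a)) =
      ∑ a ∈ Finset.range (d + 1), C (c (a + 1) - c a) * cellPoly d (1 - d + a) := by
  simp only [derivative_sum, derivative_mul, derivative_C, zero_mul, zero_add, derivative_cellPoly,
    mul_sub, Finset.sum_sub_distrib]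
  rw [Finset.sum_range_succ', Finset.sum_range_succ (fun a : ℕ => C (c a) * cellPoly d _)]
  rw [cellPoly_eq_zero d _ (Or.inl (by push_cast; omega)),
    cellPoly_eq_zero d _ (Or.inr (by push_cast; omega))]
  simp only [mul_zero, add_zero, C_sub, sub_mul, Finset.sum_sub_distrib]
  congr 1
  · refine Finset.sum_congr rfl fun a _ => ?_
    congr 2
    push_cast; ring
  · refine Finset.sum_congr rfl fun a _ => ?_
    congr 2
    push_cast; ring

/-- Each function of degree d enters two neighbours of degree d + 1, with linear factors whose sum
is the constant d + 1; this cancels the normalization. -/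
theorem sum_cellPoly (d : ℕ) :
    ∑ a ∈ Finset.range (d + 1), cellPoly d (1 - d + a) = 1 := by
  induction d with
  | zero => simp [cellPoly]
  | succ d ih =>
    have hd : ((d : ℝ) + 1) ≠ 0 := by positivity
    have key : ∑ a ∈ Finset.range (d + 2), cellPoly (d + 1) (1 - (d + 1 : ℕ) + a) =
        ∑ a ∈ Finset.range (d + 1), cellPoly d (1 - d + a) := by
      simp only [cellPoly, mul_add, Finset.sum_add_distrib]
      rw [Finset.sum_range_succ',
        Finset.sum_range_succ (fun a : ℕ => C ((d : ℝ) + 1)⁻¹ * ((C _ - X) * cellPoly d _))]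
      rw [cellPoly_eq_zero d _ (Or.inl (by push_cast; omega)),
        cellPoly_eq_zero d _ (Or.inr (by push_cast; omega))]
      simp only [mul_zero, add_zero]
      rw [← Finset.sum_add_distrib]
      refine Finset.sum_congr rfl fun a _ => ?_
      have e1 : (1 - ((d + 1 : ℕ) : ℤ) + ((a + 1 : ℕ) : ℤ)) = 1 - d + a := by push_cast; ring
      have e2 : (1 - ((d + 1 : ℕ) : ℤ) + (a : ℤ) + 1) = 1 - d + a := by push_cast; ring
      rw [e1, e2, ← mul_assoc, ← mul_assoc, ← add_mul, ← mul_add]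
      have : (X - C (((1 - d + a : ℤ) : ℝ) - 1) +
          (C (((1 - ((d + 1 : ℕ) : ℤ) + (a : ℤ) : ℤ) : ℝ) + d + 1) - X)) = C ((d : ℝ) + 1) := by
        push_cast
        rw [sub_add_sub_comm, add_comm X, add_sub_add_right_eq_sub, ← C_sub]
        congr 1
        ring
      rw [this, ← C_mul, inv_mul_cancel₀ hd, C_1, one_mul]
    rw [key, ih]

/-- If the combination vanishes, so does its derivative, and by induction all consecutive
coefficients agree. By the partition of unity the common coefficient is the value of the
combination, which is zero. -/
theorem cellPoly_linearIndependent (d : ℕ) (c : ℕ → ℝ)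
    (h : ∑ a ∈ Finset.range (d + 1), C (c a) * cellPoly d (1 - d + a) = 0) :
    ∀ a < d + 1, c a = 0 := by
  induction d generalizing c with
  | zero =>
    intro a ha
    obtain rfl : a = 0 := by omega
    simpa [cellPoly] using h
  | succ d ih =>
    have h1 := sum_cellPoly_shift d c
    rw [h, derivative_zero] at h1
    have h2 := ih (fun a => c (a + 1) - c a) h1.symm
    have h3 : ∀ a < d + 2, c a = c 0 := by
      intro a
      induction a with
      | zero => simp
      | succ a iha =>
        intro ha
        rw [← iha (by omega)]
        linarith [h2 a (by omega)]
    have h4 : ∑ a ∈ Finset.range (d + 2), C (c a) * cellPoly (d + 1) (1 - (d + 1 : ℕ) + a) =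
        C (c 0) := by
      rw [Finset.sum_congr rfl (g := fun a : ℕ =>
        C (c 0) * cellPoly (d + 1) (1 - (d + 1 : ℕ) + a))
        fun a ha => by rw [h3 a (Finset.mem_range.mp ha)]]
      rw [← Finset.mul_sum, sum_cellPoly, mul_one]
    have h5 : c 0 = 0 := by
      have := h4.symm.trans h
      simpa using this
    intro a ha
    rw [h3 a ha, h5]

/-- The local Gram form is bounded below. -/
theorem exists_cellPoly_form_lower (d : ℕ) : ∃ c : ℝ, 0 < c ∧ ∀ b : Fin (d + 1) → ℝ,
    c * (b ⬝ᵥ b) ≤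
      ∫ u in (0 : ℝ)..1, (∑ a : Fin (d + 1), b a * (cellPoly d (1 - d + (a : ℕ))).eval u) ^ 2 := by
  set g : (Fin (d + 1) → ℝ) → ℝ[X] :=
    fun b => ∑ a : Fin (d + 1), C (b a) * cellPoly d (1 - d + (a : ℕ)) with hg
  have hgu : ∀ b u, (g b).eval u = ∑ a : Fin (d + 1), b a * (cellPoly d (1 - d + (a : ℕ))).eval u := by
    intro b u
    simp [hg, eval_finsetSum]
  set Φ : (Fin (d + 1) → ℝ) → ℝ := fun b => ∫ u in (0 : ℝ)..1, ((g b).eval u) ^ 2 with hΦ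
  have hpos : ∀ b, b ≠ 0 → 0 < Φ b := by
    intro b hb
    have hgb : g b ≠ 0 := by
      intro h0
      apply hb
      have := cellPoly_linearIndependent d (fun a => if h : a < d + 1 then b ⟨a, h⟩ else 0) (by
        rw [← Fin.sum_univ_eq_sum_range (fun a => C (if h : a < d + 1 then b ⟨a, h⟩ else 0) *
          cellPoly d (1 - d + a)), ← h0, hg]
        refine Finset.sum_congr rfl fun a _ => ?_
        simp only [a.2, dite_true, Fin.eta])
      funext a
      have h2 := this a a.2
      simpa only [a.2, dite_true, Fin.eta, Pi.zero_apply] using h2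
    have hne : ∃ u ∈ Icc (0 : ℝ) 1, (g b).eval u ≠ 0 := by
      by_contra! hcon
      apply hgb
      apply Polynomial.eq_zero_of_infinite_isRoot
      exact (Set.Icc_infinite (zero_lt_one (α := ℝ))).mono fun u hu => hcon u hu
    obtain ⟨u, hu, hne⟩ := hne
    apply intervalIntegral.integral_pos zero_lt_one
    · exact (Continuous.continuousOn (by fun_prop))
    · intro x _; positivity
    · exact ⟨u, hu, by positivity⟩
  have hcont : Continuous Φ := by
    apply intervalIntegral.continuous_parametric_intervalIntegral_of_continuous'
    simp only [Function.uncurry_def, hgu]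
    fun_prop
  have hscale : ∀ (t : ℝ) b, Φ (t • b) = t ^ 2 * Φ b := by
    intro t b
    simp only [hΦ, ← intervalIntegral.integral_const_mul]
    congr 1
    funext u
    rw [hgu, hgu, ← mul_pow, Finset.mul_sum]
    congr 1
    refine Finset.sum_congr rfl fun a _ => ?_
    simp [mul_assoc]
  -- The form is continuous and positive on a compact sphere, so it has a positive minimum there;
  -- homogeneity of degree two does the rest.
  have hcpt : IsCompact (Metric.sphere (0 : Fin (d + 1) → ℝ) 1) := isCompact_sphere 0 1
  have hnon : (Metric.sphere (0 : Fin (d + 1) → ℝ) 1).Nonempty :=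
    NormedSpace.sphere_nonempty.mpr zero_le_one
  obtain ⟨b0, hb0, hmin⟩ := hcpt.exists_isMinOn hnon hcont.continuousOn
  have hb0ne : b0 ≠ 0 := by
    rintro rfl
    simp at hb0
  have hc := hpos b0 hb0ne
  -- The sphere is that of the sup norm; the factor d + 1 compares its square with the Euclidean
  -- one.
  refine ⟨Φ b0 / (d + 1), by positivity, fun b => ?_⟩
  have hgoal : Φ b0 / (d + 1) * (b ⬝ᵥ b) ≤ Φ b := by
    by_cases hb : b = 0
    · subst hb
      have : Φ 0 = 0 := by simpa using hscale 0 0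
      simp [this]
    · have hn : 0 < ‖b‖ := norm_pos_iff.mpr hb
      have h1 : Φ b0 ≤ Φ (‖b‖⁻¹ • b) := by
        apply hmin
        simp [norm_smul, hn.ne']
      rw [hscale] at h1
      have h2 : b ⬝ᵥ b ≤ (d + 1) * ‖b‖ ^ 2 := by
        calc b ⬝ᵥ b = ∑ i, b i * b i := rfl
          _ ≤ ∑ _i : Fin (d + 1), ‖b‖ ^ 2 := by
              refine Finset.sum_le_sum fun i _ => ?_
              have := norm_le_pi_norm b i
              rw [Real.norm_eq_abs] at this
              rw [← sq, ← sq_abs]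
              gcongr
          _ = _ := by simp
      calc _ ≤ Φ b0 / (d + 1) * ((d + 1) * ‖b‖ ^ 2) := by gcongr
        _ = Φ b0 * ‖b‖ ^ 2 := by field_simp
        _ ≤ (‖b‖⁻¹ ^ 2 * Φ b) * ‖b‖ ^ 2 := by gcongr
        _ = Φ b := by field_simp
  simpa only [hΦ, hgu] using hgoal

end CellPolynomials

/-! ### The B-spline basis: support, size, approximation, stability -/

section Basis

theorem bspline_eq_zero {K : ℕ} (hK : 0 < K) (d : ℕ) (k : ℤ) {x : ℝ}
    (h : x ≤ knot K (k - 1) ∨ knot K (k + d) < x) : bspline K d k x = 0 := by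
  have hK' : (0 : ℝ) < K := by exact_mod_cast hK
  have hmono : Monotone (knot K) := fun a b hab => by
    unfold knot
    have : (a : ℝ) ≤ b := by exact_mod_cast hab
    gcongr
  induction d generalizing k with
  | zero =>
    rw [bspline, if_neg]
    rintro ⟨h1, h2⟩
    simp only [Nat.cast_zero, add_zero] at h
    rcases h with h | h <;> linarith
  | succ d ih =>
    push_cast at h
    have e : k + 1 + (d : ℤ) = k + (d + 1) := by ring
    have m1 := hmono (show k - 1 ≤ k + 1 - 1 by omega)
    have m2 := hmono (show k + d ≤ k + (d + 1) by omega)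
    rw [bspline, ih k, ih (k + 1), mul_zero, mul_zero, add_zero]
    · rcases h with h | h
      · exact Or.inl (h.trans m1)
      · exact Or.inr (by rwa [e])
    · rcases h with h | h
      · exact Or.inl h
      · exact Or.inr (m2.trans_lt h)

theorem bspline_nonneg {K : ℕ} (hK : 0 < K) (d : ℕ) (k : ℤ) (x : ℝ) : 0 ≤ bspline K d k x := by
  have hK' : (0 : ℝ) < K := by exact_mod_cast hK
  have hmono : Monotone (knot K) := fun a b hab => by
    unfold knot
    have : (a : ℝ) ≤ b := by exact_mod_cast hab
    gcongr
  induction d generalizing k with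
  | zero => rw [bspline]; split_ifs <;> norm_num
  | succ d ih =>
    rw [bspline]
    refine add_nonneg ?_ ?_
    · by_cases h : x ≤ knot K (k - 1)
      · rw [bspline_eq_zero hK d k (Or.inl h), mul_zero]
      · push Not at h
        have := hmono (show k - 1 ≤ k + d by omega)
        exact mul_nonneg (div_nonneg (by linarith) (by linarith)) (ih k)
    · by_cases h : knot K (k + 1 + d) < x
      · rw [bspline_eq_zero hK d (k + 1) (Or.inr h), mul_zero]
      · push Not at h
        have e : k + 1 + (d : ℤ) = k + d + 1 := by ring
        rw [e] at h
        have := hmono (show k ≤ k + d + 1 by omega)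
        exact mul_nonneg (div_nonneg (by linarith) (by linarith)) (ih (k + 1))

theorem measurable_bspline (K d : ℕ) (k : ℤ) : Measurable (bspline K d k) := by
  induction d generalizing k with
  | zero =>
    have : bspline K 0 k = fun x => if knot K (k - 1) < x ∧ x ≤ knot K k then 1 else 0 := by
      funext x; rw [bspline]
    rw [this]
    exact Measurable.ite (measurableSet_Ioc (a := knot K (k - 1)) (b := knot K k))
      measurable_const measurable_const
  | succ d ih =>
    have h1 := ih k
    have h2 := ih (k + 1)
    have : bspline K (d + 1) k = fun x =>
        (x - knot K (k - 1)) / (knot K (k + d) - knot K (k - 1)) * bspline K d k x +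
        (knot K (k + d + 1) - x) / (knot K (k + d + 1) - knot K k) * bspline K d (k + 1) x := by
      funext x; rw [bspline]
    rw [this]
    fun_prop

theorem measurable_basis (p K : ℕ) : Measurable (basis p K) :=
  measurable_pi_lambda _ fun _ => measurable_bspline _ _ _

variable {p K : ℕ}

theorem basis_nonneg (hK : 0 < K) (x : ℝ) (a : Fin (K + p)) : 0 ≤ basis p K x a :=
  bspline_nonneg hK _ _ _

theorem basis_eq_zero (hK : 0 < K) {x : ℝ} {a : Fin (K + p)}
    (h : x ≤ ((a : ℕ) - p : ℝ) / K ∨ ((a : ℕ) + 1 : ℝ) / K < x) : basis p K x a = 0 := by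
  refine bspline_eq_zero hK p _ ?_
  unfold knot
  push_cast
  convert h using 3 <;> ring

theorem basis_dotProduct_cell (hK : 0 < K) {j : ℕ} (hj : j < K) {x : ℝ} (h1 : (j : ℝ) / K < x)
    (h2 : x ≤ ((j : ℝ) + 1) / K) (β : Fin (K + p) → ℝ) :
    basis p K x ⬝ᵥ β = ∑ b : Fin (p + 1), β ⟨j + b, by omega⟩ *
      (cellPoly p (1 - p + (b : ℕ))).eval (K * x - j) := by
  have hval : ∀ k : ℤ, bspline K p k x = (cellPoly p (k - (j + 1) + 1)).eval (K * x - j) := by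
    intro k
    rw [bspline_eq_eval_cellPoly hK (j := (j : ℤ) + 1) (by unfold knot; push_cast; simpa using h1)
      (by unfold knot; push_cast; exact h2)]
    push_cast
    congr 1
    ring
  rw [dotProduct_comm]
  symm
  refine Fintype.sum_of_injective (fun b : Fin (p + 1) => (⟨j + b, by omega⟩ : Fin (K + p)))
    ?_ _ _ ?_ ?_
  · intro b b' h
    simpa [Fin.ext_iff] using h
  · intro a ha
    unfold basis
    rw [hval, cellPoly_eq_zero, Polynomial.eval_zero, mul_zero]
    by_contra hcon
    push Not at hcon
    apply ha
    refine ⟨⟨a - j, by omega⟩, ?_⟩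
    ext
    simp
    omega
  · intro b
    unfold basis
    rw [hval]
    congr 3
    push_cast
    ring

theorem exists_cell (hK : 0 < K) {x : ℝ} (hx : x ∈ Ioc (0 : ℝ) 1) :
    ∃ j < K, (j : ℝ) / K < x ∧ x ≤ ((j : ℝ) + 1) / K := by
  have hK' : (0 : ℝ) < K := by exact_mod_cast hK
  -- Cells are open on the left and closed on the right, hence the ceiling minus one rather than the
  -- floor.
  have h0 : 0 < ⌈(K : ℝ) * x⌉₊ := Nat.ceil_pos.mpr (mul_pos hK' hx.1)
  refine ⟨⌈(K : ℝ) * x⌉₊ - 1, ?_, ?_, ?_⟩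
  · have : ⌈(K : ℝ) * x⌉₊ ≤ K := Nat.ceil_le.mpr (by nlinarith [hx.2])
    omega
  · rw [div_lt_iff₀ hK', mul_comm x]
    exact Nat.lt_ceil.mp (by omega)
  · rw [le_div_iff₀ hK', mul_comm x]
    have := Nat.le_ceil ((K : ℝ) * x)
    rw [Nat.cast_sub (by omega)]
    simpa using this

theorem sum_basis (hK : 0 < K) {x : ℝ} (hx : x ∈ Ioc (0 : ℝ) 1) : ∑ a, basis p K x a = 1 := by
  obtain ⟨j, hj, h1, h2⟩ := exists_cell hK hx
  have h := basis_dotProduct_cell hK hj h1 h2 (fun _ : Fin (K + p) => (1 : ℝ))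
  simp only [dotProduct, mul_one, one_mul] at h
  rw [h, Fin.sum_univ_eq_sum_range (fun b => (cellPoly p (1 - p + (b : ℕ))).eval ((K : ℝ) * x - j)),
    ← Polynomial.eval_finsetSum, sum_cellPoly, Polynomial.eval_one]

theorem basis_le_one (hK : 0 < K) {x : ℝ} (hx : x ∈ Ioc (0 : ℝ) 1) (a : Fin (K + p)) :
    basis p K x a ≤ 1 := by
  rw [← sum_basis hK hx]
  exact Finset.single_le_sum (fun a _ => basis_nonneg hK x a) (Finset.mem_univ a)

theorem basis_dotProduct_self_le (hK : 0 < K) {x : ℝ} (hx : x ∈ Ioc (0 : ℝ) 1) :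
    basis p K x ⬝ᵥ basis p K x ≤ 1 := by
  calc _ ≤ ∑ a, basis p K x a * 1 := Finset.sum_le_sum fun a _ =>
        mul_le_mul_of_nonneg_left (basis_le_one hK hx a) (basis_nonneg hK x a)
    _ = 1 := by simp only [mul_one]; exact sum_basis hK hx

/-- At most p + 1 basis functions are nonzero at x and they sum to one; Cauchy-Schwarz then gives
the bound. It keeps the variance of the estimator from degenerating. -/
theorem basis_dotProduct_self_ge (hK : 0 < K) {x : ℝ} (hx : x ∈ Ioc (0 : ℝ) 1) :
    1 / ((p : ℝ) + 1) ≤ basis p K x ⬝ᵥ basis p K x := by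
  obtain ⟨j, hj, h1, h2⟩ := exists_cell hK hx
  have hs := sum_basis (p := p) hK hx
  have e1 := basis_dotProduct_cell hK hj h1 h2 (fun _ : Fin (K + p) => (1 : ℝ))
  have e2 := basis_dotProduct_cell hK hj h1 h2 (basis p K x)
  have e3 : ∀ b : Fin (p + 1), basis p K x ⟨j + b, by omega⟩ =
      (cellPoly p (1 - p + (b : ℕ))).eval ((K : ℝ) * x - j) := by
    intro b
    have := basis_dotProduct_cell hK hj h1 h2
      (Pi.single (⟨j + b, by omega⟩ : Fin (K + p)) (1 : ℝ))
    rw [dotProduct_single, mul_one] at this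
    rw [this, Finset.sum_eq_single b]
    · simp
    · intro b' _ hb'
      rw [Pi.single_eq_of_ne, zero_mul]
      simpa [Fin.ext_iff] using hb'
    · simp
  simp only [dotProduct, mul_one, one_mul] at e1
  rw [hs] at e1
  simp only [e3] at e2
  rw [e2, div_le_iff₀ (by positivity)]
  have h := sq_sum_le_card_mul_sum_sq (s := (Finset.univ : Finset (Fin (p + 1))))
    (f := fun b => (cellPoly p (1 - p + (b : ℕ))).eval ((K : ℝ) * x - j))
  rw [← e1] at h
  simp only [sq, Finset.card_univ, Fintype.card_fin] at h
  push_cast at h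
  linarith

/-- The coefficients of the spline that imitates `f`. -/
noncomputable def sampleCoeff (p K : ℕ) (f : ℝ → ℝ) : Fin (K + p) → ℝ :=
  fun a => f (min ((a : ℕ) / K) 1)

/-- The spline value is a convex combination of samples of f at points within (p + 1)/K of x;
truncating a node at 1 does not break this because x ≤ 1. Order 1/K is all that is required, since
n/K³ will tend to 0. -/
theorem abs_basis_dotProduct_sampleCoeff_sub_le (hK : 0 < K) {f : ℝ → ℝ} {L : ℝ} (hL : 0 ≤ L)
    (hf : ∀ u ∈ Icc (0 : ℝ) 1, ∀ v ∈ Icc (0 : ℝ) 1, |f u - f v| ≤ L * |u - v|) {x : ℝ}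
    (hx : x ∈ Ioc (0 : ℝ) 1) :
    |basis p K x ⬝ᵥ sampleCoeff p K f - f x| ≤ L * (p + 1) / K := by
  have hK' : (0 : ℝ) < K := by exact_mod_cast hK
  have hs := sum_basis (p := p) hK hx
  have e : basis p K x ⬝ᵥ sampleCoeff p K f - f x =
      ∑ a, basis p K x a * (sampleCoeff p K f a - f x) := by
    simp only [mul_sub, Finset.sum_sub_distrib, ← Finset.sum_mul, hs, one_mul]
    rfl
  rw [e]
  refine (Finset.abs_sum_le_sum_abs _ _).trans ?_
  calc _ ≤ ∑ a, basis p K x a * (L * (p + 1) / K) := by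
        refine Finset.sum_le_sum fun a _ => ?_
        rw [abs_mul, abs_of_nonneg (basis_nonneg hK x a)]
        by_cases h0 : basis p K x a = 0
        · simp [h0]
        · refine mul_le_mul_of_nonneg_left ?_ (basis_nonneg hK x a)
          have h1 : ((a : ℕ) - p : ℝ) / K < x := by
            by_contra hcon; exact h0 (basis_eq_zero hK (Or.inl (not_lt.mp hcon)))
          have h2 : x ≤ ((a : ℕ) + 1 : ℝ) / K := by
            by_contra hcon; exact h0 (basis_eq_zero hK (Or.inr (not_le.mp hcon)))
          have ha : (0 : ℝ) ≤ (a : ℕ) / K := by positivity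
          have hm : min (((a : ℕ) : ℝ) / K) 1 ∈ Icc (0 : ℝ) 1 :=
            ⟨le_min ha zero_le_one, min_le_right _ _⟩
          refine (hf _ hm x ⟨hx.1.le, hx.2⟩).trans ?_
          rw [mul_div_assoc]
          refine mul_le_mul_of_nonneg_left ?_ hL
          rw [sub_div] at h1
          rw [add_div] at h2
          have hp : (0 : ℝ) ≤ p / K := by positivity
          have h1' : (0 : ℝ) ≤ 1 / K := by positivity
          rw [add_div, abs_le]
          constructor
          · rcases min_cases (((a : ℕ) : ℝ) / K) 1 with ⟨h, _⟩ | ⟨h, _⟩ <;> rw [h] <;>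
              linarith [hx.2]
          · rcases min_cases (((a : ℕ) : ℝ) / K) 1 with ⟨h, h'⟩ | ⟨h, h'⟩ <;> rw [h] <;>
              linarith [hx.2]
    _ = _ := by rw [← Finset.sum_mul, hs, one_mul]

/-- The stability on the unit cell is applied on each of the K cells, scaled by the cell length 1/K,
and summed; every coefficient is seen by at least one cell. -/
theorem exists_basis_form_lower (p : ℕ) : ∃ c : ℝ, 0 < c ∧ ∀ K : ℕ, 0 < K →
    ∀ β : Fin (K + p) → ℝ, c / K * (β ⬝ᵥ β) ≤ ∫ x in (0 : ℝ)..1, (basis p K x ⬝ᵥ β) ^ 2 := by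
  obtain ⟨c, hc, h⟩ := exists_cellPoly_form_lower p
  refine ⟨c, hc, fun K hK β => ?_⟩
  have hK' : (0 : ℝ) < K := by exact_mod_cast hK
  set g : ℝ → ℝ := fun x => (basis p K x ⬝ᵥ β) ^ 2 with hg
  set β' : ℕ → ℝ := fun a => if h : a < K + p then β ⟨a, h⟩ else 0 with hβ'
  set G : ℕ → ℝ → ℝ := fun j u =>
    (∑ b : Fin (p + 1), β' (j + b) * (cellPoly p (1 - p + (b : ℕ))).eval u) ^ 2 with hG
  have hcell : ∀ j < K, ∀ x ∈ Ioc ((j : ℝ) / K) (((j + 1 : ℕ) : ℝ) / K), g x = G j (K * x - j) := by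
    intro j hj x hx
    have hx2 := hx.2
    push_cast at hx2
    simp only [hg, hG]
    rw [basis_dotProduct_cell hK hj hx.1 hx2]
    congr 1
    refine Finset.sum_congr rfl fun b _ => ?_
    rw [hβ']
    simp only
    rw [dif_pos (by omega)]
  have hGc : ∀ j, Continuous (G j) := by intro j; simp only [hG]; fun_prop
  have hle : ∀ j : ℕ, (j : ℝ) / K ≤ ((j + 1 : ℕ) : ℝ) / K := by
    intro j; push_cast; gcongr; linarith
  have hint : ∀ j < K, IntervalIntegrable g volume ((j : ℝ) / K) (((j + 1 : ℕ) : ℝ) / K) := by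
    intro j hj
    have hc : Continuous fun x : ℝ => G j (K * x - j) := (hGc j).comp (by fun_prop)
    refine (hc.intervalIntegrable _ _).congr ?_
    intro x hx
    rw [uIoc_of_le (hle j)] at hx
    exact (hcell j hj x hx).symm
  have hsum := intervalIntegral.sum_integral_adjacent_intervals
    (a := fun j : ℕ => (j : ℝ) / K) (n := K) (f := g) (μ := volume) hint
  have e0 : ((0 : ℕ) : ℝ) / K = 0 := by simp
  have e1 : (K : ℝ) / K = 1 := div_self hK'.ne'
  rw [e0, e1] at hsum
  rw [← hsum]
  have hj : ∀ j ∈ Finset.range K, c / K * ∑ b : Fin (p + 1), β' (j + b) ^ 2 ≤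
      ∫ x in ((j : ℝ) / K)..(((j + 1 : ℕ) : ℝ) / K), g x := by
    intro j hj
    have hj := Finset.mem_range.mp hj
    have : ∫ x in ((j : ℝ) / K)..(((j + 1 : ℕ) : ℝ) / K), g x =
        (K : ℝ)⁻¹ * ∫ u in (0 : ℝ)..1, G j u := by
      rw [intervalIntegral.integral_congr_ae (g := fun x => G j (K * x - j))]
      · rw [intervalIntegral.integral_comp_mul_sub (fun u => G j u) hK'.ne']
        rw [smul_eq_mul]
        congr 2
        · field_simp; ring
        · push_cast; field_simp; ring
      · refine Eventually.of_forall fun x hx => ?_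
        rw [uIoc_of_le (hle j)] at hx
        exact hcell j hj x hx
    rw [this]
    have h1 := h (fun b => β' (j + b))
    have h2 := mul_le_mul_of_nonneg_left h1 (inv_nonneg.mpr hK'.le)
    refine le_trans (le_of_eq ?_) h2
    rw [dotProduct, ← mul_assoc]
    simp only [sq]
    congr 1
    field_simp
  refine le_trans ?_ (Finset.sum_le_sum hj)
  rw [← Finset.mul_sum]
  refine mul_le_mul_of_nonneg_left ?_ (by positivity)
  rw [← Finset.sum_product' (Finset.range K) (Finset.univ : Finset (Fin (p + 1)))
      (fun j b => β' (j + b) ^ 2)]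
  -- Each coefficient is charged to one cell: coefficient a to cell a as long as a < K, and the
  -- remaining p coefficients to the last cell.
  set e : Fin (K + p) → ℕ × Fin (p + 1) := fun a =>
    if h : (a : ℕ) < K then (a, 0) else (K - 1, ⟨a - (K - 1), by omega⟩) with he
  have hadd : ∀ a, (e a).1 + ((e a).2 : ℕ) = a := by
    intro a
    simp only [he]
    split_ifs <;> simp <;> omega
  have hinj : Function.Injective e := by
    intro a b hab
    have h1 := hadd a
    rw [hab, hadd b] at h1
    exact Fin.ext h1.symm
  calc β ⬝ᵥ β = ∑ a : Fin (K + p), β' ((e a).1 + ((e a).2 : ℕ)) ^ 2 := by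
        refine Finset.sum_congr rfl fun a _ => ?_
        rw [hadd, hβ']
        simp [sq]
    _ = ∑ x ∈ Finset.univ.map ⟨e, hinj⟩, β' (x.1 + (x.2 : ℕ)) ^ 2 := by
        rw [Finset.sum_map]; rfl
    _ ≤ _ := by
        refine Finset.sum_le_sum_of_subset_of_nonneg ?_ fun _ _ _ => sq_nonneg _
        intro x hx
        obtain ⟨a, _, rfl⟩ := Finset.mem_map.mp hx
        rw [Finset.mem_product]
        refine ⟨?_, Finset.mem_univ _⟩
        rw [Finset.mem_range]
        simp only [he, Function.Embedding.coeFn_mk]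
        split_ifs with h
        · exact h
        · simp; omega

end Basis

/-! ### Normal equations of the additive model and their null direction -/

section JointSystem

variable {n N : ℕ}

/-- The design matrix of the additive model, `[A₀ A₁]`. -/
def jointDesign (A : Fin 2 → Matrix (Fin n) (Fin N) ℝ) : Matrix (Fin n) (Fin 2 × Fin N) ℝ :=
  Matrix.of fun i jk => A jk.1 i jk.2

/-- The block diagonal penalty. -/
def jointPenalty (P : Fin 2 → Matrix (Fin N) (Fin N) ℝ) :
    Matrix (Fin 2 × Fin N) (Fin 2 × Fin N) ℝ :=
  Matrix.of fun a b => if a.1 = b.1 then P a.1 a.2 b.2 else 0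

/-- The block `j` of a stacked coefficient vector. -/
def part (j : Fin 2) (b : Fin 2 × Fin N → ℝ) : Fin N → ℝ := fun k => b (j, k)

/-- The stacked vector with block `j` equal to `B` and the other block zero. -/
def emb (j : Fin 2) (B : Fin N → ℝ) : Fin 2 × Fin N → ℝ := fun a => if a.1 = j then B a.2 else 0

/-- The vector `v` with `v ⬝ᵥ b = ∑ᵢ (A₁ b₁)ᵢ`. -/
def sumVec (A : Fin 2 → Matrix (Fin n) (Fin N) ℝ) : Fin 2 × Fin N → ℝ := emb 1 ((A 1)ᵀ *ᵥ 1)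

/-- The null direction `(1, -1)` of the additive model. -/
def nullVec (N : ℕ) : Fin 2 × Fin N → ℝ := fun a => if a.1 = 0 then 1 else -1

/-- The matrix of the normal equations, made definite by the mean of the second component. -/
noncomputable def jointMatrix (A : Fin 2 → Matrix (Fin n) (Fin N) ℝ)
    (P : Fin 2 → Matrix (Fin N) (Fin N) ℝ) : Matrix (Fin 2 × Fin N) (Fin 2 × Fin N) ℝ :=
  (jointDesign A)ᵀ * jointDesign A + jointPenalty P +
    (n : ℝ)⁻¹ • Matrix.vecMulVec (sumVec A) (sumVec A)

theorem jointDesign_mulVec (A : Fin 2 → Matrix (Fin n) (Fin N) ℝ) (b : Fin 2 × Fin N → ℝ) :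
    jointDesign A *ᵥ b = A 0 *ᵥ part 0 b + A 1 *ᵥ part 1 b := by
  funext i
  simp [Matrix.mulVec, dotProduct, jointDesign, part, Fintype.sum_prod_type]

theorem part_transpose_jointDesign_mulVec (A : Fin 2 → Matrix (Fin n) (Fin N) ℝ) (r : Fin n → ℝ)
    (j : Fin 2) : part j ((jointDesign A)ᵀ *ᵥ r) = (A j)ᵀ *ᵥ r := rfl

theorem part_jointPenalty_mulVec (P : Fin 2 → Matrix (Fin N) (Fin N) ℝ) (b : Fin 2 × Fin N → ℝ)
    (j : Fin 2) : part j (jointPenalty P *ᵥ b) = P j *ᵥ part j b := by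
  funext k
  simp only [Matrix.mulVec, dotProduct, jointPenalty, part, Fintype.sum_prod_type, Matrix.of_apply]
  rw [Finset.sum_eq_single j]
  · simp
  · intro j' _ h
    simp [h.symm]
  · simp

theorem dotProduct_eq_part (a b : Fin 2 × Fin N → ℝ) :
    a ⬝ᵥ b = part 0 a ⬝ᵥ part 0 b + part 1 a ⬝ᵥ part 1 b := by
  simp [dotProduct, part, Fintype.sum_prod_type]

theorem emb_dotProduct (j : Fin 2) (B : Fin N → ℝ) (b : Fin 2 × Fin N → ℝ) :
    emb j B ⬝ᵥ b = B ⬝ᵥ part j b := by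
  rw [dotProduct_eq_part]
  fin_cases j <;> simp [part, emb, dotProduct]

theorem part_add (j : Fin 2) (a b : Fin 2 × Fin N → ℝ) : part j (a + b) = part j a + part j b := rfl

theorem part_smul (j : Fin 2) (t : ℝ) (b : Fin 2 × Fin N → ℝ) : part j (t • b) = t • part j b := rfl

theorem part_dotProduct_part_le (j : Fin 2) (b : Fin 2 × Fin N → ℝ) :
    part j b ⬝ᵥ part j b ≤ b ⬝ᵥ b := by
  rw [dotProduct_eq_part b b]
  have h0 := dotProduct_self_nonneg' (part 0 b)
  have h1 := dotProduct_self_nonneg' (part 1 b)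
  fin_cases j <;> simp <;> linarith

theorem jointMatrix_mulVec (A : Fin 2 → Matrix (Fin n) (Fin N) ℝ)
    (P : Fin 2 → Matrix (Fin N) (Fin N) ℝ) (b : Fin 2 × Fin N → ℝ) :
    jointMatrix A P *ᵥ b = (jointDesign A)ᵀ *ᵥ (jointDesign A *ᵥ b) + jointPenalty P *ᵥ b +
      ((n : ℝ)⁻¹ * (sumVec A ⬝ᵥ b)) • sumVec A := by
  rw [jointMatrix, Matrix.add_mulVec, Matrix.add_mulVec, Matrix.mulVec_mulVec, Matrix.smul_mulVec,
    Matrix.vecMulVec_mulVec, mul_smul]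
  congr 2
  ext; simp [mul_comm]

/-- The properties of the design and penalty matrices of a well-behaved sample: `h` is the
order of the Gram matrices. -/
structure WellConditioned (A : Fin 2 → Matrix (Fin n) (Fin N) ℝ)
    (P : Fin 2 → Matrix (Fin N) (Fin N) ℝ) (h c C : ℝ) : Prop where
  n_pos : 0 < n
  h_pos : 0 < h
  c_pos : 0 < c
  c_le : c ≤ C
  row_sum : ∀ j i, ∑ k, A j i k = 1
  nonneg : ∀ j i k, 0 ≤ A j i k
  pen_symm : ∀ j, (P j)ᵀ = P j
  pen_nonneg : ∀ j x, 0 ≤ x ⬝ᵥ P j *ᵥ x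
  pen_one : ∀ j, P j *ᵥ 1 = 0
  lower : ∀ b, c * h * (b ⬝ᵥ b) ≤
    (jointDesign A *ᵥ b) ⬝ᵥ (jointDesign A *ᵥ b) + (n : ℝ)⁻¹ * (sumVec A ⬝ᵥ b) ^ 2
  upper : ∀ j x, x ⬝ᵥ ((A j)ᵀ * A j + P j) *ᵥ x ≤ C * h * (x ⬝ᵥ x)

namespace WellConditioned

variable {A : Fin 2 → Matrix (Fin n) (Fin N) ℝ} {P : Fin 2 → Matrix (Fin N) (Fin N) ℝ}
  {h c C : ℝ} (W : WellConditioned A P h c C)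
include W

theorem mulVec_one (j : Fin 2) : A j *ᵥ 1 = 1 := by
  funext i
  simpa [Matrix.mulVec, dotProduct] using W.row_sum j i

theorem ch_pos : 0 < c * h := mul_pos W.c_pos W.h_pos

theorem n_pos' : (0 : ℝ) < n := by exact_mod_cast W.n_pos

theorem jointPenalty_form (b : Fin 2 × Fin N → ℝ) : 0 ≤ b ⬝ᵥ jointPenalty P *ᵥ b := by
  rw [dotProduct_eq_part, part_jointPenalty_mulVec, part_jointPenalty_mulVec]
  exact add_nonneg (W.pen_nonneg _ _) (W.pen_nonneg _ _)

theorem jointMatrix_form (b : Fin 2 × Fin N → ℝ) :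
    b ⬝ᵥ jointMatrix A P *ᵥ b = (jointDesign A *ᵥ b) ⬝ᵥ (jointDesign A *ᵥ b) +
      b ⬝ᵥ jointPenalty P *ᵥ b + (n : ℝ)⁻¹ * (sumVec A ⬝ᵥ b) ^ 2 := by
  rw [jointMatrix_mulVec, dotProduct_add, dotProduct_add, dotProduct_smul, smul_eq_mul,
    Matrix.dotProduct_mulVec b (jointDesign A)ᵀ, Matrix.vecMul_transpose, dotProduct_comm b (sumVec A)]
  ring

theorem jointMatrix_lower (b : Fin 2 × Fin N → ℝ) :
    c * h * (b ⬝ᵥ b) ≤ b ⬝ᵥ jointMatrix A P *ᵥ b := by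
  rw [W.jointMatrix_form]
  have h1 := W.lower b
  have h2 := W.jointPenalty_form b
  linarith

theorem jointMatrix_transpose : (jointMatrix A P)ᵀ = jointMatrix A P := by
  rw [jointMatrix, Matrix.transpose_add, Matrix.transpose_add, Matrix.transpose_mul,
    Matrix.transpose_transpose, Matrix.transpose_smul]
  congr 2
  · congr 1
    ext a b
    simp only [jointPenalty, Matrix.transpose_apply, Matrix.of_apply, eq_comm (a := b.1)]
    split_ifs with hab
    · rw [← hab]
      exact congrFun (congrFun (W.pen_symm a.1).symm a.2) b.2
    · rfl
  · ext a b
    simp [Matrix.vecMulVec_apply, mul_comm]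

theorem isUnit_jointMatrix : IsUnit (jointMatrix A P).det :=
  isUnit_det_of_form_lower W.ch_pos W.jointMatrix_lower

theorem jointMatrix_mulVec_inv (u : Fin 2 × Fin N → ℝ) :
    jointMatrix A P *ᵥ ((jointMatrix A P)⁻¹ *ᵥ u) = u := by
  rw [Matrix.mulVec_mulVec, Matrix.mul_nonsing_inv _ W.isUnit_jointMatrix, Matrix.one_mulVec]

theorem jointMatrix_inj {u u' : Fin 2 × Fin N → ℝ}
    (hu : jointMatrix A P *ᵥ u = jointMatrix A P *ᵥ u') : u = u' := by
  have := congrArg ((jointMatrix A P)⁻¹ *ᵥ ·) hu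
  simpa [Matrix.mulVec_mulVec, Matrix.nonsing_inv_mul _ W.isUnit_jointMatrix] using this

theorem inv_symm (u u' : Fin 2 × Fin N → ℝ) :
    u ⬝ᵥ (jointMatrix A P)⁻¹ *ᵥ u' = ((jointMatrix A P)⁻¹ *ᵥ u) ⬝ᵥ u' := by
  rw [Matrix.dotProduct_mulVec, ← Matrix.mulVec_transpose, Matrix.transpose_nonsing_inv,
    W.jointMatrix_transpose]

theorem jointDesign_nullVec : jointDesign A *ᵥ nullVec N = 0 := by
  have h0 : part 0 (nullVec N) = 1 := by funext k; simp [part, nullVec]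
  have h1 : part 1 (nullVec N) = -1 := by funext k; simp [part, nullVec]
  rw [jointDesign_mulVec, h0, h1, Matrix.mulVec_neg, W.mulVec_one, W.mulVec_one]
  simp

theorem sumVec_nullVec : sumVec A ⬝ᵥ nullVec N = -n := by
  have h1 : part 1 (nullVec N) = -1 := by funext k; simp [part, nullVec]
  rw [sumVec, emb_dotProduct, h1, dotProduct_neg, Matrix.mulVec_transpose, ← Matrix.dotProduct_mulVec,
    W.mulVec_one]
  simp [dotProduct]

theorem jointPenalty_nullVec : jointPenalty P *ᵥ nullVec N = 0 := by
  have h0 : part 0 (nullVec N) = 1 := by funext k; simp [part, nullVec]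
  have h1 : part 1 (nullVec N) = -1 := by funext k; simp [part, nullVec]
  have key : ∀ j, part j (jointPenalty P *ᵥ nullVec N) = 0 := by
    intro j
    rw [part_jointPenalty_mulVec]
    fin_cases j
    · simp [h0, W.pen_one]
    · simp [h1, Matrix.mulVec_neg, W.pen_one]
  funext a
  exact congrFun (key a.1) a.2

/-- Design and penalties annihilate the null direction, so only the rank-one term survives. This
identity ties a multiple of `sumVec` on the right-hand side to the mean of the second component. -/
theorem jointMatrix_nullVec : jointMatrix A P *ᵥ nullVec N = - sumVec A := by
  rw [jointMatrix_mulVec, W.jointDesign_nullVec, W.jointPenalty_nullVec, W.sumVec_nullVec]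
  have := W.n_pos'.ne'
  simp [this]

/-- A solution of the definite system whose right-hand side is orthogonal to the null direction
up to a multiple of `sumVec`. -/
theorem sumVec_dotProduct_of_eq {u b : Fin 2 × Fin N → ℝ} {t : ℝ} (hu : nullVec N ⬝ᵥ u = 0)
    (hb : jointMatrix A P *ᵥ b = u + (t / n) • sumVec A) : sumVec A ⬝ᵥ b = t := by
  -- Pairing the system with the null direction isolates the mean.
  have h1 : nullVec N ⬝ᵥ jointMatrix A P *ᵥ b = - (sumVec A ⬝ᵥ b) := by
    rw [Matrix.dotProduct_mulVec, ← Matrix.mulVec_transpose, W.jointMatrix_transpose,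
      W.jointMatrix_nullVec, neg_dotProduct]
  rw [hb, dotProduct_add, hu, dotProduct_smul, dotProduct_comm, W.sumVec_nullVec] at h1
  have := W.n_pos'.ne'
  simp only [smul_eq_mul] at h1
  field_simp at h1
  linarith

/-- The solution has mean t, so its rank-one term equals the multiple of `sumVec` added on the
right. The two cancel and the original singular equations remain. -/
theorem normal_equations {u b : Fin 2 × Fin N → ℝ} {t : ℝ} (hu : nullVec N ⬝ᵥ u = 0)
    (hb : jointMatrix A P *ᵥ b = u + (t / n) • sumVec A) (j j' : Fin 2) (hjj : j ≠ j') :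
    ((A j)ᵀ * A j + P j) *ᵥ part j b + (A j)ᵀ *ᵥ (A j' *ᵥ part j' b) = part j u := by
  have ht := W.sumVec_dotProduct_of_eq hu hb
  rw [jointMatrix_mulVec, ht, div_eq_inv_mul, add_left_inj] at hb
  have h1 := congrArg (part j) hb
  rw [part_add, part_transpose_jointDesign_mulVec, part_jointPenalty_mulVec, jointDesign_mulVec] at h1
  have h2 : A 0 *ᵥ part 0 b + A 1 *ᵥ part 1 b = A j *ᵥ part j b + A j' *ᵥ part j' b := by
    fin_cases j <;> fin_cases j' <;> simp at hjj ⊢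
    exact add_comm _ _
  rw [h2, Matrix.mulVec_add] at h1
  rw [← h1, Matrix.add_mulVec, ← Matrix.mulVec_mulVec]
  abel

theorem nullVec_transpose_jointDesign (r : Fin n → ℝ) :
    nullVec N ⬝ᵥ ((jointDesign A)ᵀ *ᵥ r) = 0 := by
  rw [Matrix.dotProduct_mulVec, Matrix.vecMul_transpose, W.jointDesign_nullVec, zero_dotProduct]

theorem jointPenalty_symm (a b : Fin 2 × Fin N → ℝ) :
    a ⬝ᵥ (jointPenalty P *ᵥ b) = (jointPenalty P *ᵥ a) ⬝ᵥ b := by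
  simp only [dotProduct_eq_part, part_jointPenalty_mulVec]
  have : ∀ j (x y : Fin N → ℝ), x ⬝ᵥ P j *ᵥ y = P j *ᵥ x ⬝ᵥ y := by
    intro j x y
    rw [Matrix.dotProduct_mulVec, ← Matrix.mulVec_transpose, W.pen_symm]
  rw [this, this]

theorem nullVec_jointPenalty (b : Fin 2 × Fin N → ℝ) :
    nullVec N ⬝ᵥ (jointPenalty P *ᵥ b) = 0 := by
  rw [W.jointPenalty_symm, W.jointPenalty_nullVec, zero_dotProduct]

theorem lam_transpose (j : Fin 2) : ((A j)ᵀ * A j + P j)ᵀ = (A j)ᵀ * A j + P j := by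
  rw [Matrix.transpose_add, W.pen_symm, Matrix.transpose_mul, Matrix.transpose_transpose]

/-- The joint bound is tested on a vector supported in block j. By Cauchy-Schwarz against the
constant vector the mean term is at most the Gram form, which costs the factor 2. -/
theorem gram_lower (j : Fin 2) (x : Fin N → ℝ) :
    c / 2 * h * (x ⬝ᵥ x) ≤ (A j *ᵥ x) ⬝ᵥ (A j *ᵥ x) := by
  have h1 := W.lower (emb j x)
  have hx : emb j x ⬝ᵥ emb j x = x ⬝ᵥ x := by
    rw [emb_dotProduct]; congr 1; funext k; simp [part, emb]
  have hA : jointDesign A *ᵥ emb j x = A j *ᵥ x := by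
    rw [jointDesign_mulVec]
    have e : ∀ j', part j' (emb j x) = if j' = j then x else 0 := by
      intro j'; funext k; simp [part, emb]; split_ifs <;> rfl
    rw [e, e]
    fin_cases j <;> simp
  have hs : (n : ℝ)⁻¹ * (sumVec A ⬝ᵥ emb j x) ^ 2 ≤ (A j *ᵥ x) ⬝ᵥ (A j *ᵥ x) := by
    have hp := dotProduct_self_nonneg' (A j *ᵥ x)
    have e : sumVec A ⬝ᵥ emb j x = if j = 1 then 1 ⬝ᵥ (A 1 *ᵥ x) else 0 := by
      rw [dotProduct_comm, emb_dotProduct]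
      have : part j (sumVec A) = if j = 1 then (A 1)ᵀ *ᵥ 1 else 0 := by
        funext k; simp [part, sumVec, emb]; split_ifs <;> rfl
      rw [this]
      split_ifs
      · rw [Matrix.dotProduct_mulVec, Matrix.vecMul_transpose, dotProduct_comm]
      · simp
    rw [e]
    split_ifs with hj
    · subst hj
      have := dotProduct_sq_le (1 : Fin n → ℝ) (A 1 *ᵥ x)
      have hn : (1 : Fin n → ℝ) ⬝ᵥ 1 = n := by simp [dotProduct]
      rw [hn] at this
      rw [inv_mul_le_iff₀ W.n_pos']
      exact this
    · simpa using hp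
  rw [hx, hA] at h1
  linarith

theorem lam_lower (j : Fin 2) (x : Fin N → ℝ) :
    c / 2 * h * (x ⬝ᵥ x) ≤ x ⬝ᵥ ((A j)ᵀ * A j + P j) *ᵥ x := by
  rw [Matrix.add_mulVec, dotProduct_add, dotProduct_gram]
  have := W.gram_lower j x
  have := W.pen_nonneg j x
  linarith

theorem ch2_pos : 0 < c / 2 * h := mul_pos (half_pos W.c_pos) W.h_pos

theorem isUnit_lam (j : Fin 2) : IsUnit ((A j)ᵀ * A j + P j).det :=
  isUnit_det_of_form_lower W.ch2_pos (W.lam_lower j)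

theorem lam_mulVec_inv (j : Fin 2) (u : Fin N → ℝ) :
    ((A j)ᵀ * A j + P j) *ᵥ (((A j)ᵀ * A j + P j)⁻¹ *ᵥ u) = u := by
  rw [Matrix.mulVec_mulVec, Matrix.mul_nonsing_inv _ (W.isUnit_lam j), Matrix.one_mulVec]

theorem lam_inv_mulVec (j : Fin 2) (u : Fin N → ℝ) :
    ((A j)ᵀ * A j + P j)⁻¹ *ᵥ (((A j)ᵀ * A j + P j) *ᵥ u) = u := by
  rw [Matrix.mulVec_mulVec, Matrix.nonsing_inv_mul _ (W.isUnit_lam j), Matrix.one_mulVec]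

theorem lam_inv_symm (j : Fin 2) (x y : Fin N → ℝ) :
    x ⬝ᵥ ((A j)ᵀ * A j + P j)⁻¹ *ᵥ y = ((A j)ᵀ * A j + P j)⁻¹ *ᵥ x ⬝ᵥ y := by
  rw [Matrix.dotProduct_mulVec, ← Matrix.mulVec_transpose, Matrix.transpose_nonsing_inv,
    W.lam_transpose]

/-- The smoother reproduces constants because the penalty kills them. Transposed, this says that
smoothing preserves sample means. -/
theorem lam_inv_transpose_one (j : Fin 2) :
    ((A j)ᵀ * A j + P j)⁻¹ *ᵥ ((A j)ᵀ *ᵥ 1) = 1 := by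
  have : (A j)ᵀ *ᵥ 1 = ((A j)ᵀ * A j + P j) *ᵥ 1 := by
    rw [Matrix.add_mulVec, W.pen_one, ← Matrix.mulVec_mulVec, W.mulVec_one, add_zero]
  rw [this, W.lam_inv_mulVec]

end WellConditioned

end JointSystem

/-! ### Convergence of backfitting -/

namespace WellConditioned

variable {n N : ℕ} {A : Fin 2 → Matrix (Fin n) (Fin N) ℝ} {P : Fin 2 → Matrix (Fin N) (Fin N) ℝ}
  {h c C : ℝ} (W : WellConditioned A P h c C)
include W

/-- The quadratic form of the backfitting iteration is a strict contraction on the centred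
coefficient vectors. -/
theorem backfit_form_le {δ : Fin N → ℝ} (hδ : (1 : Fin n → ℝ) ⬝ᵥ (A 1 *ᵥ δ) = 0) :
    δ ⬝ᵥ (((A 0)ᵀ * A 1)ᵀ * ((A 0)ᵀ * A 0 + P 0)⁻¹ * ((A 0)ᵀ * A 1)) *ᵥ δ ≤
      (1 - c / C) * (δ ⬝ᵥ ((A 1)ᵀ * A 1 + P 1) *ᵥ δ) := by
  set x := ((A 0)ᵀ * A 0 + P 0)⁻¹ *ᵥ (((A 0)ᵀ * A 1) *ᵥ δ) with hx
  have hG : δ ⬝ᵥ (((A 0)ᵀ * A 1)ᵀ * ((A 0)ᵀ * A 0 + P 0)⁻¹ * ((A 0)ᵀ * A 1)) *ᵥ δ =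
      (A 0 *ᵥ x) ⬝ᵥ (A 1 *ᵥ δ) := by
    rw [Matrix.mul_assoc, ← Matrix.mulVec_mulVec, Matrix.dotProduct_mulVec, Matrix.vecMul_transpose,
      ← Matrix.mulVec_mulVec δ (((A 0)ᵀ * A 0 + P 0)⁻¹), ← hx, ← Matrix.mulVec_mulVec,
      dotProduct_comm, Matrix.dotProduct_mulVec,
      Matrix.vecMul_transpose]
  have hxx : x ⬝ᵥ ((A 0)ᵀ * A 0 + P 0) *ᵥ x = (A 0 *ᵥ x) ⬝ᵥ (A 1 *ᵥ δ) := by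
    conv_lhs => rw [hx, W.lam_mulVec_inv, ← hx]
    rw [← Matrix.mulVec_mulVec, Matrix.dotProduct_mulVec, Matrix.vecMul_transpose]
  -- Given δ as second block, -x is the first block that minimizes the penalized form. The minimum
  -- is the Λ₁-energy of δ minus the form to be bounded, and the joint lower bound makes it at least
  -- c/C times that energy.
  set b : Fin 2 × Fin N → ℝ := fun a => if a.1 = 0 then - x a.2 else δ a.2 with hb
  have b0 : part 0 b = - x := by funext k; simp [part, hb]
  have b1 : part 1 b = δ := by funext k; simp [part, hb]
  have hs : sumVec A ⬝ᵥ b = 0 := by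
    rw [sumVec, emb_dotProduct, b1, ← hδ, Matrix.mulVec_transpose, ← Matrix.dotProduct_mulVec]
  have h1 := W.jointMatrix_lower b
  rw [W.jointMatrix_form, hs, jointDesign_mulVec, dotProduct_eq_part b (jointPenalty P *ᵥ b),
    part_jointPenalty_mulVec, part_jointPenalty_mulVec, b0, b1, dotProduct_eq_part b b, b0, b1] at h1
  simp only [Matrix.mulVec_neg, dotProduct_neg, neg_dotProduct, neg_neg, dotProduct_add,
    add_dotProduct] at h1
  rw [Matrix.add_mulVec, dotProduct_add, dotProduct_gram] at hxx
  have h2 := W.upper 1 δ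
  have hc := W.c_pos
  have hC : 0 < C := hc.trans_le W.c_le
  have h3 : c / C * (δ ⬝ᵥ ((A 1)ᵀ * A 1 + P 1) *ᵥ δ) ≤ c * h * (δ ⬝ᵥ δ) := by
    calc _ ≤ c / C * (C * h * (δ ⬝ᵥ δ)) := by gcongr
      _ = _ := by field_simp
  have hxn := dotProduct_self_nonneg' x
  have h4 := mul_nonneg W.ch_pos.le hxn
  rw [hG, sub_mul, one_mul]
  have h5 : δ ⬝ᵥ ((A 1)ᵀ * A 1 + P 1) *ᵥ δ = (A 1 *ᵥ δ) ⬝ᵥ (A 1 *ᵥ δ) + δ ⬝ᵥ P 1 *ᵥ δ := by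
    rw [Matrix.add_mulVec, dotProduct_add, dotProduct_gram]
  rw [h5] at h3 ⊢
  have h6 := dotProduct_comm (A 1 *ᵥ δ) (A 0 *ᵥ x)
  rw [h6, mul_add] at h1
  linarith

theorem backfit_form_nonneg (δ : Fin N → ℝ) :
    0 ≤ δ ⬝ᵥ (((A 0)ᵀ * A 1)ᵀ * ((A 0)ᵀ * A 0 + P 0)⁻¹ * ((A 0)ᵀ * A 1)) *ᵥ δ := by
  set x := ((A 0)ᵀ * A 0 + P 0)⁻¹ *ᵥ (((A 0)ᵀ * A 1) *ᵥ δ) with hx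
  have : δ ⬝ᵥ (((A 0)ᵀ * A 1)ᵀ * ((A 0)ᵀ * A 0 + P 0)⁻¹ * ((A 0)ᵀ * A 1)) *ᵥ δ =
      x ⬝ᵥ ((A 0)ᵀ * A 0 + P 0) *ᵥ x := by
    rw [Matrix.mul_assoc, ← Matrix.mulVec_mulVec, Matrix.dotProduct_mulVec, Matrix.vecMul_transpose,
      ← Matrix.mulVec_mulVec δ (((A 0)ᵀ * A 0 + P 0)⁻¹), ← hx, dotProduct_comm]
    conv_rhs => rw [hx, W.lam_mulVec_inv, ← hx]
  rw [this]
  have := W.lam_lower 0 x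
  have h2 := mul_nonneg W.ch2_pos.le (dotProduct_self_nonneg' x)
  linarith

/-- A sweep acts on the error of the second block as Λ₁⁻¹G with G symmetric and positive
semidefinite. Cauchy-Schwarz for G turns the form bound on centred vectors into a contraction of the
Λ₁-energy. Centring persists because the smoothers preserve sample means. -/
theorem backfit_step {δ : Fin N → ℝ} (hδ : (1 : Fin n → ℝ) ⬝ᵥ (A 1 *ᵥ δ) = 0) {δ' : Fin N → ℝ}
    (hδ' : δ' = ((A 1)ᵀ * A 1 + P 1)⁻¹ *ᵥ ((A 1)ᵀ *ᵥ (A 0 *ᵥ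
      (((A 0)ᵀ * A 0 + P 0)⁻¹ *ᵥ ((A 0)ᵀ *ᵥ (A 1 *ᵥ δ)))))) :
    (1 : Fin n → ℝ) ⬝ᵥ (A 1 *ᵥ δ') = 0 ∧
      δ' ⬝ᵥ ((A 1)ᵀ * A 1 + P 1) *ᵥ δ' ≤
        (1 - c / C) ^ 2 * (δ ⬝ᵥ ((A 1)ᵀ * A 1 + P 1) *ᵥ δ) := by
  have hone : ∀ (j : Fin 2) (u : Fin N → ℝ), (1 : Fin n → ℝ) ⬝ᵥ
      (A j *ᵥ (((A j)ᵀ * A j + P j)⁻¹ *ᵥ u)) = 1 ⬝ᵥ u := by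
    intro j u
    rw [Matrix.dotProduct_mulVec, ← Matrix.mulVec_transpose, W.lam_inv_symm, W.lam_inv_transpose_one]
  have hone' : ∀ (j : Fin 2) (u : Fin n → ℝ), (1 : Fin N → ℝ) ⬝ᵥ ((A j)ᵀ *ᵥ u) = 1 ⬝ᵥ u := by
    intro j u
    rw [Matrix.dotProduct_mulVec, Matrix.vecMul_transpose, W.mulVec_one]
  have hzero : (1 : Fin n → ℝ) ⬝ᵥ (A 1 *ᵥ δ') = 0 := by
    rw [hδ', hone, hone', hone, hone', hδ]
  refine ⟨hzero, ?_⟩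
  set Lm := (A 1)ᵀ * A 1 + P 1 with hLm
  set G := ((A 0)ᵀ * A 1)ᵀ * ((A 0)ᵀ * A 0 + P 0)⁻¹ * ((A 0)ᵀ * A 1) with hG
  have hLd : Lm *ᵥ δ' = G *ᵥ δ := by
    rw [hδ', W.lam_mulVec_inv, hG]
    simp only [Matrix.transpose_mul, Matrix.transpose_transpose, Matrix.mulVec_mulVec,
      Matrix.mul_assoc]
  have hGt : Gᵀ = G := by
    rw [hG, Matrix.transpose_mul (((A 0)ᵀ * A 1)ᵀ * _), Matrix.transpose_mul (((A 0)ᵀ * A 1)ᵀ),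
      Matrix.transpose_nonsing_inv, W.lam_transpose, Matrix.transpose_transpose, Matrix.mul_assoc]
  have hcs := dotProduct_mulVec_sq_le hGt W.backfit_form_nonneg δ' δ
  have f1 := W.backfit_form_le hδ
  have f2 := W.backfit_form_le hzero
  rw [← hG, ← hLm] at f1 f2
  nth_rw 1 [← hLd] at hcs
  have hc := W.c_pos
  have hC : 0 < C := hc.trans_le W.c_le
  have hq : 0 ≤ 1 - c / C := by rw [sub_nonneg, div_le_one hC]; exact W.c_le
  have p1 : 0 ≤ δ' ⬝ᵥ Lm *ᵥ δ' :=
    (mul_nonneg W.ch2_pos.le (dotProduct_self_nonneg' _)).trans (W.lam_lower 1 δ')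
  have p2 : 0 ≤ δ ⬝ᵥ Lm *ᵥ δ :=
    (mul_nonneg W.ch2_pos.le (dotProduct_self_nonneg' _)).trans (W.lam_lower 1 δ)
  rcases p1.eq_or_lt with h5 | h5
  · rw [← h5]; positivity
  · have h6 : (δ' ⬝ᵥ Lm *ᵥ δ') ^ 2 ≤ ((1 - c / C) * (δ' ⬝ᵥ Lm *ᵥ δ')) * ((1 - c / C) * (δ ⬝ᵥ Lm *ᵥ δ)) :=
      hcs.trans (mul_le_mul f2 f1 (W.backfit_form_nonneg _) (mul_nonneg hq p1))
    have : (δ' ⬝ᵥ Lm *ᵥ δ') * (δ' ⬝ᵥ Lm *ᵥ δ') ≤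
        (δ' ⬝ᵥ Lm *ᵥ δ') * ((1 - c / C) ^ 2 * (δ ⬝ᵥ Lm *ᵥ δ)) := by nlinarith
    exact le_of_mul_le_mul_left this h5

/-- Backfitting converges to the solution of the normal equations whose second component has the
same sample mean as the initial value. -/
theorem tendsto_backfit {y : Fin n → ℝ} {b : Fin 2 × Fin N → ℝ}
    {s : ℕ → (Fin N → ℝ) × (Fin N → ℝ)}
    (hs0 : ∀ l, (s (l + 1)).1 = ((A 0)ᵀ * A 0 + P 0)⁻¹ *ᵥ ((A 0)ᵀ *ᵥ (y - A 1 *ᵥ (s l).2)))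
    (hs1 : ∀ l, (s (l + 1)).2 =
      ((A 1)ᵀ * A 1 + P 1)⁻¹ *ᵥ ((A 1)ᵀ *ᵥ (y - A 0 *ᵥ (s (l + 1)).1)))
    (hb : ∀ j j' : Fin 2, j ≠ j' →
      ((A j)ᵀ * A j + P j) *ᵥ part j b + (A j)ᵀ *ᵥ (A j' *ᵥ part j' b) = (A j)ᵀ *ᵥ y)
    (hmean : sumVec A ⬝ᵥ b = 1 ⬝ᵥ (A 1 *ᵥ (s 0).2)) :
    Tendsto s atTop (𝓝 (part 0 b, part 1 b)) := by
  have hfix : ∀ j j' : Fin 2, j ≠ j' →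
      part j b = ((A j)ᵀ * A j + P j)⁻¹ *ᵥ ((A j)ᵀ *ᵥ (y - A j' *ᵥ part j' b)) := by
    intro j j' hj
    have := hb j j' hj
    rw [Matrix.mulVec_sub, ← this, add_sub_cancel_right, W.lam_inv_mulVec]
  set δ : ℕ → Fin N → ℝ := fun l => (s l).2 - part 1 b with hδ
  have h1 : ∀ l, (s (l + 1)).1 - part 0 b =
      - (((A 0)ᵀ * A 0 + P 0)⁻¹ *ᵥ ((A 0)ᵀ *ᵥ (A 1 *ᵥ δ l))) := by
    intro l
    rw [hs0, hfix 0 1 (by simp), ← Matrix.mulVec_sub, ← Matrix.mulVec_sub, sub_sub_sub_cancel_left,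
      ← Matrix.mulVec_sub, ← Matrix.mulVec_neg, ← Matrix.mulVec_neg, ← Matrix.mulVec_neg, hδ, neg_sub]
  have h2 : ∀ l, δ (l + 1) = ((A 1)ᵀ * A 1 + P 1)⁻¹ *ᵥ ((A 1)ᵀ *ᵥ (A 0 *ᵥ
      (((A 0)ᵀ * A 0 + P 0)⁻¹ *ᵥ ((A 0)ᵀ *ᵥ (A 1 *ᵥ δ l))))) := by
    intro l
    have e : part 0 b - (s (l + 1)).1 =
        ((A 0)ᵀ * A 0 + P 0)⁻¹ *ᵥ ((A 0)ᵀ *ᵥ (A 1 *ᵥ δ l)) := by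
      rw [← neg_sub, h1, neg_neg]
    rw [← e]
    simp only [hδ]
    rw [hs1, hfix 1 0 (by simp), ← Matrix.mulVec_sub, ← Matrix.mulVec_sub, sub_sub_sub_cancel_left,
      ← Matrix.mulVec_sub]
  have h0 : (1 : Fin n → ℝ) ⬝ᵥ (A 1 *ᵥ δ 0) = 0 := by
    simp only [hδ]
    rw [Matrix.mulVec_sub, dotProduct_sub, ← hmean, sumVec, emb_dotProduct, Matrix.mulVec_transpose,
      ← Matrix.dotProduct_mulVec, sub_self]
  have hen : ∀ l, (1 : Fin n → ℝ) ⬝ᵥ (A 1 *ᵥ δ l) = 0 ∧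
      δ l ⬝ᵥ ((A 1)ᵀ * A 1 + P 1) *ᵥ δ l ≤
        ((1 - c / C) ^ 2) ^ l * (δ 0 ⬝ᵥ ((A 1)ᵀ * A 1 + P 1) *ᵥ δ 0) := by
    intro l
    induction l with
    | zero => exact ⟨h0, by simp⟩
    | succ l ih =>
      have := W.backfit_step ih.1 (h2 l)
      refine ⟨this.1, this.2.trans ?_⟩
      rw [pow_succ' ((1 - c / C) ^ 2), mul_assoc]
      exact mul_le_mul_of_nonneg_left ih.2 (sq_nonneg _)
  have hc := W.c_pos
  have hC : 0 < C := hc.trans_le W.c_le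
  have hq : 0 ≤ 1 - c / C := by rw [sub_nonneg, div_le_one hC]; exact W.c_le
  have hq1 : 1 - c / C < 1 := by have : 0 < c / C := by positivity
                                 linarith
  have hδ0 : Tendsto δ atTop (𝓝 0) := by
    rw [tendsto_pi_nhds]
    intro k
    refine (tendsto_zero_iff_abs_tendsto_zero _).mpr ?_
    have hsq : Tendsto (fun l => (δ l k) ^ 2) atTop (𝓝 0) := by
      have hlim : Tendsto (fun l : ℕ => (((1 - c / C) ^ 2) ^ l *
          (δ 0 ⬝ᵥ ((A 1)ᵀ * A 1 + P 1) *ᵥ δ 0)) / (c / 2 * h)) atTop (𝓝 0) := by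
        have := tendsto_pow_atTop_nhds_zero_of_lt_one (sq_nonneg (1 - c / C))
          (pow_lt_one₀ hq hq1 two_ne_zero)
        simpa using (this.mul_const (δ 0 ⬝ᵥ ((A 1)ᵀ * A 1 + P 1) *ᵥ δ 0)).div_const (c / 2 * h)
      refine squeeze_zero (fun l => sq_nonneg _) (fun l => ?_) hlim
      rw [le_div_iff₀ W.ch2_pos]
      calc (δ l k) ^ 2 * (c / 2 * h) ≤ (δ l ⬝ᵥ δ l) * (c / 2 * h) :=
            mul_le_mul_of_nonneg_right (sq_apply_le_dotProduct_self _ _) W.ch2_pos.le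
        _ = c / 2 * h * (δ l ⬝ᵥ δ l) := mul_comm _ _
        _ ≤ _ := (W.lam_lower 1 _).trans (hen l).2
    have := hsq.sqrt
    simpa [Real.sqrt_sq_eq_abs, Function.comp_def] using this
  have hlim2 : Tendsto (fun l => (s l).2) atTop (𝓝 (part 1 b)) := by
    have := hδ0.add_const (part 1 b)
    simpa [hδ] using this
  refine Tendsto.prodMk_nhds ?_ hlim2
  -- The first block at stage 0 is arbitrary; from stage 1 on it is a continuous function of the
  -- preceding second block.
  rw [← tendsto_add_atTop_iff_nat 1]
  have hcont : Continuous fun x : Fin N → ℝ =>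
      - (((A 0)ᵀ * A 0 + P 0)⁻¹ *ᵥ ((A 0)ᵀ *ᵥ (A 1 *ᵥ x))) := by fun_prop
  have := (hcont.tendsto 0).comp hδ0
  have h3 := this.add_const (part 0 b)
  simp only [Matrix.mulVec_zero, neg_zero, zero_add] at h3
  refine h3.congr fun l => ?_
  simp only [Function.comp]
  rw [← h1 l, sub_add_cancel]

end WellConditioned

theorem dotProduct_transpose_mulVec {ι κ : Type*} [Fintype ι] [Fintype κ] (A : Matrix κ ι ℝ)
    (x : ι → ℝ) (y : κ → ℝ) : x ⬝ᵥ (Aᵀ *ᵥ y) = (A *ᵥ x) ⬝ᵥ y := by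
  rw [Matrix.dotProduct_mulVec, Matrix.vecMul_transpose]

theorem transpose_mulVec_dotProduct {ι κ : Type*} [Fintype ι] [Fintype κ] (A : Matrix κ ι ℝ)
    (x : ι → ℝ) (y : κ → ℝ) : (Aᵀ *ᵥ y) ⬝ᵥ x = y ⬝ᵥ (A *ᵥ x) := by
  rw [dotProduct_comm, dotProduct_transpose_mulVec, dotProduct_comm]

/-! ### Weights of the errors in the estimator -/

section Weights
variable {n N : ℕ}

/-- The weights with which the errors enter the value of the component `j` at the point with basis
vector `B`. -/
noncomputable def weight (A : Fin 2 → Matrix (Fin n) (Fin N) ℝ)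
    (P : Fin 2 → Matrix (Fin N) (Fin N) ℝ) (j : Fin 2) (B : Fin N → ℝ) : Fin n → ℝ :=
  jointDesign A *ᵥ ((jointMatrix A P)⁻¹ *ᵥ emb j B)

/-- The vector `Λ_j⁻¹ B`. -/
noncomputable def blockWeight (A : Fin 2 → Matrix (Fin n) (Fin N) ℝ)
    (P : Fin 2 → Matrix (Fin N) (Fin N) ℝ) (j : Fin 2) (B : Fin N → ℝ) : Fin N → ℝ :=
  ((A j)ᵀ * A j + P j)⁻¹ *ᵥ B

/-- The vector `A_{j'}ᵀ A_j Λ_j⁻¹ B`. -/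
noncomputable def crossWeight (A : Fin 2 → Matrix (Fin n) (Fin N) ℝ)
    (P : Fin 2 → Matrix (Fin N) (Fin N) ℝ) (j j' : Fin 2) (B : Fin N → ℝ) : Fin N → ℝ :=
  (A j')ᵀ *ᵥ (A j *ᵥ blockWeight A P j B)

/-- The profile of exponential decay away from the support of `B`. -/
noncomputable def decayWeight (q : ℝ) (w : ℕ) (B : Fin N → ℝ) (k : Fin N) : ℝ :=
  ∑ l, B l * q ^ (Nat.dist k l / w)

theorem decayWeight_nonneg {q : ℝ} (hq : 0 ≤ q) (w : ℕ) {B : Fin N → ℝ} (hB : ∀ k, 0 ≤ B k)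
    (k : Fin N) : 0 ≤ decayWeight q w B k :=
  Finset.sum_nonneg fun l _ => mul_nonneg (hB l) (by positivity)

/-- The mass of the profile is bounded independently of the dimension N, so that sums against it
behave like sums over boundedly many indices. -/
theorem sum_decayWeight_le {q : ℝ} (h0 : 0 ≤ q) (h1 : q < 1) {w : ℕ} (hw : 0 < w) {B : Fin N → ℝ}
    (hB : ∀ k, 0 ≤ B k) (hB1 : ∑ k, B k = 1) :
    ∑ k, decayWeight q w B k ≤ 2 * (w / (1 - q)) := by
  unfold decayWeight
  rw [Finset.sum_comm]
  calc _ ≤ ∑ l, B l * (2 * (w / (1 - q))) := by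
        refine Finset.sum_le_sum fun l _ => ?_
        rw [← Finset.mul_sum]
        exact mul_le_mul_of_nonneg_left (sum_pow_dist_div_le h0 h1 hw l) (hB l)
    _ = _ := by rw [← Finset.sum_mul, hB1, one_mul]

end Weights

/-! ### Size of the weights, covariance and bias on a good sample -/

namespace WellConditioned

variable {n N : ℕ} {A : Fin 2 → Matrix (Fin n) (Fin N) ℝ} {P : Fin 2 → Matrix (Fin N) (Fin N) ℝ}
  {h c C : ℝ} (W : WellConditioned A P h c C)
include W

theorem entry_le_one (j : Fin 2) (i : Fin n) (k : Fin N) : A j i k ≤ 1 := by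
  rw [← W.row_sum j i]
  exact Finset.single_le_sum (fun k _ => W.nonneg j i k) (Finset.mem_univ k)

theorem weight_dotProduct (j : Fin 2) (B : Fin N → ℝ) (r : Fin n → ℝ) :
    weight A P j B ⬝ᵥ r = B ⬝ᵥ part j ((jointMatrix A P)⁻¹ *ᵥ ((jointDesign A)ᵀ *ᵥ r)) := by
  rw [weight, ← emb_dotProduct, W.inv_symm, Matrix.dotProduct_mulVec _ (jointDesign A)ᵀ,
    Matrix.vecMul_transpose]

theorem blockWeight_dotProduct (j : Fin 2) (B x : Fin N → ℝ) :
    blockWeight A P j B ⬝ᵥ (((A j)ᵀ * A j + P j) *ᵥ x) = B ⬝ᵥ x := by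
  rw [blockWeight, ← W.lam_inv_symm, W.lam_inv_mulVec]

/-- The value at a point expressed through the decaying vector `Λ_j⁻¹ B`. -/
theorem dotProduct_part_of_normal_equations {u b : Fin 2 × Fin N → ℝ} {t : ℝ}
    (hu : nullVec N ⬝ᵥ u = 0) (hb : jointMatrix A P *ᵥ b = u + (t / n) • sumVec A) {j j' : Fin 2}
    (hjj : j ≠ j') (B : Fin N → ℝ) :
    B ⬝ᵥ part j b =
      blockWeight A P j B ⬝ᵥ part j u - crossWeight A P j j' B ⬝ᵥ part j' b := by
  rw [← W.normal_equations hu hb j j' hjj, dotProduct_add, W.blockWeight_dotProduct, crossWeight,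
    transpose_mulVec_dotProduct, dotProduct_transpose_mulVec, add_sub_cancel_right]

theorem jointMatrix_mulVec_inv' (u : Fin 2 × Fin N → ℝ) :
    jointMatrix A P *ᵥ ((jointMatrix A P)⁻¹ *ᵥ u) = u + ((0 : ℝ) / n) • sumVec A := by
  rw [W.jointMatrix_mulVec_inv]; simp

/-- Eliminating block j from the normal equations leaves the one-component smoother, which is local,
minus the value of the other block tested against the cross weight. The latter is small because the
cross Gram matrix has entries of order n/K² only. -/
theorem weight_eq {j j' : Fin 2} (hjj : j ≠ j') (B : Fin N → ℝ) :
    weight A P j B = A j *ᵥ blockWeight A P j B - weight A P j' (crossWeight A P j j' B) := by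
  rw [← sub_eq_zero]
  -- The identity is checked against an arbitrary response r, where the weights become values of the
  -- solution for r.
  suffices hr : ∀ r : Fin n → ℝ, (weight A P j B -
      (A j *ᵥ blockWeight A P j B - weight A P j' (crossWeight A P j j' B))) ⬝ᵥ r = 0 from
    dotProduct_self_eq_zero.mp (hr _)
  intro r
  have hu := W.nullVec_transpose_jointDesign r
  have h1 := W.dotProduct_part_of_normal_equations hu (W.jointMatrix_mulVec_inv' _) hjj B
  rw [sub_dotProduct, sub_dotProduct, W.weight_dotProduct, W.weight_dotProduct, h1,
    part_transpose_jointDesign_mulVec, Matrix.dotProduct_mulVec _ (A j)ᵀ, Matrix.vecMul_transpose]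
  ring

theorem emb_dotProduct_self (j : Fin 2) (B : Fin N → ℝ) : emb j B ⬝ᵥ emb j B = B ⬝ᵥ B := by
  rw [emb_dotProduct]; congr 1; funext k; simp [part, emb]

/-- The form of the joint matrix at its solution for B dominates the design part, the penalty and
mean terms being nonnegative. This is the upper bound of order 1/h for the variance. -/
theorem weight_dotProduct_self_le (j : Fin 2) (B : Fin N → ℝ) :
    weight A P j B ⬝ᵥ weight A P j B ≤ (B ⬝ᵥ B) / (c * h) := by
  have h1 := dotProduct_mulVec_le_of_form_lower W.ch_pos W.jointMatrix_lower
    ((jointMatrix A P)⁻¹ *ᵥ emb j B)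
  rw [W.jointMatrix_form, W.jointMatrix_mulVec_inv, W.emb_dotProduct_self] at h1
  have h2 := W.jointPenalty_form ((jointMatrix A P)⁻¹ *ᵥ emb j B)
  have h3 : 0 ≤ (n : ℝ)⁻¹ * (sumVec A ⬝ᵥ ((jointMatrix A P)⁻¹ *ᵥ emb j B)) ^ 2 := by positivity
  unfold weight
  linarith

theorem jointDesign_row_sq_le (i : Fin n) : jointDesign A i ⬝ᵥ jointDesign A i ≤ 2 := by
  have key : ∀ j, A j i ⬝ᵥ A j i ≤ 1 := by
    intro j
    calc _ ≤ ∑ k, A j i k * 1 := Finset.sum_le_sum fun k _ =>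
          mul_le_mul_of_nonneg_left (W.entry_le_one j i k) (W.nonneg j i k)
      _ = 1 := by simp only [mul_one]; exact W.row_sum j i
  rw [dotProduct_eq_part]
  have h0 := key 0
  have h1 := key 1
  change A 0 i ⬝ᵥ A 0 i + A 1 i ⬝ᵥ A 1 i ≤ 2
  linarith

/-- A design row has squared norm at most 2 and the inverse joint matrix has norm at most 1/(ch).
Single weights are thus of order 1/h, against a Euclidean norm of order h^(-1/2), which is what a
Lyapunov condition needs. -/
theorem abs_weight_le (j : Fin 2) {B : Fin N → ℝ} (hB : B ⬝ᵥ B ≤ 1) (i : Fin n) :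
    |weight A P j B i| ≤ 2 / (c * h) := by
  have h1 := dotProduct_self_le_of_form_lower W.ch_pos W.jointMatrix_lower
    ((jointMatrix A P)⁻¹ *ᵥ emb j B)
  rw [W.jointMatrix_mulVec_inv, W.emb_dotProduct_self] at h1
  have hch := W.ch_pos
  have h2 := dotProduct_sq_le (jointDesign A i) ((jointMatrix A P)⁻¹ *ᵥ emb j B)
  have h3 := W.jointDesign_row_sq_le i
  refine abs_le_of_sq_le_sq ?_ (by positivity)
  change (jointDesign A i ⬝ᵥ _) ^ 2 ≤ _
  calc _ ≤ _ := h2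
    _ ≤ 2 * ((B ⬝ᵥ B) / (c * h) ^ 2) := by
        gcongr
        exact dotProduct_self_nonneg' _
    _ ≤ 2 * (1 / (c * h) ^ 2) := by gcongr
    _ ≤ (2 / (c * h)) ^ 2 := by
        rw [div_pow, ← mul_div_assoc]
        gcongr
        norm_num

theorem design_blockWeight_le (j : Fin 2) (B : Fin N → ℝ) :
    (A j *ᵥ blockWeight A P j B) ⬝ᵥ (A j *ᵥ blockWeight A P j B) ≤ (B ⬝ᵥ B) / (c / 2 * h) := by
  have h1 := dotProduct_mulVec_le_of_form_lower W.ch2_pos (W.lam_lower j) (blockWeight A P j B)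
  have h2 := W.pen_nonneg j (blockWeight A P j B)
  have h3 : ((A j)ᵀ * A j + P j) *ᵥ blockWeight A P j B = B := by
    rw [blockWeight, W.lam_mulVec_inv]
  rw [h3] at h1
  have h4 : blockWeight A P j B ⬝ᵥ B =
      (A j *ᵥ blockWeight A P j B) ⬝ᵥ (A j *ᵥ blockWeight A P j B) +
        blockWeight A P j B ⬝ᵥ P j *ᵥ blockWeight A P j B := by
    calc blockWeight A P j B ⬝ᵥ B =
        blockWeight A P j B ⬝ᵥ (((A j)ᵀ * A j + P j) *ᵥ blockWeight A P j B) := by rw [h3]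
      _ = _ := by rw [Matrix.add_mulVec, dotProduct_add, dotProduct_gram]
  linarith

/-- B is the image of `blockWeight` under Λ_j, whose norm is at most Ch; so `blockWeight` cannot be
small, and the Gram form is coercive on it. -/
theorem le_design_blockWeight (j : Fin 2) (B : Fin N → ℝ) :
    c / 2 * h * ((B ⬝ᵥ B) / (C * h) ^ 2) ≤
      (A j *ᵥ blockWeight A P j B) ⬝ᵥ (A j *ᵥ blockWeight A P j B) := by
  refine le_trans ?_ (W.gram_lower j _)
  have hC : 0 < C := W.c_pos.trans_le W.c_le
  have hCh : 0 < C * h := mul_pos hC W.h_pos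
  refine mul_le_mul_of_nonneg_left ?_ W.ch2_pos.le
  rw [div_le_iff₀ (by positivity), mul_comm]
  have h3 : ((A j)ᵀ * A j + P j) *ᵥ blockWeight A P j B = B := by
    rw [blockWeight, W.lam_mulVec_inv]
  have h4 := mulVec_dotProduct_self_le (W.lam_transpose j)
    (fun x => (mul_nonneg W.ch2_pos.le (dotProduct_self_nonneg' x)).trans (W.lam_lower j x))
    hCh.le (W.upper j) (blockWeight A P j B)
  rwa [h3] at h4

/-- The local part is the weight plus the cross remainder; |x + y|² ≤ 2|x|² + 2|y|² halves the
constant c/2 to c/4. -/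
theorem weight_dotProduct_self_ge {j j' : Fin 2} (hjj : j ≠ j') (B : Fin N → ℝ) :
    c / 4 * h * ((B ⬝ᵥ B) / (C * h) ^ 2) -
      (crossWeight A P j j' B ⬝ᵥ crossWeight A P j j' B) / (c * h) ≤
      weight A P j B ⬝ᵥ weight A P j B := by
  have h1 := W.weight_eq hjj B
  have h2 : A j *ᵥ blockWeight A P j B =
      weight A P j B + weight A P j' (crossWeight A P j j' B) := by rw [h1, sub_add_cancel]
  have h3 := dotProduct_self_add_le (weight A P j B) (weight A P j' (crossWeight A P j j' B))
  rw [← h2] at h3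
  have h4 := W.le_design_blockWeight j B
  have h5 := W.weight_dotProduct_self_le j' (crossWeight A P j j' B)
  have h6 : c / 4 * h * ((B ⬝ᵥ B) / (C * h) ^ 2) = (c / 2 * h * ((B ⬝ᵥ B) / (C * h) ^ 2)) / 2 := by
    ring
  linarith

variable {w : ℕ} (hw : 0 < w)
  (hband : ∀ j (k l : Fin N), w < Nat.dist k l → ((A j)ᵀ * A j + P j) k l = 0)
include hw hband

/-- Decay of the inverse of the banded matrix Λ_j, averaged over B. The rate comes from the ratio of
the one-block lower bound c/2 to the upper bound C. -/
theorem abs_blockWeight_le (j : Fin 2) {B : Fin N → ℝ} (hB : ∀ k, 0 ≤ B k) (k : Fin N) :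
    |blockWeight A P j B k| ≤ 2 / (c * h) * decayWeight (1 - c / (2 * C)) w B k := by
  have hC : 0 < C := W.c_pos.trans_le W.c_le
  have hc := W.c_pos
  have hh := W.h_pos
  have e : blockWeight A P j B k = ∑ l, ((A j)ᵀ * A j + P j)⁻¹ k l * B l := rfl
  have hle : c / 2 * h ≤ C * h := mul_le_mul_of_nonneg_right (by linarith [W.c_le]) hh.le
  rw [e, decayWeight, Finset.mul_sum]
  refine (Finset.abs_sum_le_sum_abs _ _).trans (Finset.sum_le_sum fun l _ => ?_)
  rw [abs_mul, abs_of_nonneg (hB l)]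
  have h1 := abs_inv_apply_le_of_banded hw (W.lam_transpose j) (hband j) W.ch2_pos
    (C := C * h) hle (W.lam_lower j) (W.upper j) k l
  have e1 : (c / 2 * h)⁻¹ = 2 / (c * h) := by field_simp
  have e2 : c / 2 * h / (C * h) = c / (2 * C) := by field_simp
  rw [e1, e2] at h1
  calc _ ≤ 2 / (c * h) * (1 - c / (2 * C)) ^ (Nat.dist k l / w) * B l :=
        mul_le_mul_of_nonneg_right h1 (hB l)
    _ = _ := by ring

omit W hw hband in
theorem decay_rate_nonneg (W : WellConditioned A P h c C) : 0 ≤ 1 - c / (2 * C) := by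
  have hC : 0 < C := W.c_pos.trans_le W.c_le
  rw [sub_nonneg, div_le_one (by positivity)]
  linarith [W.c_le]

omit W hw hband in
theorem decay_rate_lt_one (W : WellConditioned A P h c C) : 1 - c / (2 * C) < 1 := by
  have hC : 0 < C := W.c_pos.trans_le W.c_le
  have hc := W.c_pos
  have : 0 < c / (2 * C) := by positivity
  linarith

/-- Replacing the sample-dependent vector `blockWeight` by its deterministic decay profile, and
using Cauchy-Schwarz with the profile as weight, leaves an expression linear in the squared cross
Gram entries. Its expectation is then accessible. -/
theorem crossWeight_dotProduct_self_le (j j' : Fin 2) {B : Fin N → ℝ} (hB : ∀ k, 0 ≤ B k) :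
    crossWeight A P j j' B ⬝ᵥ crossWeight A P j j' B ≤
      (2 / (c * h)) ^ 2 * (∑ k, decayWeight (1 - c / (2 * C)) w B k) *
        ∑ k, decayWeight (1 - c / (2 * C)) w B k * ∑ l, (((A j)ᵀ * A j') k l) ^ 2 := by
  set om := decayWeight (1 - c / (2 * C)) w B with hom
  have homn : ∀ k, 0 ≤ om k := decayWeight_nonneg W.decay_rate_nonneg w hB
  have hNn : ∀ k l, 0 ≤ ((A j)ᵀ * A j') k l := fun k l => by
    rw [Matrix.mul_apply]
    exact Finset.sum_nonneg fun i _ => mul_nonneg (W.nonneg j i k) (W.nonneg j' i l)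
  have hch := W.ch_pos
  have hl : ∀ l, (crossWeight A P j j' B l) ^ 2 ≤
      (2 / (c * h)) ^ 2 * (∑ k, om k) * ∑ k, om k * (((A j)ᵀ * A j') k l) ^ 2 := by
    intro l
    have e : crossWeight A P j j' B l = ∑ k, blockWeight A P j B k * ((A j)ᵀ * A j') k l := by
      rw [crossWeight, Matrix.mulVec_mulVec, Matrix.mulVec, dotProduct]
      refine Finset.sum_congr rfl fun k _ => ?_
      rw [mul_comm]
      congr 1
      simp only [Matrix.mul_apply, Matrix.transpose_apply]
      exact Finset.sum_congr rfl fun i _ => mul_comm _ _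
    have h1 : |crossWeight A P j j' B l| ≤ 2 / (c * h) * ∑ k, om k * ((A j)ᵀ * A j') k l := by
      rw [e, Finset.mul_sum]
      refine (Finset.abs_sum_le_sum_abs _ _).trans (Finset.sum_le_sum fun k _ => ?_)
      rw [abs_mul, abs_of_nonneg (hNn k l), ← mul_assoc]
      exact mul_le_mul_of_nonneg_right (W.abs_blockWeight_le hw hband j hB k) (hNn k l)
    have h2 : (∑ k, om k * ((A j)ᵀ * A j') k l) ^ 2 ≤
        (∑ k, om k) * ∑ k, om k * (((A j)ᵀ * A j') k l) ^ 2 := by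
      refine Finset.sum_sq_le_sum_mul_sum_of_sq_le_mul _ (fun k _ => homn k)
        (fun k _ => mul_nonneg (homn k) (sq_nonneg _)) fun k _ => le_of_eq (by ring)
    calc (crossWeight A P j j' B l) ^ 2 = |crossWeight A P j j' B l| ^ 2 := (sq_abs _).symm
      _ ≤ (2 / (c * h) * ∑ k, om k * ((A j)ᵀ * A j') k l) ^ 2 := by gcongr
      _ = (2 / (c * h)) ^ 2 * (∑ k, om k * ((A j)ᵀ * A j') k l) ^ 2 := by ring
      _ ≤ _ := by rw [mul_assoc]; gcongr
  calc _ = ∑ l, (crossWeight A P j j' B l) ^ 2 := by simp [dotProduct, sq]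
    _ ≤ _ := Finset.sum_le_sum fun l _ => hl l
    _ = _ := by
        rw [← Finset.mul_sum, Finset.sum_comm]
        simp only [Finset.mul_sum]

/-- The covariance of the two components is of smaller order than the variances. -/
theorem abs_cov_le {B : Fin 2 → Fin N → ℝ} (hB : ∀ j k, 0 ≤ B j k) (hB1 : ∀ j, B j ⬝ᵥ B j ≤ 1)
    {σ : Fin n → ℝ} {S : ℝ} (hσ : ∀ i, 0 ≤ σ i ∧ σ i ≤ S) {D : ℝ}
    (hD : ∀ j j', j ≠ j' → crossWeight A P j j' (B j) ⬝ᵥ crossWeight A P j j' (B j) ≤ D) :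
    |∑ i, σ i * weight A P 0 (B 0) i * weight A P 1 (B 1) i| ≤
      S * ((2 / (c * h)) ^ 2 * (∑ k, ∑ l, decayWeight (1 - c / (2 * C)) w (B 0) k *
        decayWeight (1 - c / (2 * C)) w (B 1) l * ((A 0)ᵀ * A 1) k l) +
        (4 * √D + D) / (c * h)) := by
  set om0 := decayWeight (1 - c / (2 * C)) w (B 0) with hom0
  set om1 := decayWeight (1 - c / (2 * C)) w (B 1) with hom1
  have hn0 : ∀ k, 0 ≤ om0 k := decayWeight_nonneg W.decay_rate_nonneg w (hB 0)
  have hn1 : ∀ k, 0 ≤ om1 k := decayWeight_nonneg W.decay_rate_nonneg w (hB 1)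
  have hch := W.ch_pos
  have hD0 : 0 ≤ D := (dotProduct_self_nonneg' _).trans (hD 0 1 (by simp))
  -- Each weight is a local part x minus a cross remainder g. The product of the two local parts is
  -- bounded by the overlap of the decay profiles in the cross Gram matrix, the other three products
  -- by Cauchy-Schwarz.
  set x : Fin 2 → Fin n → ℝ := fun j => A j *ᵥ blockWeight A P j (B j) with hx
  set g0 := weight A P 1 (crossWeight A P 0 1 (B 0)) with hg0
  set g1 := weight A P 0 (crossWeight A P 1 0 (B 1)) with hg1
  have w0 : weight A P 0 (B 0) = x 0 - g0 := W.weight_eq (by simp) _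
  have w1 : weight A P 1 (B 1) = x 1 - g1 := W.weight_eq (by simp) _
  have bx : ∀ j, x j ⬝ᵥ x j ≤ 2 / (c * h) := by
    intro j
    refine (W.design_blockWeight_le j (B j)).trans ?_
    calc _ ≤ 1 / (c / 2 * h) := by have := W.ch2_pos; gcongr; exact hB1 j
      _ = _ := by have := W.c_pos; have := W.h_pos; field_simp
  have bg0 : g0 ⬝ᵥ g0 ≤ D / (c * h) :=
    (W.weight_dotProduct_self_le _ _).trans (by gcongr; exact hD 0 1 (by simp))
  have bg1 : g1 ⬝ᵥ g1 ≤ D / (c * h) :=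
    (W.weight_dotProduct_self_le _ _).trans (by gcongr; exact hD 1 0 (by simp))
  have habs : ∀ u v : Fin n → ℝ, ∑ i, |u i| * |v i| ≤ √(u ⬝ᵥ u) * √(v ⬝ᵥ v) := by
    intro u v
    have := Real.sum_mul_le_sqrt_mul_sqrt Finset.univ (fun i => |u i|) (fun i => |v i|)
    simpa [sq_abs, dotProduct, sq] using this
  have hxabs : ∀ j i, |x j i| ≤ 2 / (c * h) * ∑ k, A j i k *
      decayWeight (1 - c / (2 * C)) w (B j) k := by
    intro j i
    simp only [hx, Matrix.mulVec, dotProduct]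
    rw [Finset.mul_sum]
    refine (Finset.abs_sum_le_sum_abs _ _).trans (Finset.sum_le_sum fun k _ => ?_)
    rw [abs_mul, abs_of_nonneg (W.nonneg j i k)]
    calc _ ≤ A j i k * (2 / (c * h) * decayWeight (1 - c / (2 * C)) w (B j) k) :=
          mul_le_mul_of_nonneg_left (W.abs_blockWeight_le hw hband j (hB j) k) (W.nonneg j i k)
      _ = _ := by ring
  have hmain : ∑ i, |x 0 i| * |x 1 i| ≤ (2 / (c * h)) ^ 2 * (∑ k, ∑ l, om0 k * om1 l *
      ((A 0)ᵀ * A 1) k l) := by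
    calc _ ≤ ∑ i, (2 / (c * h) * ∑ k, A 0 i k * om0 k) * (2 / (c * h) * ∑ k, A 1 i k * om1 k) := by
          refine Finset.sum_le_sum fun i _ => ?_
          refine mul_le_mul (hxabs 0 i) (hxabs 1 i) (abs_nonneg _) ?_
          exact mul_nonneg (by positivity)
            (Finset.sum_nonneg fun k _ => mul_nonneg (W.nonneg 0 i k) (hn0 k))
      _ = (2 / (c * h)) ^ 2 * ∑ i, ∑ k, ∑ l, om0 k * om1 l * (A 0 i k * A 1 i l) := by
          rw [Finset.mul_sum]
          refine Finset.sum_congr rfl fun i _ => ?_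
          rw [mul_mul_mul_comm, ← sq, Finset.sum_mul_sum]
          congr 1
          refine Finset.sum_congr rfl fun k _ => Finset.sum_congr rfl fun l _ => ?_
          ring
      _ = _ := by
          congr 1
          rw [Finset.sum_comm]
          refine Finset.sum_congr rfl fun k _ => ?_
          rw [Finset.sum_comm]
          refine Finset.sum_congr rfl fun l _ => ?_
          rw [← Finset.mul_sum]
          rfl
  have hS : ∀ i : Fin n, |σ i * weight A P 0 (B 0) i * weight A P 1 (B 1) i| ≤
      S * (|x 0 i| * |x 1 i| + |x 0 i| * |g1 i| + |g0 i| * |x 1 i| + |g0 i| * |g1 i|) := by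
    intro i
    rw [mul_assoc, abs_mul, abs_mul, abs_of_nonneg (hσ i).1, w0, w1]
    have a0 := abs_sub (x 0 i) (g0 i)
    have a1 := abs_sub (x 1 i) (g1 i)
    have hSn : 0 ≤ S := (hσ i).1.trans (hσ i).2
    calc _ ≤ S * ((|x 0 i| + |g0 i|) * (|x 1 i| + |g1 i|)) := by
          gcongr
          · exact (hσ i).2
          · exact a0
          · exact a1
      _ = _ := by ring
  rcases Nat.eq_zero_or_pos n with hn | hn
  · exact absurd W.n_pos (by omega)
  have hSn : 0 ≤ S := (hσ ⟨0, hn⟩).1.trans (hσ ⟨0, hn⟩).2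
  refine (Finset.abs_sum_le_sum_abs _ _).trans ((Finset.sum_le_sum fun i _ => hS i).trans ?_)
  rw [← Finset.mul_sum]
  refine mul_le_mul_of_nonneg_left ?_ hSn
  simp only [Finset.sum_add_distrib]
  have sq1 : √(2 / (c * h)) * √(D / (c * h)) ≤ 2 * √D / (c * h) := by
    rw [← Real.sqrt_mul (by positivity)]
    have : 2 / (c * h) * (D / (c * h)) = 2 * D / (c * h) ^ 2 := by field_simp
    rw [this, Real.sqrt_div (by positivity), Real.sqrt_sq hch.le, Real.sqrt_mul (by norm_num)]
    gcongr
    rw [Real.sqrt_le_left (by norm_num)]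
    norm_num
  have sq2 : √(D / (c * h)) * √(D / (c * h)) = D / (c * h) := Real.mul_self_sqrt (by positivity)
  have t1 : ∑ i, |x 0 i| * |g1 i| ≤ 2 * √D / (c * h) := (habs _ _).trans (le_trans (by
    gcongr
    · exact bx 0) sq1)
  have t2 : ∑ i, |g0 i| * |x 1 i| ≤ 2 * √D / (c * h) := (habs _ _).trans (le_trans (by
    rw [mul_comm]
    gcongr
    · exact bx 1) sq1)
  have t3 : ∑ i, |g0 i| * |g1 i| ≤ D / (c * h) := (habs _ _).trans (le_trans (by gcongr) sq2.le)
  have : (4 * √D + D) / (c * h) = 2 * √D / (c * h) + 2 * √D / (c * h) + D / (c * h) := by ring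
  rw [this]
  linarith

/-- The bias caused by the approximation error `r` and by the penalty. -/
theorem abs_bias_le {j j' : Fin 2} (hjj : j ≠ j') {B : Fin N → ℝ} (hB : ∀ k, 0 ≤ B k)
    {r : Fin n → ℝ} {ρ : ℝ} (hr : ∀ i, |r i| ≤ ρ) {s : Fin 2 × Fin N → ℝ} {π : ℝ}
    (hs : ∀ j k, |(P j *ᵥ part j s) k| ≤ π) {D : ℝ}
    (hD : crossWeight A P j j' B ⬝ᵥ crossWeight A P j j' B ≤ D) :
    |B ⬝ᵥ part j ((jointMatrix A P)⁻¹ *ᵥ ((jointDesign A)ᵀ *ᵥ r - jointPenalty P *ᵥ s))| ≤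
      2 / (c * h) * (ρ * (∑ k, decayWeight (1 - c / (2 * C)) w B k * ((A j)ᵀ *ᵥ 1) k) +
        π * ∑ k, decayWeight (1 - c / (2 * C)) w B k) +
      √(D * (2 * (n * ρ ^ 2 / (c * h)) + 2 * (2 * N * π ^ 2 / (c * h) ^ 2))) := by
  set om := decayWeight (1 - c / (2 * C)) w B with hom
  have homn : ∀ k, 0 ≤ om k := decayWeight_nonneg W.decay_rate_nonneg w hB
  have hch := W.ch_pos
  set u := (jointDesign A)ᵀ *ᵥ r - jointPenalty P *ᵥ s with hu
  set b := (jointMatrix A P)⁻¹ *ᵥ u with hb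
  have hu0 : nullVec N ⬝ᵥ u = 0 := by
    rw [hu, dotProduct_sub, W.nullVec_transpose_jointDesign, W.nullVec_jointPenalty, sub_zero]
  rw [W.dotProduct_part_of_normal_equations hu0 (W.jointMatrix_mulVec_inv' u) hjj B]
  refine (abs_sub _ _).trans (add_le_add ?_ ?_)
  -- The local term: approximation error and penalty are bounded entrywise and summed against the
  -- decay profile.
  · have hρ : ∀ k, |((A j)ᵀ *ᵥ r) k| ≤ ρ * ((A j)ᵀ *ᵥ 1) k := by
      intro k
      simp only [Matrix.mulVec, dotProduct, Matrix.transpose_apply, Pi.one_apply, mul_one]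
      rw [Finset.mul_sum]
      refine (Finset.abs_sum_le_sum_abs _ _).trans (Finset.sum_le_sum fun i _ => ?_)
      rw [abs_mul, abs_of_nonneg (W.nonneg j i k), mul_comm]
      exact mul_le_mul_of_nonneg_right (hr i) (W.nonneg j i k)
    have hpu : ∀ k, |part j u k| ≤ ρ * ((A j)ᵀ *ᵥ 1) k + π := by
      intro k
      have e : part j u k = ((A j)ᵀ *ᵥ r) k - (P j *ᵥ part j s) k := by
        rw [← part_transpose_jointDesign_mulVec, ← part_jointPenalty_mulVec]; rfl
      rw [e]
      exact (abs_sub _ _).trans (add_le_add (hρ k) (hs j k))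
    refine (Finset.abs_sum_le_sum_abs _ _).trans ?_
    calc _ ≤ ∑ k, 2 / (c * h) * om k * (ρ * ((A j)ᵀ *ᵥ 1) k + π) := by
          refine Finset.sum_le_sum fun k _ => ?_
          rw [abs_mul]
          exact mul_le_mul (W.abs_blockWeight_le hw hband j hB k) (hpu k) (abs_nonneg _)
            (mul_nonneg (by positivity) (homn k))
      _ = _ := by
          rw [Finset.mul_sum, Finset.mul_sum, ← Finset.sum_add_distrib, Finset.mul_sum]
          refine Finset.sum_congr rfl fun k _ => ?_
          ring
  -- The cross term needs only the Euclidean norm of the other block. The part due to r is bounded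
  -- through the energy identity, which avoids an upper bound on the joint Gram matrix; the part due
  -- to the penalty through the norm of the inverse.
  · apply Real.abs_le_sqrt
    refine (dotProduct_sq_le _ _).trans ?_
    refine mul_le_mul hD ((part_dotProduct_part_le j' b).trans ?_) (dotProduct_self_nonneg' _)
      ((dotProduct_self_nonneg' _).trans hD)
    have hsplit : b = (jointMatrix A P)⁻¹ *ᵥ ((jointDesign A)ᵀ *ᵥ r) +
        (jointMatrix A P)⁻¹ *ᵥ (-(jointPenalty P *ᵥ s)) := by
      rw [hb, hu, ← Matrix.mulVec_add, sub_eq_add_neg]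
    rw [hsplit]
    refine (dotProduct_self_add_le _ _).trans (add_le_add ?_ ?_)
    · refine mul_le_mul_of_nonneg_left ?_ (by norm_num)
      set b1 := (jointMatrix A P)⁻¹ *ᵥ ((jointDesign A)ᵀ *ᵥ r) with hb1
      have f1 := W.jointMatrix_form b1
      have f2 : b1 ⬝ᵥ jointMatrix A P *ᵥ b1 = (jointDesign A *ᵥ b1) ⬝ᵥ r := by
        rw [hb1, W.jointMatrix_mulVec_inv, Matrix.dotProduct_mulVec _ (jointDesign A)ᵀ,
          Matrix.vecMul_transpose]
      have f3 := W.jointPenalty_form b1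
      have f4 : 0 ≤ (n : ℝ)⁻¹ * (sumVec A ⬝ᵥ b1) ^ 2 := by positivity
      have f5 := W.jointMatrix_lower b1
      have f6 := dotProduct_sq_le (jointDesign A *ᵥ b1) r
      have f7 : r ⬝ᵥ r ≤ n * ρ ^ 2 := by
        calc r ⬝ᵥ r = ∑ i, |r i| ^ 2 := by simp [dotProduct, sq]
          _ ≤ ∑ _i : Fin n, ρ ^ 2 := Finset.sum_le_sum fun i _ => by gcongr; exact hr i
          _ = _ := by simp
      rw [f2] at f1 f5
      set E := (jointDesign A *ᵥ b1) ⬝ᵥ r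
      have hEE : (jointDesign A *ᵥ b1) ⬝ᵥ (jointDesign A *ᵥ b1) ≤ E := by linarith
      have hE0 : 0 ≤ E := (dotProduct_self_nonneg' _).trans hEE
      have hE : E ≤ r ⬝ᵥ r := by
        rcases hE0.eq_or_lt with h0 | h0
        · rw [← h0]; exact dotProduct_self_nonneg' _
        · have : E * E ≤ E * (r ⬝ᵥ r) := by
            have := mul_le_mul_of_nonneg_right hEE (dotProduct_self_nonneg' r)
            nlinarith
          exact le_of_mul_le_mul_left this h0
      rw [le_div_iff₀ hch]
      linarith
    · refine mul_le_mul_of_nonneg_left ?_ (by norm_num)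
      refine (dotProduct_self_le_of_form_lower hch W.jointMatrix_lower _).trans ?_
      rw [W.jointMatrix_mulVec_inv, neg_dotProduct_neg, dotProduct_eq_part,
        part_jointPenalty_mulVec, part_jointPenalty_mulVec]
      have key : ∀ j, (P j *ᵥ part j s) ⬝ᵥ (P j *ᵥ part j s) ≤ N * π ^ 2 := by
        intro j
        calc _ = ∑ k, |(P j *ᵥ part j s) k| ^ 2 := by simp [dotProduct, sq]
          _ ≤ ∑ _k : Fin N, π ^ 2 := Finset.sum_le_sum fun k _ => by gcongr; exact hs j k
          _ = _ := by simp
      have k0 := key 0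
      have k1 := key 1
      gcongr
      linarith

omit hw hband in
/-- The solution of the normal equations split into the spline, the bias, the linear part and the
contribution of the initial value. -/
theorem dotProduct_solution {s : Fin 2 × Fin N → ℝ} {r e : Fin n → ℝ} {t : ℝ} {B : Fin N → ℝ}
    (hB1 : ∑ k, B k = 1) (j : Fin 2) :
    B ⬝ᵥ part j ((jointMatrix A P)⁻¹ *ᵥ ((jointDesign A)ᵀ *ᵥ (jointDesign A *ᵥ s + r + e) +
        (t / n) • sumVec A)) =
      B ⬝ᵥ part j s +
        B ⬝ᵥ part j ((jointMatrix A P)⁻¹ *ᵥ ((jointDesign A)ᵀ *ᵥ r - jointPenalty P *ᵥ s)) +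
        weight A P j B ⬝ᵥ e - (t - sumVec A ⬝ᵥ s) / n * (if j = 0 then 1 else -1) := by
  have key : (jointMatrix A P)⁻¹ *ᵥ ((jointDesign A)ᵀ *ᵥ (jointDesign A *ᵥ s + r + e) +
      (t / n) • sumVec A) = s +
      (jointMatrix A P)⁻¹ *ᵥ ((jointDesign A)ᵀ *ᵥ r - jointPenalty P *ᵥ s) +
      (jointMatrix A P)⁻¹ *ᵥ ((jointDesign A)ᵀ *ᵥ e) +
      (-((t - sumVec A ⬝ᵥ s) / n)) • nullVec N := by
    -- Both sides have the same image under the definite matrix; the multiple of the null direction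
    -- absorbs the mismatch between t and the mean of s.
    apply W.jointMatrix_inj
    simp only [Matrix.mulVec_add (jointMatrix A P), Matrix.mulVec_smul, W.jointMatrix_mulVec_inv,
      W.jointMatrix_nullVec]
    rw [jointMatrix_mulVec A P s]
    simp only [Matrix.mulVec_add]
    funext a
    simp only [Pi.add_apply, Pi.sub_apply, Pi.smul_apply, Pi.neg_apply, smul_eq_mul]
    ring
  have hnull : B ⬝ᵥ part j (nullVec N) = if j = 0 then 1 else -1 := by
    have : part j (nullVec N) = fun _ => if j = 0 then (1 : ℝ) else -1 := rfl
    rw [this, dotProduct, ← Finset.sum_mul, hB1, one_mul]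
  rw [key, part_add, part_add, part_add, part_smul, dotProduct_add, dotProduct_add, dotProduct_add,
    dotProduct_smul, hnull, W.weight_dotProduct, smul_eq_mul]
  ring

end WellConditioned

/-! ### Lyapunov bounds for characteristic functions -/

section CharacteristicFunctions
open Complex

/-- For |x| ≤ 1 the third-order remainder is used together with |x|³ ≤ |x|^(2+δ); for |x| > 1 all
terms are bounded crudely by multiples of x² ≤ |x|^(2+δ). -/
theorem norm_exp_I_sub_taylor_le {δ : ℝ} (hδ : 0 < δ) (hδ1 : δ ≤ 1) (x : ℝ) :
    ‖exp (x * I) - (1 + x * I - (x : ℂ) ^ 2 / 2)‖ ≤ 4 * |x| ^ (2 + δ) := by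
  have hxI : ‖(x : ℂ) * I‖ = |x| := by simp
  by_cases hx : |x| ≤ 1
  · have h := exp_bound (x := x * I) (by rw [hxI]; exact hx) (n := 3) (by norm_num)
    have e : ∑ m ∈ Finset.range 3, ((x : ℂ) * I) ^ m / (m.factorial : ℂ) =
        1 + x * I - (x : ℂ) ^ 2 / 2 := by
      simp [Finset.sum_range_succ, Nat.factorial, mul_pow]
      ring
    rw [e, hxI] at h
    refine h.trans ?_
    have h3 : |x| ^ 3 ≤ |x| ^ (2 + δ) := by
      rw [← Real.rpow_natCast]
      rcases (abs_nonneg x).eq_or_lt with h0 | h0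
      · rw [← h0, Real.zero_rpow (by norm_num), Real.zero_rpow (by positivity)]
      · exact Real.rpow_le_rpow_of_exponent_ge h0 hx (by push_cast; linarith)
    have hp : (0 : ℝ) ≤ |x| ^ 3 := by positivity
    norm_num [Nat.factorial]
    linarith
  · push Not at hx
    have h1 : |x| ^ 2 ≤ |x| ^ (2 + δ) := by
      rw [← Real.rpow_natCast]
      exact Real.rpow_le_rpow_of_exponent_le hx.le (by push_cast; linarith)
    have hn : ‖exp (x * I)‖ = 1 := norm_exp_ofReal_mul_I x
    have h2 : ‖(1 : ℂ) + x * I - (x : ℂ) ^ 2 / 2‖ ≤ 1 + |x| + |x| ^ 2 / 2 := by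
      refine (norm_sub_le _ _).trans (add_le_add ((norm_add_le _ _).trans ?_) ?_)
      · simp
      · simp
    have h3 := norm_sub_le (exp (x * I)) (1 + x * I - (x : ℂ) ^ 2 / 2)
    nlinarith

/-- The factors are exchanged one at a time, the others having modulus at most one. -/
theorem norm_prod_sub_prod_le {n : ℕ} (a b : Fin n → ℂ) (ha : ∀ i, ‖a i‖ ≤ 1)
    (hb : ∀ i, ‖b i‖ ≤ 1) : ‖∏ i, a i - ∏ i, b i‖ ≤ ∑ i, ‖a i - b i‖ := by
  induction n with
  | zero => simp
  | succ n ih =>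
    rw [Fin.prod_univ_succ, Fin.prod_univ_succ, Fin.sum_univ_succ]
    have h := ih (fun i => a i.succ) (fun i => b i.succ) (fun i => ha _) (fun i => hb _)
    have e : a 0 * ∏ i : Fin n, a i.succ - b 0 * ∏ i : Fin n, b i.succ =
        (a 0 - b 0) * ∏ i : Fin n, a i.succ + b 0 * (∏ i : Fin n, a i.succ - ∏ i : Fin n, b i.succ) := by
      ring
    rw [e]
    refine (norm_add_le _ _).trans (add_le_add ?_ ?_)
    · rw [norm_mul, norm_prod]
      refine mul_le_of_le_one_right (norm_nonneg _) (Finset.prod_le_one (fun _ _ => norm_nonneg _)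
        fun i _ => ha _)
    · rw [norm_mul]
      exact (mul_le_of_le_one_left (norm_nonneg _) (hb 0)).trans h

variable {Ω' : Type*} [MeasurableSpace Ω'] {P : Measure Ω'} [IsProbabilityMeasure P]

/-- The Taylor bound is integrated, mean zero removing the linear term. The last summand compares 1
- y with exp(-y) for y = u²s/2, up to y². -/
theorem norm_integral_exp_sub_le {ξ : Ω' → ℝ} (hξ : AEMeasurable ξ P) (h2 : MemLp ξ 2 P)
    (h0 : ∫ ω, ξ ω ∂P = 0) {δ : ℝ} (hδ : 0 < δ) (hδ1 : δ ≤ 1)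
    (hint : Integrable (fun ω => |ξ ω| ^ (2 + δ)) P) {M : ℝ} (hM : ∫ ω, |ξ ω| ^ (2 + δ) ∂P ≤ M)
    {s : ℝ} (hs : Var[ξ; P] = s) (u : ℝ) :
    ‖∫ ω, exp ((u * ξ ω : ℝ) * I) ∂P - (Real.exp (-(u ^ 2 * s / 2)) : ℂ)‖ ≤
      4 * M * |u| ^ (2 + δ) + (u ^ 2 * s) ^ 2 := by
  have hsq : ∫ ω, ξ ω ^ 2 ∂P = s := by
    rw [← hs, variance_of_integral_eq_zero hξ h0]
  have i1 : Integrable ξ P := h2.integrable (by norm_num)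
  have i2 : Integrable (fun ω => ξ ω ^ 2) P := h2.integrable_sq
  have iexp : Integrable (fun ω => exp ((u * ξ ω : ℝ) * I)) P := by
    refine Integrable.of_bound (C := 1) ?_ (Eventually.of_forall fun ω => ?_)
    · exact (by fun_prop : AEMeasurable (fun ω => exp ((u * ξ ω : ℝ) * I)) P).aestronglyMeasurable
    · rw [norm_exp_ofReal_mul_I]
  have itay : Integrable (fun ω => (1 : ℂ) + (u * ξ ω : ℝ) * I - ((u * ξ ω : ℝ) : ℂ) ^ 2 / 2) P := by
    have a1 : Integrable (fun ω => ((u * ξ ω : ℝ) : ℂ) * I) P := (i1.const_mul u).ofReal.mul_const I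
    have a2 : Integrable (fun ω => ((u * ξ ω : ℝ) : ℂ) ^ 2 / 2) P := by
      have := ((i2.const_mul (u ^ 2)).ofReal (𝕜 := ℂ)).div_const 2
      refine this.congr (Eventually.of_forall fun ω => ?_)
      simp [mul_pow]
    exact ((integrable_const 1).add a1).sub a2
  have hval : ∫ ω, ((1 : ℂ) + (u * ξ ω : ℝ) * I - ((u * ξ ω : ℝ) : ℂ) ^ 2 / 2) ∂P =
      ((1 - u ^ 2 * s / 2 : ℝ) : ℂ) := by
    have a1 : Integrable (fun ω => ((u * ξ ω : ℝ) : ℂ) * I) P := (i1.const_mul u).ofReal.mul_const I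
    have e : ∀ ω, ((u * ξ ω : ℝ) : ℂ) ^ 2 / 2 = ((u ^ 2 / 2 * ξ ω ^ 2 : ℝ) : ℂ) := by
      intro ω; push_cast; ring
    have a2 : Integrable (fun ω => ((u ^ 2 / 2 * ξ ω ^ 2 : ℝ) : ℂ)) P :=
      (i2.const_mul _).ofReal
    simp only [e]
    have a3 : Integrable (fun ω => (1 : ℂ) + ((u * ξ ω : ℝ) : ℂ) * I) P := (integrable_const 1).add a1
    rw [integral_sub a3 a2, integral_add (integrable_const 1) a1,
      integral_mul_const, integral_complex_ofReal, integral_complex_ofReal, integral_const_mul, integral_const_mul,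
      h0, hsq]
    simp
    ring
  have b1 : ‖∫ ω, exp ((u * ξ ω : ℝ) * I) ∂P - ((1 - u ^ 2 * s / 2 : ℝ) : ℂ)‖ ≤
      4 * M * |u| ^ (2 + δ) := by
    rw [← hval, ← integral_sub iexp itay]
    refine (norm_integral_le_integral_norm _).trans ?_
    calc _ ≤ ∫ ω, 4 * |u| ^ (2 + δ) * |ξ ω| ^ (2 + δ) ∂P := by
          refine integral_mono_of_nonneg (Eventually.of_forall fun _ => norm_nonneg _)
            (hint.const_mul _) (Eventually.of_forall fun ω => ?_)
          refine (norm_exp_I_sub_taylor_le hδ hδ1 (u * ξ ω)).trans (le_of_eq ?_)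
          rw [abs_mul, Real.mul_rpow (abs_nonneg _) (abs_nonneg _)]
          ring
      _ = 4 * |u| ^ (2 + δ) * ∫ ω, |ξ ω| ^ (2 + δ) ∂P := integral_const_mul _ _
      _ ≤ 4 * |u| ^ (2 + δ) * M := by gcongr
      _ = _ := by ring
  have hs0 : 0 ≤ s := by rw [← hs]; exact variance_nonneg _ _
  have b2 : ‖((1 - u ^ 2 * s / 2 : ℝ) : ℂ) - (Real.exp (-(u ^ 2 * s / 2)) : ℂ)‖ ≤ (u ^ 2 * s) ^ 2 := by
    rw [← ofReal_sub, norm_real, Real.norm_eq_abs]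
    set y := u ^ 2 * s / 2 with hy
    have hy0 : 0 ≤ y := by positivity
    have e1 := Real.add_one_le_exp (-y)
    have e2 : Real.exp (-y) ≤ 1 - y + y ^ 2 := by
      by_cases hy1 : y ≤ 1
      · have hy1' : ‖-y‖ ≤ 1 := by rwa [norm_neg, Real.norm_eq_abs, abs_of_nonneg hy0]
        have := Real.norm_exp_sub_one_sub_id_le hy1'
        rw [Real.norm_eq_abs, Real.norm_eq_abs, abs_neg, sq_abs] at this
        have := (abs_le.mp this).2
        linarith
      · push Not at hy1
        have := Real.exp_le_one_iff.mpr (neg_nonpos.mpr hy0)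
        nlinarith
    rw [abs_le]
    constructor <;> nlinarith
  calc _ = ‖(∫ ω, exp ((u * ξ ω : ℝ) * I) ∂P - ((1 - u ^ 2 * s / 2 : ℝ) : ℂ)) +
        (((1 - u ^ 2 * s / 2 : ℝ) : ℂ) - (Real.exp (-(u ^ 2 * s / 2)) : ℂ))‖ := by
        rw [sub_add_sub_cancel]
    _ ≤ _ := (norm_add_le _ _).trans (add_le_add b1 b2)

/-- A Lyapunov bound for the characteristic function of a weighted sum of independent variables. -/
theorem norm_integral_exp_sum_sub_le {n : ℕ} {e : Fin n → Ω' → ℝ} (hm : ∀ i, Measurable (e i))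
    (hind : iIndepFun e P) (h2 : ∀ i, MemLp (e i) 2 P) (h0 : ∀ i, ∫ ω, e i ω ∂P = 0) {δ : ℝ}
    (hδ : 0 < δ) (hδ1 : δ ≤ 1) (hint : ∀ i, Integrable (fun ω => |e i ω| ^ (2 + δ)) P) {M : ℝ}
    (hM : ∀ i, ∫ ω, |e i ω| ^ (2 + δ) ∂P ≤ M) {s : Fin n → ℝ} (hs : ∀ i, Var[e i; P] = s i)
    {u : Fin n → ℝ} {τ a b Q : ℝ} (ha : 0 < a) (hb : 0 ≤ b) (hτ : 0 ≤ τ) (hab : ∀ i, a ≤ s i ∧ s i ≤ b)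
    (hu : ∀ i, |u i| ≤ τ) (hM0 : 0 ≤ M) (hQ : ∑ i, u i ^ 2 * s i ≤ Q) :
    ‖∫ ω, exp ((∑ i, u i * e i ω : ℝ) * I) ∂P - (Real.exp (-(∑ i, u i ^ 2 * s i) / 2) : ℂ)‖ ≤
      (4 * M * τ ^ δ / a + τ ^ 2 * b) * Q := by
  have hs0 : ∀ i, 0 ≤ s i := fun i => ha.le.trans (hab i).1
  have hprod : ∫ ω, exp ((∑ i, u i * e i ω : ℝ) * I) ∂P =
      ∏ i, ∫ ω, exp ((u i * e i ω : ℝ) * I) ∂P := by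
    rw [← iIndepFun.integral_fun_prod_comp (f := fun i (x : ℝ) => exp ((u i * x : ℝ) * I)) hind
      (fun i => (hm i).aemeasurable) (fun i => by fun_prop)]
    congr 1
    funext ω
    rw [← exp_sum]
    congr 1
    push_cast
    rw [Finset.sum_mul]
  have hexp : (Real.exp (-(∑ i, u i ^ 2 * s i) / 2) : ℂ) =
      ∏ i, (Real.exp (-(u i ^ 2 * s i / 2)) : ℂ) := by
    rw [← ofReal_prod, ← Real.exp_sum]
    congr 2
    rw [Finset.sum_neg_distrib, neg_div, Finset.sum_div]
  rw [hprod, hexp]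
  refine (norm_prod_sub_prod_le _ _ (fun i => ?_) (fun i => ?_)).trans ?_
  · refine (norm_integral_le_of_norm_le_const (C := 1) (Eventually.of_forall fun ω => ?_)).trans ?_
    · rw [norm_exp_ofReal_mul_I]
    · simp
  · rw [norm_real, Real.norm_eq_abs, Real.abs_exp, Real.exp_le_one_iff]
    have := hs0 i
    have : 0 ≤ u i ^ 2 * s i / 2 := by positivity
    linarith
  · calc _ ≤ ∑ i, (4 * M * τ ^ δ / a + τ ^ 2 * b) * (u i ^ 2 * s i) := by
          refine Finset.sum_le_sum fun i _ => ?_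
          refine (norm_integral_exp_sub_le (hm i).aemeasurable (h2 i) (h0 i) hδ hδ1 (hint i) (hM i)
            (hs i) (u i)).trans ?_
          -- The lower bound a on the variances turns u² into u²s, so that the errors add up to a
          -- multiple of the total variance.
          have hui : |u i| ^ (2 + δ) ≤ τ ^ δ * (u i ^ 2 * s i) / a := by
            rw [Real.rpow_add_of_nonneg (abs_nonneg _) (by norm_num) hδ.le, le_div_iff₀ ha,
              Real.rpow_two, sq_abs]
            have h1 : |u i| ^ δ ≤ τ ^ δ := Real.rpow_le_rpow (abs_nonneg _) (hu i) hδ.le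
            have h2 : 0 ≤ |u i| ^ δ := by positivity
            have h3 := (hab i).1
            calc u i ^ 2 * |u i| ^ δ * a ≤ u i ^ 2 * τ ^ δ * s i := by gcongr
              _ = _ := by ring
          have hui2 : (u i ^ 2 * s i) ^ 2 ≤ τ ^ 2 * b * (u i ^ 2 * s i) := by
            have h1 : u i ^ 2 ≤ τ ^ 2 := by rw [← sq_abs]; gcongr; exact hu i
            have h3 := (hab i).2
            have h4 := hs0 i
            rw [sq (u i ^ 2 * s i)]
            gcongr
          calc _ ≤ 4 * M * (τ ^ δ * (u i ^ 2 * s i) / a) + τ ^ 2 * b * (u i ^ 2 * s i) := by gcongr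
            _ = _ := by ring
      _ = (4 * M * τ ^ δ / a + τ ^ 2 * b) * ∑ i, u i ^ 2 * s i := by rw [Finset.mul_sum]
      _ ≤ _ := by
          gcongr

end CharacteristicFunctions

/-! ### Measurability of the estimator and of its conditional covariance -/

section Measurability
variable {α : Type*} [MeasurableSpace α]

theorem measurable_mulVec_apply {ι κ : Type*} [Fintype ι] {A : α → Matrix κ ι ℝ} {v : α → ι → ℝ}
    (hA : ∀ i j, Measurable fun a => A a i j) (hv : ∀ j, Measurable fun a => v a j) (i : κ) :
    Measurable fun a => (A a *ᵥ v a) i := by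
  simp only [Matrix.mulVec, dotProduct]
  exact Finset.measurable_sum _ fun j _ => (hA i j).mul (hv j)

theorem measurable_matrix_mul_apply {ι κ ν : Type*} [Fintype ι] {A : α → Matrix κ ι ℝ}
    {B : α → Matrix ι ν ℝ} (hA : ∀ i j, Measurable fun a => A a i j)
    (hB : ∀ i j, Measurable fun a => B a i j) (i : κ) (j : ν) :
    Measurable fun a => (A a * B a) i j := by
  simp only [Matrix.mul_apply]
  exact Finset.measurable_sum _ fun k _ => (hA i k).mul (hB k j)

theorem measurable_det {ι : Type*} [Fintype ι] [DecidableEq ι] {A : α → Matrix ι ι ℝ}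
    (hA : ∀ i j, Measurable fun a => A a i j) : Measurable fun a => (A a).det := by
  simp only [Matrix.det_apply]
  exact Finset.measurable_sum _ fun σ _ =>
    (Finset.measurable_prod _ fun i _ => hA (σ i) i).const_smul _

/-- Cramer's rule expresses the entries by determinants, and it remains valid for singular matrices
because both conventions give zero. -/
theorem measurable_inv_apply {ι : Type*} [Fintype ι] [DecidableEq ι] {A : α → Matrix ι ι ℝ}
    (hA : ∀ i j, Measurable fun a => A a i j) (i j : ι) : Measurable fun a => (A a)⁻¹ i j := by
  have e : ∀ a, (A a)⁻¹ i j = ((A a).det)⁻¹ * ((A a).updateRow j (Pi.single i 1)).det := by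
    intro a
    rw [Matrix.inv_def, Matrix.smul_apply, Matrix.adjugate_apply, Ring.inverse_eq_inv', smul_eq_mul]
  simp only [e]
  refine (measurable_det hA).inv.mul (measurable_det fun k l => ?_)
  simp only [Matrix.updateRow_apply]
  split_ifs
  · exact measurable_const
  · exact hA k l

variable {p m K n : ℕ} {lam : Fin 2 → ℝ} {z : α → Fin n → Fin 2 → ℝ}

theorem measurable_designMatrix_apply (hz : Measurable z) (j : Fin 2) (i : Fin n)
    (k : Fin (K + p)) : Measurable fun a => designMatrix p K (z a) j i k := by
  have h1 : Measurable fun a => z a i j := by fun_prop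
  exact (measurable_bspline K p _).comp h1

theorem measurable_update_apply (hz : Measurable z) (j : Fin 2) {r : α → Fin n → ℝ}
    (hr : ∀ i, Measurable fun a => r a i) (k : Fin (K + p)) :
    Measurable fun a => update p m K lam (z a) j (r a) k := by
  have hA := fun i k => measurable_designMatrix_apply (p := p) (K := K) hz j i k
  refine measurable_mulVec_apply (measurable_inv_apply fun i k => ?_)
    (measurable_mulVec_apply (fun i k => hA k i) hr) k
  exact (measurable_matrix_mul_apply (fun i k => hA k i) hA i k).add measurable_const

theorem measurable_backfit (hz : Measurable z) {y : α → Fin n → ℝ}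
    (hy : ∀ i, Measurable fun a => y a i) {b0 : α → Fin (K + p) → ℝ} (hb : Measurable b0) (l : ℕ) :
    Measurable fun a => backfit p m K lam (z a) (y a) (b0 a) l := by
  induction l with
  | zero => exact measurable_const.prodMk hb
  | succ l ih =>
    have hA := fun j i k => measurable_designMatrix_apply (p := p) (K := K) hz j i k
    have h1 : Measurable fun a => update p m K lam (z a) 0 (y a - designMatrix p K (z a) 1 *ᵥ
        (backfit p m K lam (z a) (y a) (b0 a) l).2) := by
      refine measurable_pi_lambda _ fun k => measurable_update_apply hz 0 (fun i => ?_) k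
      exact (hy i).sub (measurable_mulVec_apply (hA 1)
        (fun k => (measurable_pi_apply k).comp ih.snd) i)
    refine h1.prodMk (measurable_pi_lambda _ fun k => measurable_update_apply hz 1 (fun i => ?_) k)
    exact (hy i).sub (measurable_mulVec_apply (hA 0) (fun k => (measurable_pi_apply k).comp h1) i)

/-- No convergence is required: `limUnder` of a measurable sequence is measurable even with its
default values. -/
theorem measurable_backfitLimit (hz : Measurable z) {y : α → Fin n → ℝ}
    (hy : ∀ i, Measurable fun a => y a i) {b0 : α → Fin (K + p) → ℝ} (hb : Measurable b0) :
    Measurable fun a => backfitLimit p m K lam (z a) (y a) (b0 a) := by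
  have := StronglyMeasurable.limUnder (l := atTop)
    (f := fun l a => backfit p m K lam (z a) (y a) (b0 a) l)
    (fun l => (measurable_backfit (m := m) (lam := lam) hz hy hb l).stronglyMeasurable)
  exact this.measurable

theorem measurable_fhat {p m : ℕ} {K : ℕ → ℕ} {lam : Fin 2 → ℕ → ℝ} {f : Fin 2 → ℝ → ℝ}
    (hf : ∀ j, Measurable (f j)) {b0 : ∀ n, (Fin n → Fin 2 → ℝ) → Fin (K n + p) → ℝ}
    (hb0 : ∀ n, Measurable (b0 n)) (x : Fin 2 → ℝ) (n : ℕ) :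
    Measurable fun a : (ℕ → Fin 2 → ℝ) × (ℕ → ℝ) => fhat p m K lam f b0 x n a.1 a.2 := by
  have hz : Measurable fun (a : (ℕ → Fin 2 → ℝ) × (ℕ → ℝ)) (i : Fin n) => a.1 i := by fun_prop
  have hL := measurable_backfitLimit (p := p) (m := m) (K := K n) (lam := fun j => lam j n) hz
    (y := fun a => response f (fun i => a.1 i) (fun i => a.2 i)) (fun i => by
      have h0 := (hf 0).comp (show Measurable fun a : (ℕ → Fin 2 → ℝ) × (ℕ → ℝ) => a.1 i 0 by fun_prop)
      have h1 := (hf 1).comp (show Measurable fun a : (ℕ → Fin 2 → ℝ) × (ℕ → ℝ) => a.1 i 1 by fun_prop)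
      have h2 : Measurable fun a : (ℕ → Fin 2 → ℝ) × (ℕ → ℝ) => a.2 i := by fun_prop
      exact (h0.add h1).add h2) ((hb0 n).comp hz)
  refine measurable_pi_lambda _ fun j => ?_
  fin_cases j
  · exact (by fun_prop : Continuous fun v : Fin (K n + p) → ℝ =>
      basis p (K n) (x 0) ⬝ᵥ v).measurable.comp hL.fst
  · exact (by fun_prop : Continuous fun v : Fin (K n + p) → ℝ =>
      basis p (K n) (x 1) ⬝ᵥ v).measurable.comp hL.snd

theorem measurable_covMatrix_apply {β : Type*} [MeasurableSpace β] {κ : Kernel α β}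
    [IsSFiniteKernel κ] {T : α → β → Fin 2 → ℝ} (hT : Measurable (Function.uncurry T)) (j k : Fin 2) :
    Measurable fun a => covMatrix (T a) (κ a) j k := by
  have hTj : ∀ j, Measurable fun x : α × β => T x.1 x.2 j := fun j =>
    (measurable_pi_apply j).comp hT
  have hmean : ∀ j, Measurable fun a => ∫ e, T a e j ∂(κ a) := fun j =>
    ((hTj j).stronglyMeasurable.integral_kernel_prod_right').measurable
  have hprod : Measurable fun x : α × β => (T x.1 x.2 j - ∫ e, T x.1 e j ∂(κ x.1)) *
      (T x.1 x.2 k - ∫ e, T x.1 e k ∂(κ x.1)) :=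
    ((hTj j).sub ((hmean j).comp measurable_fst)).mul ((hTj k).sub ((hmean k).comp measurable_fst))
  exact (hprod.stronglyMeasurable.integral_kernel_prod_right').measurable

end Measurability

/-! ### Square roots of two by two matrices -/

section SquareRoot

/-- Polynomial conditions on the entries, from which measurability of the set of positive
semidefinite values follows. -/
theorem posSemidef_fin_two_iff (A : Matrix (Fin 2) (Fin 2) ℝ) :
    A.PosSemidef ↔ A 0 1 = A 1 0 ∧ 0 ≤ A 0 0 ∧ 0 ≤ A 1 1 ∧ 0 ≤ A.det := by
  constructor
  · intro h
    refine ⟨?_, h.diag_nonneg, h.diag_nonneg, h.det_nonneg⟩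
    have := h.1.apply 0 1
    simpa using this.symm
  · rintro ⟨hs, h0, h1, hd⟩
    rw [Matrix.det_fin_two, ← hs] at hd
    refine Matrix.PosSemidef.of_dotProduct_mulVec_nonneg ?_ fun v => ?_
    · ext i j
      fin_cases i <;> fin_cases j <;> simp [hs]
    · simp only [star_trivial, dotProduct, Matrix.mulVec, Fin.sum_univ_two, ← hs]
      rcases h0.eq_or_lt with h | h
      · rw [← h] at hd ⊢
        have : A 0 1 = 0 := by nlinarith
        rw [this]
        nlinarith [mul_nonneg h1 (sq_nonneg (v 1))]
      · have key : 0 ≤ A 0 0 * (v 0 * (A 0 0 * v 0 + A 0 1 * v 1) + v 1 * (A 0 1 * v 0 + A 1 1 * v 1)) := by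
          nlinarith [sq_nonneg (A 0 0 * v 0 + A 0 1 * v 1), mul_nonneg hd (sq_nonneg (v 1))]
        exact nonneg_of_mul_nonneg_right key h

/-- Cayley-Hamilton: with d² = det A one has (A + d)² = (tr A + 2d)A. If tr A + 2d = 0 then A = 0,
and the convention 0⁻¹ = 0 still gives the right value. -/
theorem sqrt_fin_two {A : Matrix (Fin 2) (Fin 2) ℝ} (hA : A.PosSemidef) :
    CFC.sqrt A = (√(A 0 0 + A 1 1 + 2 * √A.det))⁻¹ • (A + √A.det • 1) := by
  obtain ⟨hs, h0, h1, hd⟩ := (posSemidef_fin_two_iff A).mp hA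
  set d := √A.det with hdef
  have hd0 : 0 ≤ d := Real.sqrt_nonneg _
  have hdd : d * d = A.det := Real.mul_self_sqrt hd
  rw [Matrix.det_fin_two, ← hs] at hdd
  set t := A 0 0 + A 1 1 + 2 * d with ht
  have ht0 : 0 ≤ t := by positivity
  apply CFC.sqrt_unique
  · rcases ht0.eq_or_lt with h | h
    · have e0 : A 0 0 = 0 := by linarith
      have e1 : A 1 1 = 0 := by linarith
      have e2 : A 0 1 = 0 := by
        have : d = 0 := by linarith
        rw [e0, this] at hdd
        nlinarith
      have hA0 : A = 0 := by
        ext i j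
        fin_cases i <;> fin_cases j <;> simp [e0, e1, e2, ← hs]
      rw [← h]
      simp [hA0]
    · rw [Matrix.smul_mul, Matrix.mul_smul, smul_smul, ← mul_inv, Real.mul_self_sqrt ht0,
        inv_smul_eq_iff₀ h.ne']
      ext i j
      fin_cases i <;> fin_cases j <;>
        simp [Matrix.mul_apply, Fin.sum_univ_two, ← hs, ht] <;> nlinarith
  · rw [Matrix.nonneg_iff_posSemidef]
    refine Matrix.PosSemidef.smul (hA.add (Matrix.PosSemidef.one.smul hd0)) (by positivity)

/-- Where V⁻¹ is positive semidefinite the explicit root is a measurable function of the entries;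
elsewhere `CFC.sqrt` takes the default value 0. -/
theorem measurable_invSqrt_apply {α : Type*} [MeasurableSpace α] {V : α → Matrix (Fin 2) (Fin 2) ℝ}
    (hV : ∀ i j, Measurable fun a => V a i j) (i j : Fin 2) :
    Measurable fun a => invSqrt (V a) i j := by
  have hI := measurable_inv_apply hV
  have hdet := measurable_det hI
  have hset : MeasurableSet {a | ((V a)⁻¹).PosSemidef} := by
    simp only [posSemidef_fin_two_iff]
    exact (measurableSet_eq_fun (hI 0 1) (hI 1 0)).inter ((measurableSet_le measurable_const (hI 0 0)).inter
      ((measurableSet_le measurable_const (hI 1 1)).inter (measurableSet_le measurable_const hdet)))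
  classical
  have e : (fun a => invSqrt (V a) i j) = fun a => if a ∈ {a | ((V a)⁻¹).PosSemidef} then
      (√((V a)⁻¹ 0 0 + (V a)⁻¹ 1 1 + 2 * √((V a)⁻¹).det))⁻¹ *
        ((V a)⁻¹ i j + √((V a)⁻¹).det * (1 : Matrix (Fin 2) (Fin 2) ℝ) i j) else 0 := by
    funext a
    split_ifs with h
    · rw [invSqrt, sqrt_fin_two h]
      simp
    · rw [invSqrt, CFC.sqrt_of_not_nonneg]
      · rfl
      · rwa [Matrix.nonneg_iff_posSemidef]
  rw [e]
  refine Measurable.ite hset ?_ measurable_const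
  refine ((((hI 0 0).add (hI 1 1)).add (hdet.sqrt.const_mul 2)).sqrt.inv).mul ?_
  exact (hI i j).add (hdet.sqrt.mul_const _)

end SquareRoot

/-! ### Laws on the square with density bounded above and below -/

section Law

/-- The uniform law on the open unit interval. -/
noncomputable def uniformLaw : Measure ℝ := volume.restrict (Ioo (0 : ℝ) 1)

instance : IsProbabilityMeasure uniformLaw :=
  ⟨by simp [uniformLaw]⟩

theorem ae_uniformLaw : ∀ᵐ x ∂uniformLaw, x ∈ Ioo (0 : ℝ) 1 :=
  ae_restrict_mem measurableSet_Ioo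

theorem restrict_unitSquare :
    (volume : Measure (Fin 2 → ℝ)).restrict unitSquare = Measure.pi fun _ => uniformLaw := by
  rw [unitSquare, volume_pi, Measure.restrict_pi_pi]
  rfl

theorem measurableSet_unitSquare : MeasurableSet unitSquare :=
  MeasurableSet.univ_pi fun _ => measurableSet_Ioo

theorem integral_pi_uniformLaw_mul (g₀ g₁ : ℝ → ℝ) :
    ∫ z, g₀ (z 0) * g₁ (z 1) ∂(Measure.pi fun _ : Fin 2 => uniformLaw) =
      (∫ x, g₀ x ∂uniformLaw) * ∫ x, g₁ x ∂uniformLaw := by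
  have := integral_fintype_prod_eq_prod (μ := fun _ : Fin 2 => uniformLaw)
    (f := fun i x => if i = 0 then g₀ x else g₁ x)
  simpa [Fin.prod_univ_two] using this

theorem integral_pi_uniformLaw_eval (j : Fin 2) (g : ℝ → ℝ) (hg : Measurable g) :
    ∫ z, g (z j) ∂(Measure.pi fun _ : Fin 2 => uniformLaw) = ∫ x, g x ∂uniformLaw := by
  have h := measurePreserving_eval (fun _ : Fin 2 => uniformLaw) j
  conv_rhs => rw [← h.map_eq, integral_map h.measurable.aemeasurable hg.aestronglyMeasurable]

theorem integral_sub_const_sq {α : Type*} [MeasurableSpace α] {P : Measure α}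
    [IsProbabilityMeasure P] {g : α → ℝ} (hg : Integrable g P) (hg2 : Integrable (fun x => g x ^ 2) P)
    (t : ℝ) : ∫ x, (g x - t) ^ 2 ∂P = ∫ x, g x ^ 2 ∂P - 2 * t * ∫ x, g x ∂P + t ^ 2 := by
  have hi : Integrable (fun x => g x ^ 2 - 2 * t * g x) P := hg2.sub (hg.const_mul _)
  calc _ = ∫ x, ((g x ^ 2 - 2 * t * g x) + t ^ 2) ∂P := by congr 1; funext x; ring
    _ = _ := by
      rw [integral_add hi (integrable_const _), integral_sub hg2 (hg.const_mul _),
        integral_const_mul]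
      simp

theorem sq_integral_le {α : Type*} [MeasurableSpace α] {P : Measure α}
    [IsProbabilityMeasure P] {g : α → ℝ} (hg : Integrable g P)
    (hg2 : Integrable (fun x => g x ^ 2) P) : (∫ x, g x ∂P) ^ 2 ≤ ∫ x, g x ^ 2 ∂P := by
  have h0 : 0 ≤ ∫ x, (g x - ∫ x, g x ∂P) ^ 2 ∂P := integral_nonneg fun x => sq_nonneg _
  rw [integral_sub_const_sq hg hg2] at h0
  nlinarith

/-- A probability law on the unit square whose density lies between `c` and `C`. -/
structure SquareLaw (ν : Measure (Fin 2 → ℝ)) (c C : ℝ) : Prop where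
  isProb : IsProbabilityMeasure ν
  c_pos : 0 < c
  C_pos : 0 < C
  lower : ENNReal.ofReal c • (Measure.pi fun _ : Fin 2 => uniformLaw) ≤ ν
  upper : ν ≤ ENNReal.ofReal C • (Measure.pi fun _ : Fin 2 => uniformLaw)

theorem squareLaw_withDensity {q : (Fin 2 → ℝ) → ℝ} {c C : ℝ} (hc : 0 < c)
    (hq : ∀ z ∈ unitSquare, c ≤ q z ∧ q z ≤ C) (hprob : IsProbabilityMeasure
      ((volume.restrict unitSquare).withDensity (fun z => ENNReal.ofReal (q z)))) :
    SquareLaw ((volume.restrict unitSquare).withDensity (fun z => ENNReal.ofReal (q z))) c C := by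
  have hC : c ≤ C := by
    have := hq (fun _ => 1 / 2) (by intro i _; norm_num)
    linarith
  refine ⟨hprob, hc, hc.trans_le hC, ?_, ?_⟩
  · rw [← restrict_unitSquare, ← withDensity_const]
    refine withDensity_mono ?_
    filter_upwards [ae_restrict_mem measurableSet_unitSquare] with z hz
    exact ENNReal.ofReal_le_ofReal (hq z hz).1
  · rw [← restrict_unitSquare, ← withDensity_const]
    refine withDensity_mono ?_
    filter_upwards [ae_restrict_mem measurableSet_unitSquare] with z hz
    exact ENNReal.ofReal_le_ofReal (hq z hz).2

namespace SquareLaw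
variable {ν : Measure (Fin 2 → ℝ)} {c C : ℝ} (L : SquareLaw ν c C)
include L

theorem ae_mem : ∀ᵐ z ∂ν, z ∈ unitSquare := by
  have h1 : ∀ᵐ z ∂(Measure.pi fun _ : Fin 2 => uniformLaw), z ∈ unitSquare := by
    rw [← restrict_unitSquare]
    exact ae_restrict_mem measurableSet_unitSquare
  have h2 : ν ≪ (Measure.pi fun _ : Fin 2 => uniformLaw) :=
    Measure.absolutelyContinuous_of_le_smul L.upper
  exact h2.ae_le h1

theorem integrable {g : (Fin 2 → ℝ) → ℝ} (hg : Measurable g) {R : ℝ}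
    (hR : ∀ z ∈ unitSquare, |g z| ≤ R) : Integrable g ν := by
  have := L.isProb
  refine Integrable.of_bound hg.aestronglyMeasurable R ?_
  filter_upwards [L.ae_mem] with z hz using hR z hz

omit L in
theorem integrable_pi {g : (Fin 2 → ℝ) → ℝ} (hg : Measurable g) {R : ℝ}
    (hR : ∀ z ∈ unitSquare, |g z| ≤ R) :
    Integrable g (Measure.pi fun _ : Fin 2 => uniformLaw) := by
  refine Integrable.of_bound hg.aestronglyMeasurable R ?_
  rw [← restrict_unitSquare]
  filter_upwards [ae_restrict_mem measurableSet_unitSquare] with z hz using hR z hz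

theorem mul_integral_le {g : (Fin 2 → ℝ) → ℝ} (hg : Measurable g) {R : ℝ}
    (hR : ∀ z ∈ unitSquare, |g z| ≤ R) (h0 : ∀ z ∈ unitSquare, 0 ≤ g z) :
    c * ∫ z, g z ∂(Measure.pi fun _ : Fin 2 => uniformLaw) ≤ ∫ z, g z ∂ν := by
  have h1 := integral_mono_measure L.lower (f := g)
    (by filter_upwards [L.ae_mem] with z hz using h0 z hz) (L.integrable hg hR)
  rwa [integral_smul_measure, ENNReal.toReal_ofReal L.c_pos.le, smul_eq_mul] at h1

theorem integral_le_mul {g : (Fin 2 → ℝ) → ℝ} (hg : Measurable g) {R : ℝ}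
    (hR : ∀ z ∈ unitSquare, |g z| ≤ R) (h0 : ∀ z ∈ unitSquare, 0 ≤ g z) :
    ∫ z, g z ∂ν ≤ C * ∫ z, g z ∂(Measure.pi fun _ : Fin 2 => uniformLaw) := by
  have h2 : ∀ᵐ z ∂(Measure.pi fun _ : Fin 2 => uniformLaw), z ∈ unitSquare := by
    rw [← restrict_unitSquare]
    exact ae_restrict_mem measurableSet_unitSquare
  have h1 := integral_mono_measure L.upper (f := g)
    (by
      refine Measure.ae_smul_measure ?_ _
      filter_upwards [h2] with z hz using h0 z hz)
    ((integrable_pi hg hR).smul_measure ENNReal.ofReal_ne_top)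
  rwa [integral_smul_measure, ENNReal.toReal_ofReal L.C_pos.le, smul_eq_mul] at h1

/-- Additive functions are stable under a law with density bounded away from zero. -/
theorem additive_lower {g₀ g₁ : ℝ → ℝ} (hg₀ : Measurable g₀) (hg₁ : Measurable g₁) {R : ℝ}
    (hR₀ : ∀ x ∈ Ioo (0 : ℝ) 1, |g₀ x| ≤ R) (hR₁ : ∀ x ∈ Ioo (0 : ℝ) 1, |g₁ x| ≤ R) :
    (∫ x, g₀ x ^ 2 ∂uniformLaw) + ∫ x, g₁ x ^ 2 ∂uniformLaw ≤
      max ((2 + 6 * C) / c) 6 *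
        (∫ z, (g₀ (z 0) + g₁ (z 1)) ^ 2 ∂ν + (∫ z, g₁ (z 1) ∂ν) ^ 2) := by
  have := L.isProb
  have hR : 0 ≤ R := (abs_nonneg _).trans (hR₀ (1 / 2) (by norm_num))
  -- Shifting the constant a from g₁ to g₀ centres g₁ under the uniform law, so the cross term
  -- vanishes under the product measure.
  set a := ∫ x, g₁ x ∂uniformLaw with ha
  have hint : ∀ g : ℝ → ℝ, Measurable g → ∀ R : ℝ, (∀ x ∈ Ioo (0 : ℝ) 1, |g x| ≤ R) →
      Integrable g uniformLaw := fun g hg R hR =>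
    Integrable.of_bound hg.aestronglyMeasurable R
      (by filter_upwards [ae_uniformLaw] with z hz using hR z hz)
  have hi₀ := hint g₀ hg₀ R hR₀
  have hi₁ := hint g₁ hg₁ R hR₁
  have hsq : ∀ g : ℝ → ℝ, (∀ x ∈ Ioo (0 : ℝ) 1, |g x| ≤ R) → ∀ x ∈ Ioo (0 : ℝ) 1,
      |g x ^ 2| ≤ R ^ 2 := fun g hg x hx => by
    rw [abs_pow]; exact pow_le_pow_left₀ (abs_nonneg _) (hg x hx) 2
  have hi₀2 := hint _ (hg₀.pow_const 2) _ (hsq g₀ hR₀)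
  have hi₁2 := hint _ (hg₁.pow_const 2) _ (hsq g₁ hR₁)
  have haR : |a| ≤ R := by
    rw [ha, ← Real.norm_eq_abs]
    refine (norm_integral_le_of_norm_le_const (C := R) ?_).trans (by simp)
    filter_upwards [ae_uniformLaw] with z hz using hR₁ z hz
  set H0 := ∫ x, (g₀ x + a) ^ 2 ∂uniformLaw with hH0
  set H1 := ∫ x, (g₁ x - a) ^ 2 ∂uniformLaw with hH1
  have e1 : H1 = ∫ x, g₁ x ^ 2 ∂uniformLaw - a ^ 2 := by
    rw [hH1, integral_sub_const_sq hi₁ hi₁2, ← ha]; ring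
  have e0 : ∫ x, g₀ x ^ 2 ∂uniformLaw ≤ 2 * H0 + 2 * a ^ 2 := by
    have hi : Integrable (fun x => (g₀ x + a) ^ 2) uniformLaw :=
      hint _ ((hg₀.add_const a).pow_const 2) ((2 * R) ^ 2) fun x hx => by
        rw [abs_pow]
        refine pow_le_pow_left₀ (abs_nonneg _) ((abs_add_le _ _).trans ?_) 2
        linarith [hR₀ x hx]
    have : 2 * H0 + 2 * a ^ 2 = ∫ x, (2 * (g₀ x + a) ^ 2 + 2 * a ^ 2) ∂uniformLaw := by
      rw [integral_add (hi.const_mul 2) (integrable_const _), integral_const_mul]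
      simp [hH0]
    rw [this]
    refine integral_mono hi₀2 ((hi.const_mul 2).add (integrable_const _)) fun x => ?_
    simp only
    nlinarith [sq_nonneg (g₀ x + 2 * a)]
  have hmem : ∀ z ∈ unitSquare, ∀ j : Fin 2, z j ∈ Ioo (0 : ℝ) 1 := fun z hz j => hz j (mem_univ j)
  have hm0 : Measurable fun z : Fin 2 → ℝ => g₀ (z 0) + a :=
    (hg₀.comp (measurable_pi_apply 0)).add_const a
  have hm1 : Measurable fun z : Fin 2 → ℝ => g₁ (z 1) - a :=
    (hg₁.comp (measurable_pi_apply 1)).sub_const a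
  have hb0 : ∀ z ∈ unitSquare, |g₀ (z 0) + a| ≤ 2 * R := fun z hz =>
    (abs_add_le _ _).trans (by linarith [hR₀ _ (hmem z hz 0)])
  have hb1 : ∀ z ∈ unitSquare, |g₁ (z 1) - a| ≤ 2 * R := fun z hz =>
    (abs_sub _ _).trans (by linarith [hR₁ _ (hmem z hz 1)])
  have e2 : ∫ z, (g₀ (z 0) + g₁ (z 1)) ^ 2 ∂(Measure.pi fun _ : Fin 2 => uniformLaw) =
      H0 + H1 := by
    have hs : ∀ z : Fin 2 → ℝ, (g₀ (z 0) + g₁ (z 1)) ^ 2 =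
        (g₀ (z 0) + a) ^ 2 + 2 * ((g₀ (z 0) + a) * (g₁ (z 1) - a)) + (g₁ (z 1) - a) ^ 2 :=
      fun z => by ring
    simp_rw [hs]
    have i0 : Integrable (fun z : Fin 2 → ℝ => (g₀ (z 0) + a) ^ 2)
        (Measure.pi fun _ : Fin 2 => uniformLaw) :=
      integrable_pi (hm0.pow_const 2) (R := (2 * R) ^ 2) fun z hz => by
        rw [abs_pow]; exact pow_le_pow_left₀ (abs_nonneg _) (hb0 z hz) 2
    have i1 : Integrable (fun z : Fin 2 → ℝ => (g₁ (z 1) - a) ^ 2)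
        (Measure.pi fun _ : Fin 2 => uniformLaw) :=
      integrable_pi (hm1.pow_const 2) (R := (2 * R) ^ 2) fun z hz => by
        rw [abs_pow]; exact pow_le_pow_left₀ (abs_nonneg _) (hb1 z hz) 2
    have i01 : Integrable (fun z : Fin 2 → ℝ => (g₀ (z 0) + a) * (g₁ (z 1) - a))
        (Measure.pi fun _ : Fin 2 => uniformLaw) :=
      integrable_pi (hm0.mul hm1) (R := (2 * R) * (2 * R)) fun z hz => by
        rw [abs_mul]
        exact mul_le_mul (hb0 z hz) (hb1 z hz) (abs_nonneg _) (by linarith)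
    have hz1 : ∫ x, (g₁ x - a) ∂uniformLaw = 0 := by
      rw [integral_sub hi₁ (integrable_const _), ← ha]; simp
    have i2 : Integrable (fun z : Fin 2 → ℝ => (g₀ (z 0) + a) ^ 2 +
        2 * ((g₀ (z 0) + a) * (g₁ (z 1) - a))) (Measure.pi fun _ : Fin 2 => uniformLaw) :=
      i0.add (i01.const_mul 2)
    rw [integral_add i2 i1, integral_add i0 (i01.const_mul 2),
      integral_const_mul, integral_pi_uniformLaw_mul (fun x => g₀ x + a) (fun x => g₁ x - a), hz1,
      integral_pi_uniformLaw_eval 0 (fun x => (g₀ x + a) ^ 2) ((hg₀.add_const a).pow_const 2),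
      integral_pi_uniformLaw_eval 1 (fun x => (g₁ x - a) ^ 2) ((hg₁.sub_const a).pow_const 2)]
    simp [hH0, hH1]
  have e3 : c * (H0 + H1) ≤ ∫ z, (g₀ (z 0) + g₁ (z 1)) ^ 2 ∂ν := by
    rw [← e2]
    refine L.mul_integral_le (((hg₀.comp (measurable_pi_apply 0)).add
      (hg₁.comp (measurable_pi_apply 1))).pow_const 2) (R := (2 * R) ^ 2) (fun z hz => ?_)
      fun z _ => sq_nonneg _
    rw [abs_pow]
    refine pow_le_pow_left₀ (abs_nonneg _) ((abs_add_le _ _).trans ?_) 2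
    have h1 := hR₀ _ (hmem z hz 0)
    have h2 := hR₁ _ (hmem z hz 1)
    linarith
  -- The uniform mean differs from the mean under ν by the ν-mean of g₁ - a, whose square is at most
  -- C times H1.
  have e4 : a ^ 2 ≤ 2 * (∫ z, g₁ (z 1) ∂ν) ^ 2 + 2 * (C * H1) := by
    have hb1' : ∀ z ∈ unitSquare, |(g₁ (z 1) - a) ^ 2| ≤ (2 * R) ^ 2 := fun z hz => by
      rw [abs_pow]; exact pow_le_pow_left₀ (abs_nonneg _) (hb1 z hz) 2
    have h1 := L.integral_le_mul (hm1.pow_const 2) hb1' fun z _ => sq_nonneg _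
    rw [integral_pi_uniformLaw_eval 1 (fun x => (g₁ x - a) ^ 2)
      ((hg₁.sub_const a).pow_const 2), ← hH1] at h1
    have hi := L.integrable (hm1.pow_const 2) hb1'
    have hi' := L.integrable hm1 hb1
    have hig : Integrable (fun z : Fin 2 → ℝ => g₁ (z 1)) ν := L.integrable (hg₁.comp (measurable_pi_apply 1)) fun z hz => hR₁ _ (hmem z hz 1)
    have h2 : (∫ z, (g₁ (z 1) - a) ∂ν) ^ 2 ≤ ∫ z, (g₁ (z 1) - a) ^ 2 ∂ν :=
      sq_integral_le hi' hi
    have h3 : ∫ z, (g₁ (z 1) - a) ∂ν = ∫ z, g₁ (z 1) ∂ν - a := by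
      rw [integral_sub hig (integrable_const _)]; simp
    rw [h3] at h2
    nlinarith [sq_nonneg (2 * (∫ z, g₁ (z 1) ∂ν) - a)]
  have hH0n : 0 ≤ H0 := integral_nonneg fun x => sq_nonneg _
  have hH1n : 0 ≤ H1 := integral_nonneg fun x => sq_nonneg _
  have hc := L.c_pos
  have hC := L.C_pos
  set T := (∫ z, g₁ (z 1) ∂ν) ^ 2 with hT
  have hTn : 0 ≤ T := sq_nonneg _
  -- The left side of the claim is at most 2H0 + H1 + 3a², and the bound on a² makes this at most (2
  -- + 6C)(H0 + H1) + 6T.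
  have f1 : (2 + 6 * C) * (H0 + H1) ≤ max ((2 + 6 * C) / c) 6 * (c * (H0 + H1)) := by
    rw [← mul_assoc]
    refine mul_le_mul_of_nonneg_right ?_ (by linarith)
    rw [← div_le_iff₀ hc]
    exact le_max_left _ _
  have f2 : 6 * T ≤ max ((2 + 6 * C) / c) 6 * T :=
    mul_le_mul_of_nonneg_right (le_max_right _ _) hTn
  have f3 : max ((2 + 6 * C) / c) 6 * (c * (H0 + H1)) ≤
      max ((2 + 6 * C) / c) 6 * ∫ z, (g₀ (z 0) + g₁ (z 1)) ^ 2 ∂ν :=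
    mul_le_mul_of_nonneg_left e3 (le_max_of_le_right (by norm_num))
  rw [mul_add]
  nlinarith [mul_nonneg hC.le hH0n, mul_nonneg hC.le hH1n]

end SquareLaw
end Law

theorem sq_dotProduct_eq_sum {ι : Type*} [Fintype ι] (x y : ι → ℝ) :
    (x ⬝ᵥ y) ^ 2 = ∑ ab : ι × ι, x ab.1 * x ab.2 * (y ab.1 * y ab.2) := by
  rw [sq, dotProduct, Fintype.sum_mul_sum, Fintype.sum_prod_type]
  exact Finset.sum_congr rfl fun a _ => Finset.sum_congr rfl fun b _ => by ring

/-! ### Moments of the spline features -/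

section Feature

/-- The vector `(B(z₁), B(z₂))` of basis functions of the additive model. -/
noncomputable def feature (p K : ℕ) (z : Fin 2 → ℝ) : Fin 2 × Fin (K + p) → ℝ :=
  fun a => basis p K (z a.1) a.2

theorem measurable_basis_apply (p K : ℕ) (a : Fin (K + p)) : Measurable fun x => basis p K x a :=
  (measurable_pi_apply a).comp (measurable_basis p K)

theorem measurable_feature_apply (p K : ℕ) (a : Fin 2 × Fin (K + p)) :
    Measurable fun z => feature p K z a :=
  (measurable_basis_apply p K a.2).comp (measurable_pi_apply a.1)

variable {p K : ℕ} (hK : 0 < K)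

theorem apply_mem_Ioc {z : Fin 2 → ℝ} (hz : z ∈ unitSquare) (j : Fin 2) : z j ∈ Ioc (0 : ℝ) 1 :=
  Ioo_subset_Ioc_self (hz j (mem_univ j))

include hK

theorem abs_basis_le_one {x : ℝ} (hx : x ∈ Ioc (0 : ℝ) 1) (a : Fin (K + p)) :
    |basis p K x a| ≤ 1 := by
  rw [abs_of_nonneg (basis_nonneg hK x a)]
  exact basis_le_one hK hx a

theorem integral_basis_le (a : Fin (K + p)) :
    ∫ x, basis p K x a ∂uniformLaw ≤ (p + 1) / K := by
  have hK' : (0 : ℝ) < K := by exact_mod_cast hK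
  set I := Ioc ((((a : ℕ) : ℝ) - p) / K) ((((a : ℕ) : ℝ) + 1) / K) with hI
  have h1 : ∫ x, basis p K x a ∂uniformLaw ≤ ∫ x, I.indicator 1 x ∂uniformLaw := by
    refine integral_mono_ae ?_ ?_ ?_
    · refine Integrable.of_bound (measurable_basis_apply p K a).aestronglyMeasurable 1 ?_
      filter_upwards [ae_uniformLaw] with x hx
      exact abs_basis_le_one hK (Ioo_subset_Ioc_self hx) a
    · exact (integrable_const (1 : ℝ)).indicator measurableSet_Ioc
    · filter_upwards [ae_uniformLaw] with x hx
      by_cases hxI : x ∈ I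
      · rw [indicator_of_mem hxI]
        exact basis_le_one hK (Ioo_subset_Ioc_self hx) a
      · rw [indicator_of_notMem hxI]
        refine (basis_eq_zero hK ?_).le
        by_contra! h
        exact hxI ⟨h.1, h.2⟩
  refine h1.trans ?_
  rw [integral_indicator_one measurableSet_Ioc]
  have h2 : uniformLaw.real I ≤ (volume : Measure ℝ).real I := by
    unfold uniformLaw Measure.real
    refine ENNReal.toReal_mono ?_ (Measure.restrict_apply_le _ _)
    rw [hI, Real.volume_Ioc]; exact ENNReal.ofReal_ne_top
  refine h2.trans (le_of_eq ?_)
  have h3 : (((a : ℕ) : ℝ) - p) / K ≤ (((a : ℕ) : ℝ) + 1) / K := by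
    gcongr
    have : (0 : ℝ) ≤ p := Nat.cast_nonneg p
    linarith
  rw [hI, Real.volume_real_Ioc_of_le h3]
  field_simp
  ring

theorem integral_basis_nonneg (a : Fin (K + p)) : 0 ≤ ∫ x, basis p K x a ∂uniformLaw :=
  integral_nonneg fun x => basis_nonneg hK x a

theorem feature_nonneg (z : Fin 2 → ℝ) (a : Fin 2 × Fin (K + p)) : 0 ≤ feature p K z a :=
  basis_nonneg hK _ _

theorem abs_feature_le_one {z : Fin 2 → ℝ} (hz : z ∈ unitSquare) (a : Fin 2 × Fin (K + p)) :
    |feature p K z a| ≤ 1 :=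
  abs_basis_le_one hK (apply_mem_Ioc hz _) _

theorem feature_dotProduct_self_le {z : Fin 2 → ℝ} (hz : z ∈ unitSquare) :
    feature p K z ⬝ᵥ feature p K z ≤ 2 := by
  rw [dotProduct_eq_part]
  have h0 := basis_dotProduct_self_le (p := p) hK (apply_mem_Ioc hz 0)
  have h1 := basis_dotProduct_self_le (p := p) hK (apply_mem_Ioc hz 1)
  change basis p K (z 0) ⬝ᵥ basis p K (z 0) + basis p K (z 1) ⬝ᵥ basis p K (z 1) ≤ 2
  linarith

theorem abs_basis_dotProduct_le {x : ℝ} (hx : x ∈ Ioc (0 : ℝ) 1) (b : Fin (K + p) → ℝ) :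
    |basis p K x ⬝ᵥ b| ≤ ∑ k, |b k| := by
  refine (Finset.abs_sum_le_sum_abs _ _).trans (Finset.sum_le_sum fun k _ => ?_)
  rw [abs_mul]
  exact mul_le_of_le_one_left (abs_nonneg _) (abs_basis_le_one hK hx k)

omit hK in
theorem measurable_basis_dotProduct (b : Fin (K + p) → ℝ) :
    Measurable fun x => basis p K x ⬝ᵥ b :=
  Finset.measurable_sum _ fun k _ => (measurable_basis_apply p K k).mul_const _

end Feature

namespace SquareLaw
variable {ν : Measure (Fin 2 → ℝ)} {c C : ℝ} (L : SquareLaw ν c C) {p K : ℕ} (hK : 0 < K)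
include L hK

theorem integrable_feature (a : Fin 2 × Fin (K + p)) : Integrable (fun z => feature p K z a) ν :=
  L.integrable (measurable_feature_apply p K a) fun _ hz => abs_feature_le_one hK hz a

theorem integrable_feature_mul (a b : Fin 2 × Fin (K + p)) :
    Integrable (fun z => feature p K z a * feature p K z b) ν :=
  L.integrable (R := 1) ((measurable_feature_apply p K a).mul (measurable_feature_apply p K b))
    fun _ hz => by
      rw [abs_mul]
      exact mul_le_one₀ (abs_feature_le_one hK hz a) (abs_nonneg _) (abs_feature_le_one hK hz b)

theorem integral_feature_le (a : Fin 2 × Fin (K + p)) :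
    ∫ z, feature p K z a ∂ν ≤ C * ((p + 1) / K) := by
  refine (L.integral_le_mul (measurable_feature_apply p K a)
    (fun _ hz => abs_feature_le_one hK hz a) fun z _ => feature_nonneg hK z a).trans ?_
  refine mul_le_mul_of_nonneg_left ?_ L.C_pos.le
  exact (integral_pi_uniformLaw_eval a.1 _ (measurable_basis_apply p K a.2)).trans_le
    (integral_basis_le hK a.2)

theorem integral_feature_mul_le (k l : Fin (K + p)) :
    ∫ z, feature p K z (0, k) * feature p K z (1, l) ∂ν ≤ C * ((p + 1) / K) ^ 2 := by
  refine (L.integral_le_mul (g := fun z => feature p K z (0, k) * feature p K z (1, l)) (R := 1)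
    ((measurable_feature_apply p K _).mul (measurable_feature_apply p K _)) (fun _ hz => ?_)
    fun z _ => mul_nonneg (feature_nonneg hK z _) (feature_nonneg hK z _)).trans ?_
  · rw [abs_mul]
    exact mul_le_one₀ (abs_feature_le_one hK hz _) (abs_nonneg _) (abs_feature_le_one hK hz _)
  refine mul_le_mul_of_nonneg_left ?_ L.C_pos.le
  refine (integral_pi_uniformLaw_mul (fun x => basis p K x k) fun x => basis p K x l).trans_le ?_
  rw [sq]
  have hK' : (0 : ℝ) < K := by exact_mod_cast hK
  exact mul_le_mul (integral_basis_le hK k) (integral_basis_le hK l) (integral_basis_nonneg hK l)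
    (by positivity)

/-- The second moment of a spline in one of the covariates. -/
theorem integral_basis_dotProduct_sq_le (j : Fin 2) (b : Fin (K + p) → ℝ) :
    ∫ z, (basis p K (z j) ⬝ᵥ b) ^ 2 ∂ν ≤ C * ((p + 1) / K) * (b ⬝ᵥ b) := by
  have h1 : ∀ᵐ z ∂ν, (basis p K (z j) ⬝ᵥ b) ^ 2 ≤ ∑ k, feature p K z (j, k) * b k ^ 2 := by
    filter_upwards [L.ae_mem] with z hz
    have h2 := Finset.sum_sq_le_sum_mul_sum_of_sq_le_mul Finset.univ
      (r := fun k => basis p K (z j) k * b k) (f := fun k => basis p K (z j) k)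
      (g := fun k => basis p K (z j) k * b k ^ 2) (fun k _ => basis_nonneg hK _ k)
      (fun k _ => mul_nonneg (basis_nonneg hK _ k) (sq_nonneg _)) fun k _ => (by ring : _ = _).le
    rw [sum_basis hK (apply_mem_Ioc hz j), one_mul] at h2
    exact h2
  have hi : ∀ k, Integrable (fun z => feature p K z (j, k) * b k ^ 2) ν := fun k =>
    (L.integrable_feature hK (j, k)).mul_const _
  have hi2 : Integrable (fun z => (basis p K (z j) ⬝ᵥ b) ^ 2) ν :=
    L.integrable (R := (∑ k, |b k|) ^ 2)
      (((measurable_basis_dotProduct b).comp (measurable_pi_apply j)).pow_const 2) fun z hz => by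
        rw [abs_pow]
        exact pow_le_pow_left₀ (abs_nonneg _) (abs_basis_dotProduct_le hK (apply_mem_Ioc hz j) b) 2
  refine (integral_mono_ae hi2 (integrable_finsetSum _ fun k _ => hi k) h1).trans ?_
  rw [integral_finsetSum _ fun k _ => hi k, dotProduct, Finset.mul_sum]
  refine Finset.sum_le_sum fun k _ => ?_
  rw [integral_mul_const, ← sq]
  exact mul_le_mul_of_nonneg_right (L.integral_feature_le hK _) (sq_nonneg _)

omit hK in
-- B-spline stability in each coordinate combined with the stability of additive functions; the
-- squared mean controls the null direction, on which the first term vanishes.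
theorem exists_feature_form_lower (p : ℕ) : ∃ c' > 0, ∀ K > 0, ∀ b : Fin 2 × Fin (K + p) → ℝ,
    c' / K * (b ⬝ᵥ b) ≤ ∫ z, (feature p K z ⬝ᵥ b) ^ 2 ∂ν +
      (∫ z, basis p K (z 1) ⬝ᵥ part 1 b ∂ν) ^ 2 := by
  obtain ⟨c₀, hc₀, h⟩ := exists_basis_form_lower p
  set m := max ((2 + 6 * C) / c) 6 with hm
  have hm0 : 0 < m := lt_max_of_lt_right (by norm_num)
  refine ⟨c₀ / m, by positivity, fun K hK b => ?_⟩
  have key : ∀ j : Fin 2, c₀ / K * (part j b ⬝ᵥ part j b) ≤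
      ∫ x, (basis p K x ⬝ᵥ part j b) ^ 2 ∂uniformLaw := fun j => by
    refine (h K hK (part j b)).trans (le_of_eq ?_)
    rw [intervalIntegral.integral_of_le zero_le_one, integral_Ioc_eq_integral_Ioo]
    rfl
  set R := ∑ j, ∑ k, |part j b k| with hR
  have hbd : ∀ j : Fin 2, ∀ x ∈ Ioo (0 : ℝ) 1, |basis p K x ⬝ᵥ part j b| ≤ R := fun j x hx =>
    (abs_basis_dotProduct_le hK (Ioo_subset_Ioc_self hx) _).trans
      (Finset.single_le_sum (f := fun j => ∑ k, |part j b k|)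
        (fun j _ => Finset.sum_nonneg fun k _ => abs_nonneg _) (Finset.mem_univ j))
  have h1 := L.additive_lower (measurable_basis_dotProduct (part 0 b))
    (measurable_basis_dotProduct (part 1 b)) (hbd 0) (hbd 1)
  have h2 : ∀ z : Fin 2 → ℝ, feature p K z ⬝ᵥ b =
      basis p K (z 0) ⬝ᵥ part 0 b + basis p K (z 1) ⬝ᵥ part 1 b := fun z => dotProduct_eq_part _ _
  simp_rw [h2]
  rw [dotProduct_eq_part b b]
  have h3 : c₀ / m / K = m⁻¹ * (c₀ / K) := by field_simp
  rw [h3, mul_assoc, inv_mul_le_iff₀ hm0, mul_add]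
  linarith [key 0, key 1]

end SquareLaw

/-! ### Deviation of the sample Gram matrix from its mean -/

section Deviation

/-- The squared deviation of the Gram matrix and of the column sums from their expectations. -/
noncomputable def deviation (p K : ℕ) (ν : Measure (Fin 2 → ℝ)) {n : ℕ} (z : Fin n → Fin 2 → ℝ) : ℝ :=
  ∑ ab : (Fin 2 × Fin (K + p)) × (Fin 2 × Fin (K + p)),
      (∑ i, feature p K (z i) ab.1 * feature p K (z i) ab.2 -
        n * ∫ z, feature p K z ab.1 * feature p K z ab.2 ∂ν) ^ 2 +
    ∑ a, (∑ i, feature p K (z i) a - n * ∫ z, feature p K z a ∂ν) ^ 2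

variable {p K n : ℕ} {ν : Measure (Fin 2 → ℝ)} {c C : ℝ}

/-- The quadratic form is linear in the matrix of products of entries of b, so Cauchy-Schwarz bounds
its deviation by Frobenius norms, uniformly in b. -/
theorem SquareLaw.abs_sum_feature_sq_sub_le (L : SquareLaw ν c C) (hK : 0 < K)
    (z : Fin n → Fin 2 → ℝ) (b : Fin 2 × Fin (K + p) → ℝ) :
    |∑ i, (feature p K (z i) ⬝ᵥ b) ^ 2 - n * ∫ z, (feature p K z ⬝ᵥ b) ^ 2 ∂ν| ≤
      √(deviation p K ν z) * (b ⬝ᵥ b) := by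
  set D : (Fin 2 × Fin (K + p)) × (Fin 2 × Fin (K + p)) → ℝ := fun ab =>
    ∑ i, feature p K (z i) ab.1 * feature p K (z i) ab.2 -
        n * ∫ z, feature p K z ab.1 * feature p K z ab.2 ∂ν with hD
  set E : (Fin 2 × Fin (K + p)) × (Fin 2 × Fin (K + p)) → ℝ := fun ab => b ab.1 * b ab.2 with hE
  have hsq : ∀ z : Fin 2 → ℝ, (feature p K z ⬝ᵥ b) ^ 2 =
      ∑ ab : (Fin 2 × Fin (K + p)) × (Fin 2 × Fin (K + p)),
        feature p K z ab.1 * feature p K z ab.2 * (b ab.1 * b ab.2) := fun z =>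
    sq_dotProduct_eq_sum _ _
  have h1 : ∑ i, (feature p K (z i) ⬝ᵥ b) ^ 2 - n * ∫ z, (feature p K z ⬝ᵥ b) ^ 2 ∂ν = D ⬝ᵥ E := by
    simp_rw [hsq]
    rw [integral_finsetSum _ fun ab _ => (L.integrable_feature_mul hK ab.1 ab.2).mul_const _,
      Finset.sum_comm, Finset.mul_sum, ← Finset.sum_sub_distrib, dotProduct]
    refine Finset.sum_congr rfl fun ab _ => ?_
    rw [integral_mul_const, hD, hE, ← Finset.sum_mul]
    ring
  have h2 := dotProduct_sq_le D E
  have h3 : D ⬝ᵥ D ≤ deviation p K ν z := by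
    have : D ⬝ᵥ D = ∑ ab, D ab ^ 2 := Finset.sum_congr rfl fun ab _ => (sq _).symm
    rw [this, deviation]
    exact le_add_of_nonneg_right (Finset.sum_nonneg fun a _ => sq_nonneg _)
  have h4 : E ⬝ᵥ E = (b ⬝ᵥ b) ^ 2 := (sq_dotProduct_eq_sum b b).symm
  have hb := dotProduct_self_nonneg' b
  have h5 : 0 ≤ deviation p K ν z := (dotProduct_self_nonneg' D).trans h3
  rw [h1]
  refine abs_le_of_sq_le_sq ?_ (by positivity)
  rw [mul_pow, Real.sq_sqrt h5]
  refine h2.trans ?_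
  rw [h4]
  gcongr

theorem SquareLaw.sq_sum_basis_sub_le (L : SquareLaw ν c C) (hK : 0 < K)
    (z : Fin n → Fin 2 → ℝ) (j : Fin 2) (b : Fin (K + p) → ℝ) :
    (∑ i, basis p K (z i j) ⬝ᵥ b - n * ∫ z, basis p K (z j) ⬝ᵥ b ∂ν) ^ 2 ≤
      deviation p K ν z * (b ⬝ᵥ b) := by
  set D : Fin (K + p) → ℝ := fun a =>
    ∑ i, feature p K (z i) (j, a) - n * ∫ z, feature p K z (j, a) ∂ν with hD
  have h1 : ∑ i, basis p K (z i j) ⬝ᵥ b - n * ∫ z, basis p K (z j) ⬝ᵥ b ∂ν = D ⬝ᵥ b := by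
    have e : ∀ z : Fin 2 → ℝ, basis p K (z j) ⬝ᵥ b = ∑ a, feature p K z (j, a) * b a := fun z => rfl
    simp_rw [e]
    rw [integral_finsetSum _ fun a _ => (L.integrable_feature hK (j, a)).mul_const _,
      Finset.sum_comm, Finset.mul_sum, ← Finset.sum_sub_distrib, dotProduct]
    refine Finset.sum_congr rfl fun ab _ => ?_
    rw [integral_mul_const, hD, ← Finset.sum_mul]
    ring
  rw [h1]
  refine (dotProduct_sq_le D b).trans ?_
  refine mul_le_mul_of_nonneg_right ?_ (dotProduct_self_nonneg' b)
  rw [deviation]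
  refine le_add_of_nonneg_of_le (Finset.sum_nonneg fun a _ => sq_nonneg _) ?_
  rw [Fintype.sum_prod_type]
  have h2 : D ⬝ᵥ D = ∑ a, (∑ i, feature p K (z i) (j, a) - n * ∫ z, feature p K z (j, a) ∂ν) ^ 2 :=
    Finset.sum_congr rfl fun a _ => (sq _).symm
  rw [h2]
  exact Finset.single_le_sum (f := fun j => ∑ a, (∑ i, feature p K (z i) (j, a) -
    n * ∫ z, feature p K z (j, a) ∂ν) ^ 2) (fun j _ => Finset.sum_nonneg fun a _ => sq_nonneg _)
    (Finset.mem_univ j)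

end Deviation

/-! ### Moments of sums over independent covariates -/

section Moments
variable {Ω : Type*} [MeasurableSpace Ω] {μ : Measure Ω} [IsProbabilityMeasure μ]
  {X : ℕ → Ω → Fin 2 → ℝ} {ν : Measure (Fin 2 → ℝ)} {c C : ℝ}
  (L : SquareLaw ν c C) (hX : ∀ i, Measurable (X i)) (hlaw : ∀ i, μ.map (X i) = ν)
include L hX hlaw

omit [IsProbabilityMeasure μ] L in
theorem integral_comp_law (i : ℕ) {g : (Fin 2 → ℝ) → ℝ} (hg : Measurable g) :
    ∫ ω, g (X i ω) ∂μ = ∫ z, g z ∂ν := by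
  rw [← hlaw i, integral_map (hX i).aemeasurable hg.aestronglyMeasurable]

omit [IsProbabilityMeasure μ] in
theorem integrable_comp_law (i : ℕ) {g : (Fin 2 → ℝ) → ℝ} (hg : Measurable g) {R : ℝ}
    (hR : ∀ z ∈ unitSquare, |g z| ≤ R) : Integrable (fun ω => g (X i ω)) μ := by
  have h := L.integrable hg hR
  rw [← hlaw i] at h
  exact (integrable_map_measure hg.aestronglyMeasurable (hX i).aemeasurable).mp h

omit [IsProbabilityMeasure μ] in
theorem ae_forall_mem : ∀ᵐ ω ∂μ, ∀ i, X i ω ∈ unitSquare := by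
  rw [ae_all_iff]
  intro i
  have h := L.ae_mem
  rw [← hlaw i] at h
  exact ae_of_ae_map (hX i).aemeasurable h

omit [IsProbabilityMeasure μ] in
theorem integral_sum_comp_law (n : ℕ) {g : (Fin 2 → ℝ) → ℝ} (hg : Measurable g) {R : ℝ}
    (hR : ∀ z ∈ unitSquare, |g z| ≤ R) :
    ∫ ω, ∑ i : Fin n, g (X i ω) ∂μ = n * ∫ z, g z ∂ν := by
  rw [integral_finsetSum (f := fun (i : Fin n) ω => g (X i ω)) _
    fun i _ => integrable_comp_law L hX hlaw i hg hR]
  simp [integral_comp_law hX hlaw _ hg]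

theorem memLp_comp_law {n : ℕ} {g : (Fin 2 → ℝ) → ℝ} (hg : Measurable g) {R : ℝ}
    (hR : ∀ z ∈ unitSquare, |g z| ≤ R) (i : Fin n) : MemLp (fun ω => g (X i ω)) 2 μ := by
  refine MemLp.of_bound (hg.comp (hX i)).aestronglyMeasurable R ?_
  filter_upwards [ae_forall_mem L hX hlaw] with ω h using hR _ (h i)

theorem memLp_sum_comp_law (n : ℕ) {g : (Fin 2 → ℝ) → ℝ} (hg : Measurable g) {R : ℝ}
    (hR : ∀ z ∈ unitSquare, |g z| ≤ R) : MemLp (fun ω => ∑ i : Fin n, g (X i ω)) 2 μ :=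
  memLp_finsetSum _ fun i _ => memLp_comp_law L hX hlaw hg hR i

theorem integrable_sum_comp_law (n : ℕ) {g : (Fin 2 → ℝ) → ℝ} (hg : Measurable g) {R : ℝ}
    (hR : ∀ z ∈ unitSquare, |g z| ≤ R) : Integrable (fun ω => ∑ i : Fin n, g (X i ω)) μ :=
  (memLp_sum_comp_law L hX hlaw n hg hR).integrable one_le_two

theorem integral_sum_sub_sq_le (hind : iIndepFun X μ) (n : ℕ) {g : (Fin 2 → ℝ) → ℝ}
    (hg : Measurable g) {R : ℝ} (hR : ∀ z ∈ unitSquare, |g z| ≤ R) :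
    Integrable (fun ω => (∑ i : Fin n, g (X i ω) - n * ∫ z, g z ∂ν) ^ 2) μ ∧
    ∫ ω, (∑ i : Fin n, g (X i ω) - n * ∫ z, g z ∂ν) ^ 2 ∂μ ≤ n * ∫ z, g z ^ 2 ∂ν := by
  have hmem := memLp_comp_law L hX hlaw (n := n) hg hR
  have hsum := memLp_sum_comp_law L hX hlaw n hg hR
  have hv := variance_eq_integral (μ := μ) (X := fun ω => ∑ i : Fin n, g (X i ω))
    hsum.aestronglyMeasurable.aemeasurable
  rw [integral_sum_comp_law L hX hlaw n hg hR] at hv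
  refine ⟨(hsum.sub (memLp_const _)).integrable_sq, ?_⟩
  rw [← hv]
  have e : (fun ω => ∑ i : Fin n, g (X i ω)) = ∑ i : Fin n, fun ω => g (X i ω) := by
    funext ω; simp
  rw [e, IndepFun.variance_sum (fun i _ => hmem i)]
  · calc ∑ i : Fin n, Var[fun ω => g (X i ω); μ] ≤ ∑ i : Fin n, ∫ z, g z ^ 2 ∂ν := by
          refine Finset.sum_le_sum fun i _ => ?_
          refine (variance_le_expectation_sq (hg.comp (hX i)).aestronglyMeasurable).trans (le_of_eq ?_)
          exact integral_comp_law hX hlaw i (hg.pow_const 2)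
      _ = _ := by simp
  · intro i _ j _ hij
    exact (hind.indepFun (i := (i : ℕ)) (j := (j : ℕ)) (fun h => hij (Fin.ext h))).comp hg hg

/-- For 0 ≤ g ≤ 1 one has g² ≤ g, so the variance of the sum is at most the bound nb on its mean;
the second moment is at most twice the variance plus twice the squared mean. -/
theorem integral_sum_sq_le (hind : iIndepFun X μ) (n : ℕ) {g : (Fin 2 → ℝ) → ℝ}
    (hg : Measurable g) (hg0 : ∀ z ∈ unitSquare, 0 ≤ g z) (hg1 : ∀ z ∈ unitSquare, g z ≤ 1)
    {b : ℝ} (hb : ∫ z, g z ∂ν ≤ b) :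
    ∫ ω, (∑ i : Fin n, g (X i ω)) ^ 2 ∂μ ≤ 2 * (n * b) + 2 * (n * b) ^ 2 := by
  have hR : ∀ z ∈ unitSquare, |g z| ≤ 1 := fun z hz => by rw [abs_of_nonneg (hg0 z hz)]; exact hg1 z hz
  have hi := integral_sum_sub_sq_le L hX hlaw hind n hg hR
  have hint := (memLp_sum_comp_law L hX hlaw n hg hR).integrable_sq
  have h0 : 0 ≤ ∫ z, g z ∂ν := integral_nonneg_of_ae (by filter_upwards [L.ae_mem] with z hz using hg0 z hz)
  have hg2 : ∫ z, g z ^ 2 ∂ν ≤ ∫ z, g z ∂ν := by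
    refine integral_mono_ae (L.integrable (hg.pow_const 2) (R := 1) fun z hz => ?_)
      (L.integrable hg hR) ?_
    · rw [abs_pow]; exact pow_le_one₀ (abs_nonneg _) (hR z hz)
    · filter_upwards [L.ae_mem] with z hz
      rw [sq]
      exact mul_le_of_le_one_left (hg0 z hz) (hg1 z hz)
  have hn : (0 : ℝ) ≤ n := Nat.cast_nonneg n
  set e := ∫ z, g z ∂ν with he
  calc ∫ ω, (∑ i : Fin n, g (X i ω)) ^ 2 ∂μ
      ≤ ∫ ω, (2 * (∑ i : Fin n, g (X i ω) - n * e) ^ 2 + 2 * (n * e) ^ 2) ∂μ := by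
        refine integral_mono hint ((hi.1.const_mul 2).add (integrable_const _)) fun ω => ?_
        simp only
        nlinarith [sq_nonneg (∑ i : Fin n, g (X i ω) - 2 * (n * e))]
    _ = 2 * ∫ ω, (∑ i : Fin n, g (X i ω) - n * e) ^ 2 ∂μ + 2 * (n * e) ^ 2 := by
        rw [integral_add (hi.1.const_mul 2) (integrable_const _), integral_const_mul]
        simp
    _ ≤ 2 * (n * b) + 2 * (n * b) ^ 2 := by
        have h5 := hi.2.trans (mul_le_mul_of_nonneg_left (hg2.trans hb) hn)
        have h6 : (n * e) ^ 2 ≤ (n * b) ^ 2 :=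
          pow_le_pow_left₀ (by positivity) (mul_le_mul_of_nonneg_left hb hn) 2
        linarith

/-- The variances add up to at most n times the expectation of |φ|⁴ + |φ|² for the feature vector φ.
By the partition of unity |φ|² ≤ 2, whence 4 + 2, with no growth in K. -/
theorem integral_deviation_le (hind : iIndepFun X μ) {K : ℕ} (hK : 0 < K) (p n : ℕ) :
    Integrable (fun ω => deviation p K ν fun i : Fin n => X i ω) μ ∧
    ∫ ω, deviation p K ν (fun i : Fin n => X i ω) ∂μ ≤ 6 * n := by
  have := L.isProb
  have h1 := fun ab : (Fin 2 × Fin (K + p)) × (Fin 2 × Fin (K + p)) =>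
    integral_sum_sub_sq_le L hX hlaw hind n (g := fun z => feature p K z ab.1 * feature p K z ab.2)
      ((measurable_feature_apply p K _).mul (measurable_feature_apply p K _)) (R := 1) fun z hz => by
        rw [abs_mul]
        exact mul_le_one₀ (abs_feature_le_one hK hz _) (abs_nonneg _) (abs_feature_le_one hK hz _)
  have h2 := fun a : Fin 2 × Fin (K + p) =>
    integral_sum_sub_sq_le L hX hlaw hind n (g := fun z => feature p K z a)
      (measurable_feature_apply p K _) (R := 1) fun z hz => abs_feature_le_one hK hz _
  have i1 := integrable_finsetSum Finset.univ fun ab _ => (h1 ab).1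
  have i2 := integrable_finsetSum Finset.univ fun a _ => (h2 a).1
  refine ⟨i1.add i2, ?_⟩
  unfold deviation
  rw [integral_add i1 i2, integral_finsetSum _ fun ab _ => (h1 ab).1,
    integral_finsetSum _ fun a _ => (h2 a).1]
  have j2 : ∀ a, Integrable (fun z => feature p K z a ^ 2) ν := fun a => by
    simpa [sq] using L.integrable_feature_mul (p := p) hK a a
  have j1 : ∀ ab : (Fin 2 × Fin (K + p)) × (Fin 2 × Fin (K + p)),
      Integrable (fun z => (feature p K z ab.1 * feature p K z ab.2) ^ 2) ν := fun ab =>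
    L.integrable (R := 1) (((measurable_feature_apply p K _).mul
      (measurable_feature_apply p K _)).pow_const 2) fun z hz => by
        rw [abs_pow, abs_mul]
        exact pow_le_one₀ (by positivity)
          (mul_le_one₀ (abs_feature_le_one hK hz _) (abs_nonneg _) (abs_feature_le_one hK hz _))
  have k2 : ∑ a, ∫ z, feature p K z a ^ 2 ∂ν ≤ 2 := by
    rw [← integral_finsetSum _ fun a _ => j2 a]
    calc _ ≤ ∫ z, (2 : ℝ) ∂ν := by
          refine integral_mono_ae (integrable_finsetSum _ fun a _ => j2 a) (integrable_const _) ?_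
          filter_upwards [L.ae_mem] with z hz
          simpa [dotProduct, sq] using feature_dotProduct_self_le (p := p) hK hz
      _ = 2 := by simp
  have k1 : ∑ ab : (Fin 2 × Fin (K + p)) × (Fin 2 × Fin (K + p)),
      ∫ z, (feature p K z ab.1 * feature p K z ab.2) ^ 2 ∂ν ≤ 4 := by
    rw [← integral_finsetSum _ fun a _ => j1 a]
    calc _ ≤ ∫ z, (4 : ℝ) ∂ν := by
          refine integral_mono_ae (integrable_finsetSum _ fun a _ => j1 a) (integrable_const _) ?_
          filter_upwards [L.ae_mem] with z hz
          have h := feature_dotProduct_self_le (p := p) hK hz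
          have h0 := dotProduct_self_nonneg' (feature p K z)
          have e : ∑ ab : (Fin 2 × Fin (K + p)) × (Fin 2 × Fin (K + p)),
              (feature p K z ab.1 * feature p K z ab.2) ^ 2 =
              (feature p K z ⬝ᵥ feature p K z) ^ 2 := by
            rw [sq_dotProduct_eq_sum]
            exact Finset.sum_congr rfl fun a _ => sq _
          rw [e]
          nlinarith
      _ = 4 := by simp
  have s1 := Finset.sum_le_sum fun ab (_ : ab ∈ Finset.univ) => (h1 ab).2
  have s2 := Finset.sum_le_sum fun a (_ : a ∈ Finset.univ) => (h2 a).2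
  rw [← Finset.mul_sum] at s1 s2
  have hn : (0 : ℝ) ≤ n := Nat.cast_nonneg n
  nlinarith [mul_le_mul_of_nonneg_left k1 hn, mul_le_mul_of_nonneg_left k2 hn]

end Moments

/-! ### Difference penalties -/

section Penalty

/-- Writing an entry as a sum over shifts r removes the truncated subtraction, and allows row and
column sums to be interchanged with the sum over r. -/
theorem diffOp_apply_eq_sum (m N : ℕ) (i : Fin (N - m)) (k : Fin N) :
    diffOp m N i k = ∑ r ∈ Finset.range (m + 1),
      if (i : ℕ) + r = k then (-1 : ℝ) ^ (m + r) * (m.choose r : ℝ) else 0 := by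
  simp only [diffOp, Matrix.of_apply]
  split_ifs with h
  · by_cases hr : (k : ℕ) - i ≤ m
    · rw [Finset.sum_eq_single ((k : ℕ) - i)]
      · rw [if_pos (by omega)]
      · intro r _ hr'
        rw [if_neg (by omega)]
      · intro h'
        exact absurd (Finset.mem_range.mpr (by omega)) h'
    · rw [Nat.choose_eq_zero_of_lt (by omega), Finset.sum_eq_zero]
      · simp
      · intro r hr'
        rw [if_neg]
        have := Finset.mem_range.mp hr'
        omega
  · rw [Finset.sum_eq_zero]
    intro r _
    rw [if_neg (by omega)]

theorem diffOp_eq_zero {m N : ℕ} {i : Fin (N - m)} {k : Fin N}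
    (h : (k : ℕ) < i ∨ (i : ℕ) + m < k) : diffOp m N i k = 0 := by
  rw [diffOp_apply_eq_sum]
  refine Finset.sum_eq_zero fun r hr => if_neg ?_
  have := Finset.mem_range.mp hr
  omega

theorem sum_ite_le_of_subsingleton {ι : Type*} [Fintype ι] (P : ι → Prop) [DecidablePred P]
    (hP : ∀ i j, P i → P j → i = j) {a : ℝ} (ha : 0 ≤ a) : ∑ i, (if P i then a else 0) ≤ a := by
  rw [← Finset.sum_filter, Finset.sum_const]
  have : (Finset.univ.filter P).card ≤ 1 := Finset.card_le_one.mpr fun i hi j hj =>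
    hP i j (Finset.mem_filter.mp hi).2 (Finset.mem_filter.mp hj).2
  calc (Finset.univ.filter P).card • a ≤ 1 • a := nsmul_le_nsmul_left ha this
    _ = a := one_nsmul a

theorem abs_diffOp_le (m N : ℕ) (i : Fin (N - m)) (k : Fin N) :
    |diffOp m N i k| ≤ ∑ r ∈ Finset.range (m + 1),
      if (i : ℕ) + r = k then (m.choose r : ℝ) else 0 := by
  rw [diffOp_apply_eq_sum]
  refine (Finset.abs_sum_le_sum_abs _ _).trans (Finset.sum_le_sum fun r _ => ?_)
  split_ifs <;> simp [abs_mul]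

theorem sum_abs_diffOp_row_le (m N : ℕ) (i : Fin (N - m)) : ∑ k, |diffOp m N i k| ≤ 2 ^ m := by
  refine (Finset.sum_le_sum fun k _ => abs_diffOp_le m N i k).trans ?_
  rw [Finset.sum_comm]
  refine (Finset.sum_le_sum fun r _ => sum_ite_le_of_subsingleton _ ?_ (Nat.cast_nonneg _)).trans ?_
  · intro k l hk hl
    exact Fin.ext (by omega)
  · exact_mod_cast (Nat.sum_range_choose m).le

theorem sum_abs_diffOp_col_le (m N : ℕ) (k : Fin N) : ∑ i, |diffOp m N i k| ≤ 2 ^ m := by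
  refine (Finset.sum_le_sum fun i _ => abs_diffOp_le m N i k).trans ?_
  rw [Finset.sum_comm]
  refine (Finset.sum_le_sum fun r _ => sum_ite_le_of_subsingleton _ ?_ (Nat.cast_nonneg _)).trans ?_
  · intro k l hk hl
    exact Fin.ext (by omega)
  · exact_mod_cast (Nat.sum_range_choose m).le

/-- Each row sum is an alternating sum of binomial coefficients, which vanishes for m ≥ 1. -/
theorem diffOp_mulVec_one {m : ℕ} (hm : 1 ≤ m) (N : ℕ) : diffOp m N *ᵥ 1 = 0 := by
  funext i
  simp only [Matrix.mulVec, dotProduct, Pi.one_apply, mul_one, Pi.zero_apply]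
  simp_rw [diffOp_apply_eq_sum]
  rw [Finset.sum_comm]
  have h1 : ∀ r ∈ Finset.range (m + 1), ∑ k : Fin N, (if (i : ℕ) + r = k then
      (-1 : ℝ) ^ (m + r) * (m.choose r : ℝ) else 0) = (-1) ^ m * ((-1) ^ r * (m.choose r : ℝ)) := by
    intro r hr
    have hr' := Finset.mem_range.mp hr
    rw [Finset.sum_eq_single (⟨(i : ℕ) + r, by omega⟩ : Fin N)]
    · simp [pow_add, mul_assoc]
    · intro k _ hk
      exact if_neg fun h => hk (Fin.ext h.symm)
    · intro h
      exact absurd (Finset.mem_univ _) h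
  rw [Finset.sum_congr rfl h1, ← Finset.mul_sum]
  have h2 := Int.alternating_sum_range_choose_of_ne (n := m) (by omega)
  have h3 : ∑ r ∈ Finset.range (m + 1), (-1 : ℝ) ^ r * (m.choose r : ℝ) = 0 := by exact_mod_cast h2
  rw [h3, mul_zero]

theorem penalty_transpose (m N : ℕ) : (penalty m N)ᵀ = penalty m N := by
  rw [penalty, Matrix.transpose_mul, Matrix.transpose_transpose]

theorem penalty_form_nonneg (m N : ℕ) (x : Fin N → ℝ) : 0 ≤ x ⬝ᵥ penalty m N *ᵥ x := by
  rw [penalty, dotProduct_gram]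
  exact dotProduct_self_nonneg' _

theorem penalty_mulVec_one {m : ℕ} (hm : 1 ≤ m) (N : ℕ) : penalty m N *ᵥ 1 = 0 := by
  rw [penalty, ← Matrix.mulVec_mulVec, diffOp_mulVec_one hm, Matrix.mulVec_zero]

theorem penalty_eq_zero {m N : ℕ} {k l : Fin N} (h : m < Nat.dist k l) : penalty m N k l = 0 := by
  rw [penalty, Matrix.mul_apply]
  refine Finset.sum_eq_zero fun i _ => ?_
  rw [Matrix.transpose_apply]
  by_cases hk : (k : ℕ) < i ∨ (i : ℕ) + m < k
  · rw [diffOp_eq_zero hk, zero_mul]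
  · rw [diffOp_eq_zero (k := l), mul_zero]
    unfold Nat.dist at h
    omega

/-- Schur's test: the absolute row sums and column sums of the difference operator are both at most
2^m. -/
theorem penalty_form_le (m N : ℕ) (x : Fin N → ℝ) : x ⬝ᵥ penalty m N *ᵥ x ≤ 4 ^ m * (x ⬝ᵥ x) := by
  rw [penalty, dotProduct_gram]
  have h1 : ∀ i, (diffOp m N *ᵥ x) i * (diffOp m N *ᵥ x) i ≤
      2 ^ m * ∑ k, |diffOp m N i k| * x k ^ 2 := by
    intro i
    have h := Finset.sum_sq_le_sum_mul_sum_of_sq_le_mul Finset.univ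
      (r := fun k => diffOp m N i k * x k) (f := fun k => |diffOp m N i k|)
      (g := fun k => |diffOp m N i k| * x k ^ 2) (fun k _ => abs_nonneg _)
      (fun k _ => by positivity) fun k _ => by
        rw [mul_pow, ← mul_assoc, abs_mul_abs_self, sq]
    rw [← sq]
    refine h.trans ?_
    exact mul_le_mul_of_nonneg_right (sum_abs_diffOp_row_le m N i)
      (Finset.sum_nonneg fun k _ => by positivity)
  calc _ ≤ ∑ i, 2 ^ m * ∑ k, |diffOp m N i k| * x k ^ 2 := Finset.sum_le_sum fun i _ => h1 i
    _ = 2 ^ m * ∑ k, (∑ i, |diffOp m N i k|) * x k ^ 2 := by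
      rw [← Finset.mul_sum, Finset.sum_comm]
      simp_rw [Finset.sum_mul]
    _ ≤ 2 ^ m * ∑ k, 2 ^ m * x k ^ 2 := by
      gcongr with k
      exact sum_abs_diffOp_col_le m N k
    _ = _ := by
      rw [← Finset.mul_sum, ← mul_assoc, ← mul_pow, dotProduct]
      norm_num [sq]

theorem abs_penalty_mulVec_le (m N : ℕ) {s : Fin N → ℝ} {S : ℝ} (hS : ∀ k, |s k| ≤ S) (k : Fin N) :
    |(penalty m N *ᵥ s) k| ≤ 4 ^ m * S := by
  have hS0 : 0 ≤ S := (abs_nonneg _).trans (hS k)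
  have h1 : ∀ i, |(diffOp m N *ᵥ s) i| ≤ 2 ^ m * S := fun i =>
    calc _ ≤ ∑ k, |diffOp m N i k| * S :=
          (Finset.abs_sum_le_sum_abs _ _).trans (Finset.sum_le_sum fun k _ => by
            rw [abs_mul]; exact mul_le_mul_of_nonneg_left (hS k) (abs_nonneg _))
      _ ≤ _ := by
        rw [← Finset.sum_mul]
        exact mul_le_mul_of_nonneg_right (sum_abs_diffOp_row_le m N i) hS0
  rw [penalty, ← Matrix.mulVec_mulVec]
  calc _ ≤ ∑ i, |diffOp m N i k| * (2 ^ m * S) :=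
          (Finset.abs_sum_le_sum_abs _ _).trans (Finset.sum_le_sum fun i _ => by
            rw [abs_mul]; exact mul_le_mul_of_nonneg_left (h1 i) (abs_nonneg _))
      _ ≤ 2 ^ m * (2 ^ m * S) := by
        rw [← Finset.sum_mul]
        exact mul_le_mul_of_nonneg_right (sum_abs_diffOp_col_le m N k) (by positivity)
      _ = _ := by rw [← mul_assoc, ← mul_pow]; norm_num

end Penalty

/-! ### Design matrices and well-conditioned samples -/

section Design
variable {p K n : ℕ} (hK : 0 < K) {z : Fin n → Fin 2 → ℝ}

theorem designMatrix_mulVec (z : Fin n → Fin 2 → ℝ) (j : Fin 2) (b : Fin (K + p) → ℝ)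
    (i : Fin n) : (designMatrix p K z j *ᵥ b) i = basis p K (z i j) ⬝ᵥ b := rfl

theorem sumVec_designMatrix_dotProduct (z : Fin n → Fin 2 → ℝ) (b : Fin 2 × Fin (K + p) → ℝ) :
    sumVec (designMatrix p K z) ⬝ᵥ b = ∑ i, basis p K (z i 1) ⬝ᵥ part 1 b := by
  rw [sumVec, emb_dotProduct, transpose_mulVec_dotProduct]
  simp [dotProduct, designMatrix_mulVec]

include hK

theorem basis_mul_basis_eq_zero {x : ℝ} {k l : Fin (K + p)} (h : p < Nat.dist k l) :
    basis p K x k * basis p K x l = 0 := by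
  by_contra hne
  have hk := left_ne_zero_of_mul hne
  have hl := right_ne_zero_of_mul hne
  have hk' := mt (basis_eq_zero hK) hk
  have hl' := mt (basis_eq_zero hK) hl
  rw [not_or, not_le, not_lt] at hk' hl'
  have hK' : (0 : ℝ) < K := by exact_mod_cast hK
  have h1 := hk'.1.trans_le hl'.2
  have h2 := hl'.1.trans_le hk'.2
  rw [div_lt_div_iff_of_pos_right hK'] at h1 h2
  have h3 : (k : ℕ) < (l : ℕ) + 1 + p := by
    have : ((k : ℕ) : ℝ) < (l : ℕ) + 1 + p := by linarith
    exact_mod_cast this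
  have h4 : (l : ℕ) < (k : ℕ) + 1 + p := by
    have : ((l : ℕ) : ℝ) < (k : ℕ) + 1 + p := by linarith
    exact_mod_cast this
  unfold Nat.dist at h
  omega

theorem gram_designMatrix_eq_zero (z : Fin n → Fin 2 → ℝ) (j : Fin 2) {k l : Fin (K + p)}
    (h : p < Nat.dist k l) : ((designMatrix p K z j)ᵀ * designMatrix p K z j) k l = 0 := by
  rw [Matrix.mul_apply]
  exact Finset.sum_eq_zero fun i _ => basis_mul_basis_eq_zero hK h

theorem lam_designMatrix_eq_zero (z : Fin n → Fin 2 → ℝ) (m : ℕ) (t : Fin 2 → ℝ) (j : Fin 2)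
    {k l : Fin (K + p)} (h : max 1 (max p m) < Nat.dist k l) :
    ((designMatrix p K z j)ᵀ * designMatrix p K z j + t j • penalty m (K + p)) k l = 0 := by
  have h1 : p < Nat.dist k l := by omega
  have h2 : m < Nat.dist k l := by omega
  rw [Matrix.add_apply, gram_designMatrix_eq_zero hK z j h1, Matrix.smul_apply, penalty_eq_zero h2,
    smul_zero, add_zero]

end Design

/-- On samples with small deviation the penalized normal equations are well conditioned. -/
theorem SquareLaw.exists_wellConditioned {ν : Measure (Fin 2 → ℝ)} {c C : ℝ}
    (L : SquareLaw ν c C) (p : ℕ) {m : ℕ} (hm : 1 ≤ m) : ∃ κ > 0, ∃ c₁ C₁ : ℝ,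
    ∀ n K : ℕ, 0 < n → 0 < K → ∀ t : Fin 2 → ℝ, (∀ j, 0 ≤ t j) → (∀ j, t j ≤ (n : ℝ) / K) →
    ∀ z : Fin n → Fin 2 → ℝ, (∀ i, z i ∈ unitSquare) →
    deviation p K ν z ≤ (κ * ((n : ℝ) / K)) ^ 2 →
    WellConditioned (designMatrix p K z) (fun j => t j • penalty m (K + p)) ((n : ℝ) / K) c₁ C₁ := by
  obtain ⟨c', hc', hlow⟩ := L.exists_feature_form_lower p
  have hCp := L.C_pos
  -- The deviation enters twice, in the Gram form and in the mean term, and halving the squared mean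
  -- reduces c' to c'/2. With κ ≤ c'/8 the constant c'/4 remains; κ ≤ 1 is used to compare κn/K with
  -- n.
  set κ := min 1 (c' / 8) with hκ
  have hκ0 : 0 < κ := lt_min one_pos (by positivity)
  have hκ1 : κ ≤ 1 := min_le_left _ _
  have hκ2 : κ ≤ c' / 8 := min_le_right _ _
  refine ⟨κ, hκ0, c' / 4, max (c' / 4) (C * (p + 1) + κ + 4 ^ m),
    fun n K hn hK t ht0 ht z hz hdev => ?_⟩
  have hn' : (0 : ℝ) < n := by exact_mod_cast hn
  have hK' : (0 : ℝ) < K := by exact_mod_cast hK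
  have hK1 : (1 : ℝ) ≤ K := by exact_mod_cast hK
  have hh : 0 < (n : ℝ) / K := by positivity
  have hsq : √(deviation p K ν z) ≤ κ * ((n : ℝ) / K) := Real.sqrt_le_iff.mpr ⟨by positivity, hdev⟩
  refine ⟨hn, hh, by positivity, le_max_left _ _, fun j i => ?_, fun j i k => ?_, fun j => ?_,
    fun j x => ?_, fun j => ?_, fun b => ?_, fun j x => ?_⟩
  · exact sum_basis hK (apply_mem_Ioc (hz i) j)
  · exact basis_nonneg hK _ _
  · rw [Matrix.transpose_smul, penalty_transpose]
  · rw [Matrix.smul_mulVec, dotProduct_smul]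
    exact mul_nonneg (ht0 j) (penalty_form_nonneg _ _ _)
  · rw [Matrix.smul_mulVec, penalty_mulVec_one hm, smul_zero]
  · have hb := dotProduct_self_nonneg' b
    have h1 := L.abs_sum_feature_sq_sub_le hK z b
    have h2 := L.sq_sum_basis_sub_le hK z 1 (part 1 b)
    have h3 := hlow K hK b
    rw [sumVec_designMatrix_dotProduct]
    have e : (jointDesign (designMatrix p K z) *ᵥ b) ⬝ᵥ (jointDesign (designMatrix p K z) *ᵥ b) =
        ∑ i, (feature p K (z i) ⬝ᵥ b) ^ 2 := Finset.sum_congr rfl fun i _ => (sq _).symm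
    rw [e]
    set U := ∑ i, (feature p K (z i) ⬝ᵥ b) ^ 2
    set T := ∑ i, basis p K (z i 1) ⬝ᵥ part 1 b
    set E1 := ∫ z, (feature p K z ⬝ᵥ b) ^ 2 ∂ν
    set E2 := ∫ z, basis p K (z 1) ⬝ᵥ part 1 b ∂ν
    have h4 : (T - n * E2) ^ 2 ≤ (κ * ((n : ℝ) / K)) ^ 2 * (b ⬝ᵥ b) :=
      h2.trans (mul_le_mul hdev (part_dotProduct_part_le 1 b) (dotProduct_self_nonneg' _)
        (by positivity))
    have h5 : -(κ * ((n : ℝ) / K) * (b ⬝ᵥ b)) ≤ U - n * E1 :=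
      neg_le_of_neg_le (by linarith [neg_abs_le (U - n * E1), mul_le_mul_of_nonneg_right hsq hb])
    -- From T² ≥ (nE2)²/2 - (T - nE2)², divided by n.
    have h6 : (n : ℝ) * E2 ^ 2 / 2 - κ * ((n : ℝ) / K) * (b ⬝ᵥ b) ≤ (n : ℝ)⁻¹ * T ^ 2 := by
      rw [inv_mul_eq_div, le_div_iff₀ hn']
      have h7 : (κ * ((n : ℝ) / K)) ^ 2 * (b ⬝ᵥ b) ≤ κ * ((n : ℝ) / K) * (b ⬝ᵥ b) * n := by
        have : κ * ((n : ℝ) / K) ≤ n := by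
          calc κ * ((n : ℝ) / K) ≤ 1 * (n / 1) := by gcongr
            _ = n := by ring
        calc _ = κ * ((n : ℝ) / K) * (b ⬝ᵥ b) * (κ * ((n : ℝ) / K)) := by ring
          _ ≤ _ := mul_le_mul_of_nonneg_left this (by positivity)
      nlinarith [sq_nonneg (T - n * E2), sq_nonneg (2 * T - n * E2)]
    have h8 : c' * ((n : ℝ) / K) * (b ⬝ᵥ b) ≤ n * E1 + n * E2 ^ 2 := by
      have := mul_le_mul_of_nonneg_left h3 hn'.le
      calc _ = n * (c' / K * (b ⬝ᵥ b)) := by ring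
        _ ≤ _ := this
        _ = _ := by ring
    have hE1 : 0 ≤ n * E1 := mul_nonneg hn'.le (integral_nonneg fun z => sq_nonneg _)
    have h9 : κ * ((n : ℝ) / K) * (b ⬝ᵥ b) ≤ c' / 8 * ((n : ℝ) / K) * (b ⬝ᵥ b) := by gcongr
    nlinarith
  · have hx := dotProduct_self_nonneg' x
    rw [Matrix.add_mulVec, dotProduct_add, dotProduct_gram, Matrix.smul_mulVec, dotProduct_smul,
      smul_eq_mul]
    have h1 := L.abs_sum_feature_sq_sub_le hK z (emb j x)
    have ee : emb j x ⬝ᵥ emb j x = x ⬝ᵥ x := by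
      rw [emb_dotProduct]; congr 1; funext k; simp [part, emb]
    have ef : ∀ z : Fin 2 → ℝ, feature p K z ⬝ᵥ emb j x = basis p K (z j) ⬝ᵥ x := fun z => by
      rw [dotProduct_comm, emb_dotProduct, dotProduct_comm]; rfl
    simp_rw [ef] at h1
    rw [ee] at h1
    have e : (designMatrix p K z j *ᵥ x) ⬝ᵥ (designMatrix p K z j *ᵥ x) =
        ∑ i, (basis p K (z i j) ⬝ᵥ x) ^ 2 := Finset.sum_congr rfl fun i _ => (sq _).symm
    rw [e]
    have h2 := L.integral_basis_dotProduct_sq_le hK j x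
    have h3 := mul_le_mul (ht j) (penalty_form_le m (K + p) x) (penalty_form_nonneg _ _ _) hh.le
    have h4 := mul_le_mul_of_nonneg_right hsq hx
    have h5 := (le_abs_self _).trans (h1.trans h4)
    have h6 := mul_le_mul_of_nonneg_left h2 hn'.le
    have h7 : n * (C * ((p + 1) / K) * (x ⬝ᵥ x)) = C * (p + 1) * ((n : ℝ) / K) * (x ⬝ᵥ x) := by ring
    have h8 : (C * (p + 1) + κ + 4 ^ m) * ((n : ℝ) / K) * (x ⬝ᵥ x) ≤
        max (c' / 4) (C * (p + 1) + κ + 4 ^ m) * ((n : ℝ) / K) * (x ⬝ᵥ x) := by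
      gcongr
      exact le_max_right _ _
    refine le_trans ?_ h8
    rw [h7] at h6
    calc _ ≤ C * (p + 1) * ((n : ℝ) / K) * (x ⬝ᵥ x) + κ * ((n : ℝ) / K) * (x ⬝ᵥ x) +
          (n : ℝ) / K * (4 ^ m * (x ⬝ᵥ x)) := by linarith
      _ = _ := by ring

/-- A bound for the total mass of a profile of exponential decay. -/
noncomputable def decayMass (c C : ℝ) (w : ℕ) : ℝ := 2 * (w / (1 - (1 - c / (2 * C))))

/-! ### Rescaled bounds with h = n / K -/

namespace WellConditioned
variable {n N K w : ℕ} {A : Fin 2 → Matrix (Fin n) (Fin N) ℝ} {P : Fin 2 → Matrix (Fin N) (Fin N) ℝ}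
  {c C : ℝ} (W : WellConditioned A P ((n : ℝ) / K) c C)
include W

theorem card_pos : (0 : ℝ) < K := by
  have h := W.h_pos
  rcases (Nat.cast_nonneg K : (0 : ℝ) ≤ K).lt_or_eq with h1 | h1
  · exact h1
  · rw [← h1, div_zero] at h; exact absurd h (lt_irrefl _)

theorem C_pos : 0 < C := W.c_pos.trans_le W.c_le

theorem sum_decay_le (hw : 0 < w) {B : Fin N → ℝ} (hB : ∀ k, 0 ≤ B k) (hB1 : ∑ k, B k = 1) :
    ∑ k, decayWeight (1 - c / (2 * C)) w B k ≤ decayMass c C w :=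
  sum_decayWeight_le W.decay_rate_nonneg W.decay_rate_lt_one hw hB hB1

theorem decayMass_nonneg : 0 ≤ decayMass c C w := by
  have := W.decay_rate_lt_one
  exact mul_nonneg (by norm_num) (div_nonneg (Nat.cast_nonneg w) (by linarith))

/-- Order count: the squared cross Gram entries contribute n²/K³ and `blockWeight` contributes h⁻²,
leaving 1/K. -/
theorem crossWeight_le (hw : 0 < w)
    (hband : ∀ j, ∀ k l : Fin N, w < Nat.dist k l → ((A j)ᵀ * A j + P j) k l = 0) (j j' : Fin 2)
    {B : Fin N → ℝ} (hB : ∀ k, 0 ≤ B k) (hB1 : ∑ k, B k = 1) {τ : ℝ}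
    (hZ : ∑ k, decayWeight (1 - c / (2 * C)) w B k * ∑ l, (((A j)ᵀ * A j') k l) ^ 2 ≤
      τ * ((n : ℝ) ^ 2 / (K : ℝ) ^ 3)) :
    crossWeight A P j j' B ⬝ᵥ crossWeight A P j j' B ≤ 4 * decayMass c C w * τ / c ^ 2 / K := by
  have hn := W.n_pos'
  have hK := W.card_pos
  have hc := W.c_pos
  refine (W.crossWeight_dotProduct_self_le hw hband j j' hB).trans ?_
  have h0 : 0 ≤ ∑ k, decayWeight (1 - c / (2 * C)) w B k * ∑ l, (((A j)ᵀ * A j') k l) ^ 2 :=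
    Finset.sum_nonneg fun k _ => mul_nonneg (decayWeight_nonneg W.decay_rate_nonneg w hB k)
      (Finset.sum_nonneg fun l _ => sq_nonneg _)
  have hM := W.decayMass_nonneg (w := w)
  calc _ ≤ (2 / (c * ((n : ℝ) / K))) ^ 2 * decayMass c C w * (τ * ((n : ℝ) ^ 2 / (K : ℝ) ^ 3)) :=
        mul_le_mul (mul_le_mul_of_nonneg_left (W.sum_decay_le hw hB hB1) (by positivity)) hZ h0
          (by positivity)
    _ = _ := by field_simp; ring

theorem sqrt_mul_abs_weight_le (j : Fin 2) {B : Fin N → ℝ} (hB : B ⬝ᵥ B ≤ 1) (i : Fin n) :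
    √((n : ℝ) / K) * |weight A P j B i| ≤ 2 / c * (√((n : ℝ) / K))⁻¹ := by
  have h := W.abs_weight_le j hB i
  have hs : 0 < √((n : ℝ) / K) := Real.sqrt_pos.mpr W.h_pos
  have hc := W.c_pos
  calc _ ≤ √((n : ℝ) / K) * (2 / (c * ((n : ℝ) / K))) := mul_le_mul_of_nonneg_left h hs.le
    _ = √((n : ℝ) / K) * (2 / (c * (√((n : ℝ) / K) * √((n : ℝ) / K)))) := by
      rw [Real.mul_self_sqrt W.h_pos.le]
    _ = _ := by field_simp

theorem mul_variance_le (j : Fin 2) {B : Fin N → ℝ} (hB : B ⬝ᵥ B ≤ 1) {σ : Fin n → ℝ} {S : ℝ}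
    (hS0 : 0 ≤ S) (hS : ∀ i, σ i ≤ S) :
    (n : ℝ) / K * ∑ i, σ i * weight A P j B i ^ 2 ≤ S / c := by
  have h := W.weight_dotProduct_self_le j B
  have hh := W.h_pos
  have hc := W.c_pos
  have h1 : ∑ i, σ i * weight A P j B i ^ 2 ≤ S * (weight A P j B ⬝ᵥ weight A P j B) := by
    rw [dotProduct, Finset.mul_sum]
    refine Finset.sum_le_sum fun i _ => ?_
    rw [← sq]
    exact mul_le_mul_of_nonneg_right (hS i) (sq_nonneg _)
  calc _ ≤ (n : ℝ) / K * (S * (1 / (c * ((n : ℝ) / K)))) := by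
        refine mul_le_mul_of_nonneg_left (h1.trans (mul_le_mul_of_nonneg_left (h.trans ?_) hS0)) hh.le
        gcongr
    _ = _ := by
      generalize (n : ℝ) / K = h at hh
      field_simp

theorem le_mul_variance {j j' : Fin 2} (hjj : j ≠ j') {B : Fin N → ℝ} {β D : ℝ}
    (hB : β ≤ B ⬝ᵥ B) (hD : crossWeight A P j j' B ⬝ᵥ crossWeight A P j j' B ≤ D)
    {σ : Fin n → ℝ} {S : ℝ} (hS0 : 0 ≤ S) (hS : ∀ i, S ≤ σ i) :
    S * (c * β / (4 * C ^ 2) - D / c) ≤ (n : ℝ) / K * ∑ i, σ i * weight A P j B i ^ 2 := by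
  have h := W.weight_dotProduct_self_ge hjj B
  have hh := W.h_pos
  have hc := W.c_pos
  have hC := W.C_pos
  have h1 : S * (weight A P j B ⬝ᵥ weight A P j B) ≤ ∑ i, σ i * weight A P j B i ^ 2 := by
    rw [dotProduct, Finset.mul_sum]
    refine Finset.sum_le_sum fun i _ => ?_
    rw [← sq]
    exact mul_le_mul_of_nonneg_right (hS i) (sq_nonneg _)
  calc _ = (n : ℝ) / K * (S * (c / 4 * ((n : ℝ) / K) * (β / (C * ((n : ℝ) / K)) ^ 2) -
          D / (c * ((n : ℝ) / K)))) := by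
        generalize (n : ℝ) / K = h at hh
        field_simp
    _ ≤ (n : ℝ) / K * (S * (weight A P j B ⬝ᵥ weight A P j B)) := by
        refine mul_le_mul_of_nonneg_left (mul_le_mul_of_nonneg_left (le_trans ?_ h) hS0) hh.le
        gcongr
    _ ≤ _ := mul_le_mul_of_nonneg_left h1 hh.le

/-- The overlap contributes h · h⁻² · n/K² = 1/K, and the cross remainders contribute √D + D with D
of order 1/K in the application; so h times the covariance vanishes. -/
theorem mul_abs_cov_le (hw : 0 < w)
    (hband : ∀ j, ∀ k l : Fin N, w < Nat.dist k l → ((A j)ᵀ * A j + P j) k l = 0)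
    {B : Fin 2 → Fin N → ℝ} (hB : ∀ j k, 0 ≤ B j k) (hB1 : ∀ j, B j ⬝ᵥ B j ≤ 1)
    {σ : Fin n → ℝ} {S : ℝ} (hS0 : 0 ≤ S) (hσ : ∀ i, 0 ≤ σ i ∧ σ i ≤ S) {D τ : ℝ}
    (hD : ∀ j j', j ≠ j' → crossWeight A P j j' (B j) ⬝ᵥ crossWeight A P j j' (B j) ≤ D)
    (hZ : ∑ k, ∑ l, decayWeight (1 - c / (2 * C)) w (B 0) k *
        decayWeight (1 - c / (2 * C)) w (B 1) l * ((A 0)ᵀ * A 1) k l ≤ τ * ((n : ℝ) / (K : ℝ) ^ 2)) :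
    (n : ℝ) / K * |∑ i, σ i * weight A P 0 (B 0) i * weight A P 1 (B 1) i| ≤
      S * (4 * τ / c ^ 2 / K + (4 * √D + D) / c) := by
  have h := W.abs_cov_le hw hband hB hB1 hσ hD
  have hh := W.h_pos
  have hc := W.c_pos
  have hK := W.card_pos
  have hn := W.n_pos'
  calc _ ≤ (n : ℝ) / K * (S * ((2 / (c * ((n : ℝ) / K))) ^ 2 * (τ * ((n : ℝ) / (K : ℝ) ^ 2)) +
        (4 * √D + D) / (c * ((n : ℝ) / K)))) := by
        refine mul_le_mul_of_nonneg_left (h.trans (mul_le_mul_of_nonneg_left ?_ hS0)) hh.le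
        exact add_le_add (mul_le_mul_of_nonneg_left hZ (by positivity)) le_rfl
    _ = _ := by
      generalize 4 * √D + D = d
      field_simp
      ring

/-- After multiplication by √h the approximation error contributes √h/K = √(n/K³), while the penalty
contributes the ratio η of the smoothing parameter to √h. The cross part has the same orders. -/
theorem sqrt_mul_abs_bias_le (hw : 0 < w)
    (hband : ∀ j, ∀ k l : Fin N, w < Nat.dist k l → ((A j)ᵀ * A j + P j) k l = 0)
    {j j' : Fin 2} (hjj : j ≠ j') {B : Fin N → ℝ} (hB : ∀ k, 0 ≤ B k) (hB1 : ∑ k, B k = 1)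
    {r : Fin n → ℝ} {ρ : ℝ} (hρ0 : 0 ≤ ρ) (hr : ∀ i, |r i| ≤ ρ / K) {s : Fin 2 × Fin N → ℝ}
    {π η : ℝ} (hπ0 : 0 ≤ π) (hη0 : 0 ≤ η)
    (hs : ∀ j k, |(P j *ᵥ part j s) k| ≤ π * (η * √((n : ℝ) / K))) {κ τ a : ℝ} (hκ : 0 ≤ κ)
    (ha : 0 ≤ a) (hN : (N : ℝ) ≤ a * K)
    (hD : crossWeight A P j j' B ⬝ᵥ crossWeight A P j j' B ≤ κ / K)
    (hZ : ∑ k, decayWeight (1 - c / (2 * C)) w B k * ((A j)ᵀ *ᵥ 1) k ≤ τ * ((n : ℝ) / K)) :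
    √((n : ℝ) / K) *
      |B ⬝ᵥ part j ((jointMatrix A P)⁻¹ *ᵥ ((jointDesign A)ᵀ *ᵥ r - jointPenalty P *ᵥ s))| ≤
      (2 * ρ * τ / c + √(2 * κ * ρ ^ 2 / c)) * (√((n : ℝ) / K) / K) +
        (2 * π * decayMass c C w / c + √(4 * κ * a * π ^ 2 / c ^ 2)) * η := by
  have h := W.abs_bias_le hw hband hjj hB hr hs hD
  have hh := W.h_pos
  have hc := W.c_pos
  have hK := W.card_pos
  have hn := W.n_pos'
  have hs0 : 0 < √((n : ℝ) / K) := Real.sqrt_pos.mpr hh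
  have hss : √((n : ℝ) / K) * √((n : ℝ) / K) = (n : ℝ) / K := Real.mul_self_sqrt hh.le
  set sh := √((n : ℝ) / K) with hsh
  have h1 : 2 / (c * ((n : ℝ) / K)) * (ρ / K *
      (∑ k, decayWeight (1 - c / (2 * C)) w B k * ((A j)ᵀ *ᵥ 1) k) +
      π * (η * sh) * ∑ k, decayWeight (1 - c / (2 * C)) w B k) ≤
      2 / (c * ((n : ℝ) / K)) * (ρ / K * (τ * ((n : ℝ) / K)) + π * (η * sh) * decayMass c C w) := by
    have := W.sum_decay_le hw hB hB1
    gcongr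
  have h2 : √(κ / K * (2 * (n * (ρ / K) ^ 2 / (c * ((n : ℝ) / K))) +
      2 * (2 * N * (π * (η * sh)) ^ 2 / (c * ((n : ℝ) / K)) ^ 2))) ≤
      √(2 * κ * ρ ^ 2 / c) * (1 / K) + √(4 * κ * a * π ^ 2 / c ^ 2) * (η / sh) := by
    refine Real.sqrt_le_iff.mpr ⟨by positivity, ?_⟩
    have e1 : κ / K * (2 * (n * (ρ / K) ^ 2 / (c * ((n : ℝ) / K)))) =
        (√(2 * κ * ρ ^ 2 / c) * (1 / K)) ^ 2 := by
      rw [mul_pow, Real.sq_sqrt (by positivity)]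
      field_simp
    have e2 : κ / K * (2 * (2 * N * (π * (η * sh)) ^ 2 / (c * ((n : ℝ) / K)) ^ 2)) ≤
        (√(4 * κ * a * π ^ 2 / c ^ 2) * (η / sh)) ^ 2 := by
      rw [mul_pow (√_), Real.sq_sqrt (by positivity)]
      calc _ ≤ κ / K * (2 * (2 * (a * K) * (π * (η * sh)) ^ 2 / (c * ((n : ℝ) / K)) ^ 2)) := by
            gcongr
        _ = _ := by
          rw [← hss]
          field_simp
          ring
    have h3 : 0 ≤ √(2 * κ * ρ ^ 2 / c) * (1 / K) * (√(4 * κ * a * π ^ 2 / c ^ 2) * (η / sh)) := by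
      positivity
    rw [mul_add]
    nlinarith
  calc _ ≤ sh * (2 / (c * ((n : ℝ) / K)) * (ρ / K * (τ * ((n : ℝ) / K)) +
          π * (η * sh) * decayMass c C w) + (√(2 * κ * ρ ^ 2 / c) * (1 / K) +
          √(4 * κ * a * π ^ 2 / c ^ 2) * (η / sh))) := by
        refine mul_le_mul_of_nonneg_left (h.trans (add_le_add h1 h2)) hs0.le
    _ = _ := by
      rw [← hss]
      generalize √(2 * κ * ρ ^ 2 / c) = u
      generalize √(4 * κ * a * π ^ 2 / c ^ 2) = v
      field_simp
      ring

end WellConditioned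

/-! ### The estimator as an affine function of the errors -/

/-- The coefficients of the spline approximations of both components. -/
noncomputable def jointCoeff (p K : ℕ) (f : Fin 2 → ℝ → ℝ) : Fin 2 × Fin (K + p) → ℝ :=
  fun a => sampleCoeff p K (f a.1) a.2

/-- The estimator on a well-conditioned sample. -/
theorem WellConditioned.estimator_eq {n p m K : ℕ} {t : Fin 2 → ℝ} {z : Fin n → Fin 2 → ℝ} {h c C : ℝ}
    (W : WellConditioned (designMatrix p K z) (fun j => t j • penalty m (K + p)) h c C)
    (f : Fin 2 → ℝ → ℝ) (e : Fin n → ℝ) (b0 : Fin (K + p) → ℝ) (x : Fin 2 → ℝ)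
    (hx : ∀ j, ∑ k, basis p K (x j) k = 1) (j : Fin 2) :
    estimator p m K t z (response f z e) b0 x j =
      basis p K (x j) ⬝ᵥ sampleCoeff p K (f j) +
      basis p K (x j) ⬝ᵥ part j ((jointMatrix (designMatrix p K z)
        (fun j => t j • penalty m (K + p)))⁻¹ *ᵥ ((jointDesign (designMatrix p K z))ᵀ *ᵥ
          (response f z 0 - jointDesign (designMatrix p K z) *ᵥ jointCoeff p K f) -
          jointPenalty (fun j => t j • penalty m (K + p)) *ᵥ jointCoeff p K f)) +
      weight (designMatrix p K z) (fun j => t j • penalty m (K + p)) j (basis p K (x j)) ⬝ᵥ e -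
      (∑ i, basis p K (z i 1) ⬝ᵥ b0 - ∑ i, basis p K (z i 1) ⬝ᵥ sampleCoeff p K (f 1)) / n *
        (if j = 0 then 1 else -1) := by
  set A := designMatrix p K z with hA
  set P : Fin 2 → Matrix (Fin (K + p)) (Fin (K + p)) ℝ := fun j => t j • penalty m (K + p) with hP
  set T := ∑ i, basis p K (z i 1) ⬝ᵥ b0 with hT
  set y := response f z e with hy
  -- The multiple of `sumVec` selects, among all solutions of the normal equations, the one with the
  -- mean of the initial value.
  set b := (jointMatrix A P)⁻¹ *ᵥ ((jointDesign A)ᵀ *ᵥ y + (T / n) • sumVec A) with hb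
  have hu := W.nullVec_transpose_jointDesign y
  have hMb : jointMatrix A P *ᵥ b = (jointDesign A)ᵀ *ᵥ y + (T / n) • sumVec A :=
    W.jointMatrix_mulVec_inv _
  have htend : Tendsto (backfit p m K t z y b0) atTop (𝓝 (part 0 b, part 1 b)) := by
    refine W.tendsto_backfit (y := y) (fun l => rfl) (fun l => rfl) (fun j j' hjj => ?_) ?_
    · exact W.normal_equations hu hMb j j' hjj
    · rw [W.sumVec_dotProduct_of_eq hu hMb]
      simp [dotProduct, hT, hA, designMatrix, Matrix.mulVec, backfit]
  have hlim : backfitLimit p m K t z y b0 = (part 0 b, part 1 b) := htend.limUnder_eq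
  have hest : estimator p m K t z y b0 x j = basis p K (x j) ⬝ᵥ part j b := by
    unfold estimator
    rw [hlim]
    fin_cases j <;> rfl
  have hyr : y = jointDesign A *ᵥ jointCoeff p K f +
      (response f z 0 - jointDesign A *ᵥ jointCoeff p K f) + e := by
    funext i
    simp [hy, response]
  have hs := W.dotProduct_solution (s := jointCoeff p K f)
    (r := response f z 0 - jointDesign A *ᵥ jointCoeff p K f) (e := e) (t := T) (hx j) j
  rw [← hyr] at hs
  rw [hest, hb, hs, hA, sumVec_designMatrix_dotProduct]
  rfl

/-- The statistic `T` of the errors is affine with small offset from `g`, small individual weights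
and, after multiplication by `h`, a covariance matrix that is bounded and nearly diagonal. -/
structure Linearized {n : ℕ} (T : (Fin n → ℝ) → Fin 2 → ℝ) (g : Fin 2 → ℝ) (σ : Fin n → ℝ)
    (h c C ε : ℝ) (α : Fin 2 → ℝ) (w : Fin 2 → Fin n → ℝ) : Prop where
  eq : ∀ e j, T e j = α j + w j ⬝ᵥ e
  offset : ∀ j, √h * |α j - g j| ≤ ε
  weight_le : ∀ j i, √h * |w j i| ≤ ε
  le_variance : ∀ j, c - ε ≤ h * ∑ i, σ i * w j i ^ 2
  variance_le : ∀ j, h * ∑ i, σ i * w j i ^ 2 ≤ C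
  covariance_le : h * |∑ i, σ i * w 0 i * w 1 i| ≤ ε

/-- The order of the error terms in the linearization of the estimator. -/
noncomputable def errorOrder (n K : ℕ) (η : ℝ) : ℝ :=
  η + √((n : ℝ) / K) / K + (√(K : ℝ))⁻¹ + (√((n : ℝ) / K))⁻¹

theorem le_errorOrder (n K : ℕ) (η : ℝ) : η ≤ errorOrder n K η := by
  have h1 : 0 ≤ √((n : ℝ) / K) / K := by positivity
  have h2 : 0 ≤ (√(K : ℝ))⁻¹ := by positivity
  have h3 : 0 ≤ (√((n : ℝ) / K))⁻¹ := by positivity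
  unfold errorOrder
  linarith

section
variable {n K : ℕ} {η : ℝ} (hη : 0 ≤ η)
include hη

theorem div_le_errorOrder : √((n : ℝ) / K) / K ≤ errorOrder n K η := by
  have h2 : 0 ≤ (√(K : ℝ))⁻¹ := by positivity
  have h3 : 0 ≤ (√((n : ℝ) / K))⁻¹ := by positivity
  unfold errorOrder
  linarith

theorem inv_sqrt_le_errorOrder : (√(K : ℝ))⁻¹ ≤ errorOrder n K η := by
  have h1 : 0 ≤ √((n : ℝ) / K) / K := by positivity
  have h3 : 0 ≤ (√((n : ℝ) / K))⁻¹ := by positivity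
  unfold errorOrder
  linarith

theorem inv_sqrt_div_le_errorOrder : (√((n : ℝ) / K))⁻¹ ≤ errorOrder n K η := by
  have h1 : 0 ≤ √((n : ℝ) / K) / K := by positivity
  have h2 : 0 ≤ (√(K : ℝ))⁻¹ := by positivity
  unfold errorOrder
  linarith

theorem one_div_le_errorOrder (hK : (1 : ℝ) ≤ K) : 1 / (K : ℝ) ≤ errorOrder n K η := by
  refine le_trans ?_ (inv_sqrt_le_errorOrder hη)
  have h0 : (0 : ℝ) < K := by linarith
  have h1 : 1 ≤ √(K : ℝ) := Real.one_le_sqrt.mpr hK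
  rw [one_div]
  refine inv_anti₀ (by linarith) ?_
  nlinarith [Real.mul_self_sqrt h0.le]

end

/-- The limit inherits the mean of the initial value instead of that of the spline for the second
component, and the mismatch shifts a constant between the components. It consists of the mean of the
initial value, the sample mean of f (order n^(-1/2), hence K^(-1/2) after scaling) and the
approximation error. -/
theorem sqrt_mul_abs_centring_le {n p K : ℕ} (hn0 : 0 < n) (hK : 0 < K) {f : ℝ → ℝ} {a τ η : ℝ}
    {z : Fin n → Fin 2 → ℝ} {b0 : Fin (K + p) → ℝ}
    (happrox : ∀ u ∈ Ioc (0 : ℝ) 1, |basis p K u ⬝ᵥ sampleCoeff p K f - f u| ≤ a / K)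
    (hz : ∀ i, z i ∈ unitSquare) (hmean : |∑ i, f (z i 1)| ≤ τ * √n)
    (hb0 : √((n : ℝ) / K) * |1 / (n : ℝ) * ∑ i, basis p K (z i 1) ⬝ᵥ b0| ≤ η) :
    √((n : ℝ) / K) * |(∑ i, basis p K (z i 1) ⬝ᵥ b0 -
      ∑ i, basis p K (z i 1) ⬝ᵥ sampleCoeff p K f) / n| ≤
      η + τ * (√(K : ℝ))⁻¹ + a * (√((n : ℝ) / K) / K) := by
  have hn : (0 : ℝ) < n := by exact_mod_cast hn0
  have hK' : (0 : ℝ) < K := by exact_mod_cast hK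
  have hs0 : 0 < √((n : ℝ) / K) := Real.sqrt_pos.mpr (by positivity)
  set const := (∑ i, basis p K (z i 1) ⬝ᵥ b0 - ∑ i, basis p K (z i 1) ⬝ᵥ sampleCoeff p K f) / n
    with hconst
  have h1 : |∑ i, basis p K (z i 1) ⬝ᵥ sampleCoeff p K f| ≤
      τ * √n + n * (a / K) := by
    have h2 : ∑ i, basis p K (z i 1) ⬝ᵥ sampleCoeff p K f = ∑ i, f (z i 1) +
        ∑ i, (basis p K (z i 1) ⬝ᵥ sampleCoeff p K f - f (z i 1)) := by
      rw [Finset.sum_sub_distrib]; ring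
    rw [h2]
    refine (abs_add_le _ _).trans (add_le_add hmean ?_)
    calc _ ≤ ∑ i : Fin n, a / K := (Finset.abs_sum_le_sum_abs _ _).trans
          (Finset.sum_le_sum fun i _ => happrox _ (apply_mem_Ioc (hz i) 1))
      _ = _ := by simp
  have h3 : |const| ≤ |1 / (n : ℝ) * ∑ i, basis p K (z i 1) ⬝ᵥ b0| +
      (τ * √n + n * (a / K)) / n := by
    rw [hconst, sub_div]
    refine (abs_sub _ _).trans (add_le_add (le_of_eq (by rw [one_div, inv_mul_eq_div])) ?_)
    rw [abs_div, abs_of_pos hn]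
    gcongr
  calc _ ≤ √((n : ℝ) / K) * (|1 / (n : ℝ) * ∑ i, basis p K (z i 1) ⬝ᵥ b0| +
        (τ * √n + n * (a / K)) / n) := mul_le_mul_of_nonneg_left h3 hs0.le
    _ = √((n : ℝ) / K) * |1 / (n : ℝ) * ∑ i, basis p K (z i 1) ⬝ᵥ b0| +
        τ * (√(K : ℝ))⁻¹ + a * (√((n : ℝ) / K) / K) := by
      rw [Real.sqrt_div hn.le]
      have hsn : 0 < √(n : ℝ) := Real.sqrt_pos.mpr hn
      have e1 : √(n : ℝ) / √(K : ℝ) * (τ * √(n : ℝ) / n) = τ * (√(K : ℝ))⁻¹ := by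
        rw [← Real.mul_self_sqrt hn.le]
        simp only [Real.sqrt_mul_self hsn.le]
        field_simp
      have e2 : (n : ℝ) * (a / K) / n = a / K := by field_simp
      rw [add_div, e2, mul_add, mul_add, e1]
      ring
    _ ≤ _ := by gcongr

/-- The bounds in probability that the linearization uses, with the constant `τ`. -/
structure SampleBounds (p m K : ℕ) {n : ℕ} (z : Fin n → Fin 2 → ℝ) (f : Fin 2 → ℝ → ℝ) (x : Fin 2 → ℝ)
    (c C τ : ℝ) : Prop where
  mass : ∀ j, ∑ k, decayWeight (1 - c / (2 * C)) (max 1 (max p m)) (basis p K (x j)) k *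
    ((designMatrix p K z j)ᵀ *ᵥ 1) k ≤ τ * ((n : ℝ) / K)
  cross : ∀ j j', j ≠ j' →
    ∑ k, decayWeight (1 - c / (2 * C)) (max 1 (max p m)) (basis p K (x j)) k *
      ∑ l, (((designMatrix p K z j)ᵀ * designMatrix p K z j') k l) ^ 2 ≤
    τ * ((n : ℝ) ^ 2 / (K : ℝ) ^ 3)
  overlap : ∑ k, ∑ l, decayWeight (1 - c / (2 * C)) (max 1 (max p m)) (basis p K (x 0)) k *
    decayWeight (1 - c / (2 * C)) (max 1 (max p m)) (basis p K (x 1)) l *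
      ((designMatrix p K z 0)ᵀ * designMatrix p K z 1) k l ≤ τ * ((n : ℝ) / (K : ℝ) ^ 2)
  mean : |∑ i, f 1 (z i 1)| ≤ τ * √n

-- The deterministic core: everything random has been moved into hypotheses on the sample. The
-- constant Γ precedes n, K and the sample, and each summand of Γ pays for one of the error terms.
set_option maxHeartbeats 1000000 in
theorem exists_linearized {p m : ℕ} {c C S₀ S L R τ : ℝ} {f : Fin 2 → ℝ → ℝ} {x : Fin 2 → ℝ}
    (hx : x ∈ unitSquare) (hS₀ : 0 ≤ S₀) (hL : 0 ≤ L) (hτ : 0 ≤ τ) (hc : 0 < c) (hcC : c ≤ C)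
    (hfL : ∀ j, ∀ u ∈ Icc (0 : ℝ) 1, ∀ v ∈ Icc (0 : ℝ) 1, |f j u - f j v| ≤ L * |u - v|)
    (hfR : ∀ j, ∀ u ∈ Icc (0 : ℝ) 1, |f j u| ≤ R) :
    ∃ Γ : ℝ, 0 ≤ Γ ∧ ∀ (n K : ℕ) (t : Fin 2 → ℝ) (z : Fin n → Fin 2 → ℝ) (b0 : Fin (K + p) → ℝ)
      (σ : Fin n → ℝ) (η : ℝ), 0 ≤ η → (∀ i, z i ∈ unitSquare) → (∀ i, S₀ ≤ σ i ∧ σ i ≤ S) →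
      WellConditioned (designMatrix p K z) (fun j => t j • penalty m (K + p)) ((n : ℝ) / K) c C →
      (∀ j, 0 ≤ t j) → (∀ j, t j ≤ η * √((n : ℝ) / K)) → SampleBounds p m K z f x c C τ →
      √((n : ℝ) / K) * |1 / (n : ℝ) * ∑ i, basis p K (z i 1) ⬝ᵥ b0| ≤ η →
      ∃ α w, Linearized (fun e => estimator p m K t z (response f z e) b0 x) (fun j => f j (x j)) σ
        ((n : ℝ) / K) (S₀ * (c / (4 * C ^ 2 * (p + 1)))) (S / c) (Γ * errorOrder n K η) α w := by
  have hC : 0 < C := hc.trans_le hcC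
  have hp : (0 : ℝ) ≤ p := Nat.cast_nonneg p
  have hR0 : 0 ≤ R := (abs_nonneg _).trans (hfR 0 0 (by norm_num))
  set w := max 1 (max p m) with hw
  have hw0 : 0 < w := by omega
  have hMass : 0 ≤ decayMass c C w := by
    have h1 : 0 < c / (2 * C) := by positivity
    exact mul_nonneg (by norm_num) (div_nonneg (Nat.cast_nonneg w) (by linarith))
  set κ := 4 * decayMass c C w * τ / c ^ 2 with hκ
  have hκ0 : 0 ≤ κ := by positivity
  set ρ := 2 * (L * (p + 1)) with hρ
  have hρ0 : 0 ≤ ρ := by positivity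
  set π := 4 ^ m * R with hπ
  have hπ0 : 0 ≤ π := by positivity
  set G1 := 2 * ρ * τ / c + √(2 * κ * ρ ^ 2 / c) with hG1
  set G2 := 2 * π * decayMass c C w / c + √(4 * κ * (p + 1) * π ^ 2 / c ^ 2) with hG2
  have hG10 : 0 ≤ G1 := by positivity
  have hG20 : 0 ≤ G2 := by positivity
  -- Γ is fixed before any observation shows S to be nonnegative, hence the truncation.
  set S' := max S 0 with hS'
  have hS'0 : 0 ≤ S' := le_max_right _ _
  set H1 := S' * (4 * τ / c ^ 2 + (4 * √κ + κ) / c) with hH1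
  have hH10 : 0 ≤ H1 := by positivity
  refine ⟨G1 + G2 + 2 * (L * (p + 1)) + 1 + τ + 2 / c + S₀ * κ / c + H1, by positivity,
    fun n K t z b0 σ η hη hz hσ W ht0 ht hZ hb0 => ?_⟩
  set Γ := G1 + G2 + 2 * (L * (p + 1)) + 1 + τ + 2 / c + S₀ * κ / c + H1 with hΓ
  set A := designMatrix p K z with hA
  set P : Fin 2 → Matrix (Fin (K + p)) (Fin (K + p)) ℝ := fun j => t j • penalty m (K + p) with hP
  have hK' : (0 : ℝ) < K := W.card_pos
  have hK : 0 < K := by exact_mod_cast hK'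
  have hK1 : (1 : ℝ) ≤ K := by exact_mod_cast hK
  have hn := W.n_pos'
  have hh := W.h_pos
  have hs0 : 0 < √((n : ℝ) / K) := Real.sqrt_pos.mpr hh
  have hsK : 0 < √(K : ℝ) := Real.sqrt_pos.mpr hK'
  have hsK1 : 1 ≤ √(K : ℝ) := Real.one_le_sqrt.mpr hK1
  have hKinv : 1 / (K : ℝ) ≤ errorOrder n K η := one_div_le_errorOrder hη hK1
  have o1 : η ≤ errorOrder n K η := le_errorOrder n K η
  have o2 : √((n : ℝ) / K) / K ≤ errorOrder n K η := div_le_errorOrder hη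
  have o3 : (√(K : ℝ))⁻¹ ≤ errorOrder n K η := inv_sqrt_le_errorOrder hη
  have o4 : (√((n : ℝ) / K))⁻¹ ≤ errorOrder n K η := inv_sqrt_div_le_errorOrder hη
  set δ := errorOrder n K η with hδ
  have hδ0 : 0 ≤ δ := hη.trans o1
  have mulΓ : ∀ a : ℝ, 0 ≤ a → a ≤ Γ → a * δ ≤ Γ * δ := fun a _ h =>
    mul_le_mul_of_nonneg_right h hδ0
  have hSκ : 0 ≤ S₀ * κ / c := by positivity
  have h2c : 0 ≤ 2 / c := by positivity
  have hLp : 0 ≤ L * (p + 1) := by positivity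
  have hxI : ∀ j, x j ∈ Ioc (0 : ℝ) 1 := apply_mem_Ioc hx
  have hband : ∀ j, ∀ k l : Fin (K + p), w < Nat.dist k l → ((A j)ᵀ * A j + P j) k l = 0 :=
    fun j k l h => lam_designMatrix_eq_zero hK z m t j h
  have hB : ∀ j k, 0 ≤ basis p K (x j) k := fun j k => basis_nonneg hK _ _
  have hBs : ∀ j, ∑ k, basis p K (x j) k = 1 := fun j => sum_basis hK (hxI j)
  have hB1 : ∀ j, basis p K (x j) ⬝ᵥ basis p K (x j) ≤ 1 := fun j =>
    basis_dotProduct_self_le hK (hxI j)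
  have hBge : ∀ j, 1 / ((p : ℝ) + 1) ≤ basis p K (x j) ⬝ᵥ basis p K (x j) := fun j =>
    basis_dotProduct_self_ge hK (hxI j)
  have hD : ∀ j j', j ≠ j' → crossWeight A P j j' (basis p K (x j)) ⬝ᵥ
      crossWeight A P j j' (basis p K (x j)) ≤ κ / K := fun j j' hjj =>
    W.crossWeight_le hw0 hband j j' (hB j) (hBs j) (hZ.cross j j' hjj)
  have hσ0 : ∀ i, 0 ≤ σ i ∧ σ i ≤ S' := fun i =>
    ⟨hS₀.trans (hσ i).1, (hσ i).2.trans (le_max_left _ _)⟩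
  have hne : ∀ j : Fin 2, ∃ j' : Fin 2, j ≠ j' := fun j => by
    fin_cases j
    · exact ⟨1, by simp⟩
    · exact ⟨0, by simp⟩
  have happrox : ∀ j, ∀ u ∈ Ioc (0 : ℝ) 1,
      |basis p K u ⬝ᵥ sampleCoeff p K (f j) - f j u| ≤ L * (p + 1) / K := fun j u hu =>
    abs_basis_dotProduct_sampleCoeff_sub_le hK hL (hfL j) hu
  set r := response f z 0 - jointDesign A *ᵥ jointCoeff p K f with hr
  have hrb : ∀ i, |r i| ≤ ρ / K := by
    intro i
    have e : r i = -(basis p K (z i 0) ⬝ᵥ sampleCoeff p K (f 0) - f 0 (z i 0)) -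
        (basis p K (z i 1) ⬝ᵥ sampleCoeff p K (f 1) - f 1 (z i 1)) := by
      have e1 : (jointDesign A *ᵥ jointCoeff p K f) i = basis p K (z i 0) ⬝ᵥ sampleCoeff p K (f 0) +
          basis p K (z i 1) ⬝ᵥ sampleCoeff p K (f 1) := dotProduct_eq_part _ _
      simp only [hr, Pi.sub_apply, e1, response, Pi.zero_apply]
      ring
    rw [e]
    refine (abs_sub _ _).trans ?_
    rw [abs_neg]
    have h0 := happrox 0 _ (apply_mem_Ioc (hz i) 0)
    have h1 := happrox 1 _ (apply_mem_Ioc (hz i) 1)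
    have : ρ / K = L * (p + 1) / K + L * (p + 1) / K := by rw [hρ]; ring
    linarith
  have hpen : ∀ j k, |(P j *ᵥ part j (jointCoeff p K f)) k| ≤ π * (η * √((n : ℝ) / K)) := by
    intro j k
    have h1 := abs_penalty_mulVec_le m (K + p) (s := sampleCoeff p K (f j)) (S := R) (fun k => by
      refine hfR j _ ⟨le_min (by positivity) zero_le_one, min_le_right _ _⟩) k
    have e : (P j *ᵥ part j (jointCoeff p K f)) k = t j * (penalty m (K + p) *ᵥ sampleCoeff p K (f j)) k := by
      rw [hP, Matrix.smul_mulVec]; rfl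
    rw [e, abs_mul, abs_of_nonneg (ht0 j)]
    calc _ ≤ η * √((n : ℝ) / K) * (4 ^ m * R) :=
          mul_le_mul (ht j) h1 (abs_nonneg _) (mul_nonneg hη hs0.le)
      _ = _ := by rw [hπ]; ring
  set bias : Fin 2 → ℝ := fun j => basis p K (x j) ⬝ᵥ part j ((jointMatrix A P)⁻¹ *ᵥ
    ((jointDesign A)ᵀ *ᵥ r - jointPenalty P *ᵥ jointCoeff p K f)) with hbias
  set const := (∑ i, basis p K (z i 1) ⬝ᵥ b0 - ∑ i, basis p K (z i 1) ⬝ᵥ sampleCoeff p K (f 1)) / n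
    with hconst
  have hbias_le : ∀ j, √((n : ℝ) / K) * |bias j| ≤ G1 * (√((n : ℝ) / K) / K) + G2 * η := by
    intro j
    obtain ⟨j', hjj⟩ := hne j
    exact W.sqrt_mul_abs_bias_le hw0 hband hjj (hB j) (hBs j) hρ0 hrb hπ0 hη hpen hκ0
      (by positivity) (by push_cast; nlinarith) (hD j j' hjj) (hZ.mass j)
  have hconst_le : √((n : ℝ) / K) * |const| ≤
      η + τ * (√(K : ℝ))⁻¹ + L * (p + 1) * (√((n : ℝ) / K) / K) :=
    sqrt_mul_abs_centring_le W.n_pos hK (happrox 1) hz hZ.mean hb0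
  refine ⟨fun j => basis p K (x j) ⬝ᵥ sampleCoeff p K (f j) + bias j -
      const * (if j = 0 then 1 else -1), fun j => weight A P j (basis p K (x j)), ?_⟩
  refine ⟨fun e j => ?_, fun j => ?_, fun j i => ?_, fun j => ?_, fun j => ?_, ?_⟩
  · rw [W.estimator_eq f e b0 x hBs j]
    ring
  · have h1 := happrox j _ (hxI j)
    have h2 : |basis p K (x j) ⬝ᵥ sampleCoeff p K (f j) + bias j -
        const * (if j = 0 then 1 else -1) - f j (x j)| ≤
        L * (p + 1) / K + |bias j| + |const| := by
      have e : basis p K (x j) ⬝ᵥ sampleCoeff p K (f j) + bias j -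
          const * (if j = 0 then 1 else -1) - f j (x j) =
          (basis p K (x j) ⬝ᵥ sampleCoeff p K (f j) - f j (x j)) + bias j -
          const * (if j = 0 then 1 else -1) := by ring
      rw [e]
      refine (abs_sub _ _).trans (add_le_add ((abs_add_le _ _).trans (add_le_add h1 le_rfl)) ?_)
      rw [abs_mul]
      split_ifs <;> simp
    calc _ ≤ √((n : ℝ) / K) * (L * (p + 1) / K + |bias j| + |const|) :=
          mul_le_mul_of_nonneg_left h2 hs0.le
      _ = L * (p + 1) * (√((n : ℝ) / K) / K) + √((n : ℝ) / K) * |bias j| +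
          √((n : ℝ) / K) * |const| := by ring
      _ ≤ L * (p + 1) * (√((n : ℝ) / K) / K) + (G1 * (√((n : ℝ) / K) / K) + G2 * η) +
          (η + τ * (√(K : ℝ))⁻¹ + L * (p + 1) * (√((n : ℝ) / K) / K)) :=
        add_le_add (add_le_add le_rfl (hbias_le j)) hconst_le
      _ ≤ L * (p + 1) * δ + (G1 * δ + G2 * δ) + (δ + τ * δ + L * (p + 1) * δ) := by gcongr
      _ = (G1 + G2 + 2 * (L * (p + 1)) + 1 + τ) * δ := by ring
      _ ≤ Γ * δ := mulΓ _ (by positivity) (by rw [hΓ]; linarith)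
  · refine (W.sqrt_mul_abs_weight_le j (hB1 j) i).trans ?_
    refine (mul_le_mul_of_nonneg_left o4 h2c).trans (mulΓ _ h2c ?_)
    rw [hΓ]; linarith
  · obtain ⟨j', hjj⟩ := hne j
    -- The squared norm of the basis vector is at least 1/(p + 1), which explains the constant in
    -- the lower variance bound; the cross remainder is of order 1/K.
    have h1 := W.le_mul_variance hjj (hBge j) (hD j j' hjj) hS₀ fun i => (hσ i).1
    refine le_trans ?_ h1
    have h2 : S₀ * κ / c * (1 / K) ≤ Γ * δ :=
      (mul_le_mul_of_nonneg_left (hKinv) hSκ).trans (mulΓ _ hSκ (by rw [hΓ]; linarith))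
    have h3 : S₀ * (c * (1 / ((p : ℝ) + 1)) / (4 * C ^ 2) - κ / K / c) =
        S₀ * (c / (4 * C ^ 2 * (p + 1))) - S₀ * κ / c * (1 / K) := by field_simp
    rw [h3]
    linarith
  · rcases isEmpty_or_nonempty (Fin n) with hE | ⟨⟨i⟩⟩
    · exact hE.elim ⟨0, W.n_pos⟩
    · exact W.mul_variance_le j (hB1 j) (hS₀.trans ((hσ i).1.trans (hσ i).2)) fun i => (hσ i).2
  · have h1 := W.mul_abs_cov_le hw0 hband (B := fun j => basis p K (x j)) hB hB1 hS'0 hσ0 hD hZ.overlap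
    refine h1.trans (le_trans ?_ (mulΓ H1 hH10 (by rw [hΓ]; linarith)))
    have h2 : √(κ / K) = √κ * (√(K : ℝ))⁻¹ := by rw [Real.sqrt_div hκ0]; ring
    have h3 : 4 * τ / c ^ 2 / K ≤ 4 * τ / c ^ 2 * δ := by
      rw [div_eq_mul_one_div _ (K : ℝ)]
      exact mul_le_mul_of_nonneg_left (hKinv) (by positivity)
    have h4 : 4 * √(κ / K) + κ / K ≤ (4 * √κ + κ) * δ := by
      rw [h2, div_eq_mul_one_div κ, add_mul, mul_assoc]
      have := mul_le_mul_of_nonneg_left o3 (Real.sqrt_nonneg κ)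
      have := mul_le_mul_of_nonneg_left (hKinv) hκ0
      linarith
    calc _ ≤ S' * (4 * τ / c ^ 2 * δ + (4 * √κ + κ) * δ / c) := by gcongr
      _ = H1 * δ := by rw [hH1]; ring

/-! ### Bounds in probability for the sample quantities -/

/-- Markov's inequality with the natural scale a factored out, so that the bound θ/τ can be uniform
in n and K. -/
theorem measureReal_not_le_le {Ω : Type*} [MeasurableSpace Ω] {μ : Measure Ω}
    [IsProbabilityMeasure μ] {Z : Ω → ℝ} (h0 : ∀ ω, 0 ≤ Z ω) (hi : Integrable Z μ) {a θ τ : ℝ}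
    (ha : 0 < a) (hτ : 0 < τ) (hZ : ∫ ω, Z ω ∂μ ≤ θ * a) :
    μ.real {ω | ¬ Z ω ≤ τ * a} ≤ θ / τ := by
  have h1 := mul_meas_ge_le_integral_of_nonneg (ae_of_all _ h0) hi (τ * a)
  have h2 : μ.real {ω | ¬ Z ω ≤ τ * a} ≤ μ.real {ω | τ * a ≤ Z ω} :=
    measureReal_mono fun ω (hω : ¬ _) => (not_le.mp hω).le
  rw [le_div_iff₀ hτ]
  have h3 : τ * a * μ.real {ω | ¬ Z ω ≤ τ * a} ≤ θ * a :=
    (mul_le_mul_of_nonneg_left h2 (by positivity)).trans (h1.trans hZ)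
  exact le_of_mul_le_mul_right (by linarith) ha

section
variable {Ω : Type*} [MeasurableSpace Ω] {μ : Measure Ω} [IsProbabilityMeasure μ]
  {X : ℕ → Ω → Fin 2 → ℝ} {ν : Measure (Fin 2 → ℝ)} {c C : ℝ}
  (L : SquareLaw ν c C) (hX : ∀ i, Measurable (X i)) (hlaw : ∀ i, μ.map (X i) = ν)
  {p K : ℕ} (hK : 0 < K)
include L hX hlaw hK

theorem integral_mass_le (n : ℕ) (j : Fin 2) {om : Fin (K + p) → ℝ} (hom : ∀ k, 0 ≤ om k) :
    Integrable (fun ω => ∑ k, om k * ((designMatrix p K (fun i : Fin n => X i ω) j)ᵀ *ᵥ 1) k) μ ∧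
    ∫ ω, ∑ k, om k * ((designMatrix p K (fun i : Fin n => X i ω) j)ᵀ *ᵥ 1) k ∂μ ≤
      (∑ k, om k) * (C * (p + 1)) * ((n : ℝ) / K) := by
  have e : ∀ ω k, ((designMatrix p K (fun i : Fin n => X i ω) j)ᵀ *ᵥ 1) k =
      ∑ i : Fin n, feature p K (X i ω) (j, k) := fun ω k => by
    simp [Matrix.mulVec, dotProduct, designMatrix, feature]
  simp_rw [e]
  have hb : ∀ k, ∀ z ∈ unitSquare, |feature p K z (j, k)| ≤ 1 := fun k z hz =>
    abs_feature_le_one hK hz _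
  have hi : ∀ k, Integrable (fun ω => om k * ∑ i : Fin n, feature p K (X i ω) (j, k)) μ := fun k =>
    (integrable_sum_comp_law L hX hlaw n (measurable_feature_apply p K (j, k)) (hb k)).const_mul _
  refine ⟨integrable_finsetSum _ fun k _ => hi k, ?_⟩
  rw [integral_finsetSum _ fun k _ => hi k, Finset.sum_mul, Finset.sum_mul]
  refine Finset.sum_le_sum fun k _ => ?_
  rw [integral_const_mul, integral_sum_comp_law L hX hlaw n (measurable_feature_apply p K (j, k))
    (hb k), mul_assoc]
  refine mul_le_mul_of_nonneg_left ?_ (hom k)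
  calc _ ≤ (n : ℝ) * (C * ((p + 1) / K)) :=
        mul_le_mul_of_nonneg_left (L.integral_feature_le hK _) (Nat.cast_nonneg n)
    _ = _ := by ring

omit [IsProbabilityMeasure μ] hX hlaw in
theorem integral_feature_mul_le_of_ne {j j' : Fin 2} (hjj : j ≠ j') (k l : Fin (K + p)) :
    ∫ z, feature p K z (j, k) * feature p K z (j', l) ∂ν ≤ C * ((p + 1) / K) ^ 2 := by
  fin_cases j <;> fin_cases j'
  · exact absurd rfl hjj
  · exact L.integral_feature_mul_le hK k l
  · exact (integral_congr_ae (ae_of_all _ fun z => mul_comm _ _)).trans_le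
      (L.integral_feature_mul_le hK l k)
  · exact absurd rfl hjj

omit [IsProbabilityMeasure μ] L hX hlaw in
theorem abs_feature_mul_le_one (a b : Fin 2 × Fin (K + p)) (z : Fin 2 → ℝ) (hz : z ∈ unitSquare) :
    |feature p K z a * feature p K z b| ≤ 1 := by
  rw [abs_mul]
  exact mul_le_one₀ (abs_feature_le_one hK hz _) (abs_nonneg _) (abs_feature_le_one hK hz _)

theorem integral_sum_feature_mul_sq_le (hind : iIndepFun X μ) (n : ℕ) {j j' : Fin 2}
    (hjj : j ≠ j') (k l : Fin (K + p)) :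
    Integrable (fun ω => (∑ i : Fin n, feature p K (X i ω) (j, k) * feature p K (X i ω) (j', l)) ^ 2) μ ∧
    ∫ ω, (∑ i : Fin n, feature p K (X i ω) (j, k) * feature p K (X i ω) (j', l)) ^ 2 ∂μ ≤
      2 * (n * (C * ((p + 1) / K) ^ 2)) + 2 * (n * (C * ((p + 1) / K) ^ 2)) ^ 2 := by
  have hm : Measurable fun z => feature p K z (j, k) * feature p K z (j', l) :=
    (measurable_feature_apply p K _).mul (measurable_feature_apply p K _)
  have hb := abs_feature_mul_le_one hK (j, k) (j', l)
  exact ⟨(memLp_sum_comp_law L hX hlaw n hm hb).integrable_sq,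
    integral_sum_sq_le L hX hlaw hind n hm
      (fun z _ => mul_nonneg (feature_nonneg hK z _) (feature_nonneg hK z _))
      (fun z hz => (le_abs_self _).trans (hb z hz)) (integral_feature_mul_le_of_ne L hK hjj k l)⟩

/-- A cross Gram entry is a sum of n terms with mean of order K⁻². Because K² ≤ n its mean is
bounded below by a fixed order, and the variance is absorbed into the squared order n²/K⁴; a row has
K + p such entries. -/
theorem integral_cross_le (hind : iIndepFun X μ) {n : ℕ} (hKn : K ^ 2 ≤ n) {j j' : Fin 2}
    (hjj : j ≠ j') {om : Fin (K + p) → ℝ} (hom : ∀ k, 0 ≤ om k) :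
    Integrable (fun ω => ∑ k, om k * ∑ l, (((designMatrix p K (fun i : Fin n => X i ω) j)ᵀ *
      designMatrix p K (fun i : Fin n => X i ω) j') k l) ^ 2) μ ∧
    ∫ ω, ∑ k, om k * ∑ l, (((designMatrix p K (fun i : Fin n => X i ω) j)ᵀ *
      designMatrix p K (fun i : Fin n => X i ω) j') k l) ^ 2 ∂μ ≤
      (∑ k, om k) * ((p + 1) * (2 * (C * (p + 1) ^ 2) + 2 * (C * (p + 1) ^ 2) ^ 2)) *
        ((n : ℝ) ^ 2 / (K : ℝ) ^ 3) := by
  have e : ∀ ω k l, ((designMatrix p K (fun i : Fin n => X i ω) j)ᵀ *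
      designMatrix p K (fun i : Fin n => X i ω) j') k l =
      ∑ i : Fin n, feature p K (X i ω) (j, k) * feature p K (X i ω) (j', l) := fun ω k l => by
    simp [Matrix.mul_apply, designMatrix, feature]
  simp_rw [e]
  have h1 := fun k l => integral_sum_feature_mul_sq_le L hX hlaw (p := p) hK hind n hjj k l
  have hi : ∀ k, Integrable (fun ω => om k * ∑ l, (∑ i : Fin n, feature p K (X i ω) (j, k) *
      feature p K (X i ω) (j', l)) ^ 2) μ := fun k =>
    (integrable_finsetSum _ fun l _ => (h1 k l).1).const_mul _
  refine ⟨integrable_finsetSum _ fun k _ => hi k, ?_⟩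
  rw [integral_finsetSum _ fun k _ => hi k, Finset.sum_mul, Finset.sum_mul]
  refine Finset.sum_le_sum fun k _ => ?_
  rw [integral_const_mul, integral_finsetSum _ fun l _ => (h1 k l).1, mul_assoc]
  refine mul_le_mul_of_nonneg_left ?_ (hom k)
  have hK' : (0 : ℝ) < K := by exact_mod_cast hK
  have hK1 : (1 : ℝ) ≤ K := by exact_mod_cast hK
  have hKn' : (K : ℝ) ^ 2 ≤ n := by exact_mod_cast hKn
  have hn : (0 : ℝ) < n := lt_of_lt_of_le (by positivity) hKn'
  have hp : (0 : ℝ) ≤ p := Nat.cast_nonneg p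
  have hC := L.C_pos
  set a := C * ((p : ℝ) + 1) ^ 2 with ha
  have ha0 : 0 ≤ a := by positivity
  have e2 : (n : ℝ) * (C * ((p + 1) / K) ^ 2) = a * (n / (K : ℝ) ^ 2) := by rw [ha]; ring
  have h2 : (1 : ℝ) ≤ n / (K : ℝ) ^ 2 := by rw [le_div_iff₀ (by positivity)]; linarith
  calc _ ≤ ∑ l : Fin (K + p), (2 * (a * (n / (K : ℝ) ^ 2)) + 2 * (a * (n / (K : ℝ) ^ 2)) ^ 2) :=
        Finset.sum_le_sum fun l _ => by rw [← e2]; exact (h1 k l).2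
    _ = ((K : ℝ) + p) * (2 * (a * (n / (K : ℝ) ^ 2)) + 2 * (a * (n / (K : ℝ) ^ 2)) ^ 2) := by
        rw [Finset.sum_const, Finset.card_univ, Fintype.card_fin, nsmul_eq_mul]
        push_cast
        rfl
    _ ≤ ((p + 1) * K) * (2 * a * (n / (K : ℝ) ^ 2) ^ 2 + 2 * a ^ 2 * (n / (K : ℝ) ^ 2) ^ 2) := by
        refine mul_le_mul (by nlinarith) ?_ (by positivity) (by positivity)
        have : n / (K : ℝ) ^ 2 ≤ (n / (K : ℝ) ^ 2) ^ 2 := by nlinarith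
        have := mul_le_mul_of_nonneg_left this ha0
        nlinarith
    _ = _ := by field_simp

theorem integral_overlap_le (n : ℕ) {om₀ om₁ : Fin (K + p) → ℝ} (h₀ : ∀ k, 0 ≤ om₀ k)
    (h₁ : ∀ k, 0 ≤ om₁ k) :
    Integrable (fun ω => ∑ k, ∑ l, om₀ k * om₁ l * ((designMatrix p K (fun i : Fin n => X i ω) 0)ᵀ *
      designMatrix p K (fun i : Fin n => X i ω) 1) k l) μ ∧
    ∫ ω, ∑ k, ∑ l, om₀ k * om₁ l * ((designMatrix p K (fun i : Fin n => X i ω) 0)ᵀ *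
      designMatrix p K (fun i : Fin n => X i ω) 1) k l ∂μ ≤
      (∑ k, om₀ k) * (∑ l, om₁ l) * (C * (p + 1) ^ 2) * ((n : ℝ) / (K : ℝ) ^ 2) := by
  have e : ∀ ω k l, ((designMatrix p K (fun i : Fin n => X i ω) 0)ᵀ *
      designMatrix p K (fun i : Fin n => X i ω) 1) k l =
      ∑ i : Fin n, feature p K (X i ω) (0, k) * feature p K (X i ω) (1, l) := fun ω k l => by
    simp [Matrix.mul_apply, designMatrix, feature]
  simp_rw [e]
  have hm : ∀ k l, Measurable fun z => feature p K z (0, k) * feature p K z (1, l) := fun k l =>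
    (measurable_feature_apply p K _).mul (measurable_feature_apply p K _)
  have hi : ∀ k l, Integrable (fun ω => om₀ k * om₁ l * ∑ i : Fin n, feature p K (X i ω) (0, k) *
      feature p K (X i ω) (1, l)) μ := fun k l =>
    (integrable_sum_comp_law L hX hlaw n (hm k l) (abs_feature_mul_le_one hK _ _)).const_mul _
  have hi' := fun k => integrable_finsetSum Finset.univ fun l _ => hi k l
  refine ⟨integrable_finsetSum _ fun k _ => hi' k, ?_⟩
  rw [integral_finsetSum _ fun k _ => hi' k, Finset.sum_mul_sum, Finset.sum_mul, Finset.sum_mul]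
  refine Finset.sum_le_sum fun k _ => ?_
  rw [integral_finsetSum _ fun l _ => hi k l, Finset.sum_mul, Finset.sum_mul]
  refine Finset.sum_le_sum fun l _ => ?_
  rw [integral_const_mul, integral_sum_comp_law L hX hlaw n (hm k l) (abs_feature_mul_le_one hK _ _),
    mul_assoc (om₀ k * om₁ l)]
  refine mul_le_mul_of_nonneg_left ?_ (mul_nonneg (h₀ k) (h₁ l))
  calc _ ≤ (n : ℝ) * (C * ((p + 1) / K) ^ 2) :=
        mul_le_mul_of_nonneg_left (L.integral_feature_mul_le hK k l) (Nat.cast_nonneg n)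
    _ = _ := by ring

end

/-- The bounds used by the linearization hold with probability close to one for large `τ`. -/
theorem exists_measureReal_not_sampleBounds_le {Ω : Type*} [MeasurableSpace Ω] {μ : Measure Ω}
    [IsProbabilityMeasure μ] {X : ℕ → Ω → Fin 2 → ℝ} {ν : Measure (Fin 2 → ℝ)} {c C : ℝ}
    (L : SquareLaw ν c C) (hX : ∀ i, Measurable (X i)) (hlaw : ∀ i, μ.map (X i) = ν)
    (hind : iIndepFun X μ) (p m : ℕ) {f : Fin 2 → ℝ → ℝ} (hf : Measurable (f 1)) {R : ℝ}
    (hR : ∀ u ∈ Icc (0 : ℝ) 1, |f 1 u| ≤ R) (hf0 : ∫ z, f 1 (z 1) ∂ν = 0) {x : Fin 2 → ℝ}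
    (hx : x ∈ unitSquare) {c₁ C₁ : ℝ} (hc₁ : 0 < c₁) (hcC : c₁ ≤ C₁) :
    ∃ Θ : ℝ, ∀ τ : ℝ, 1 ≤ τ → ∀ n K : ℕ, 0 < K → K ^ 2 ≤ n →
      μ.real {ω | ¬ SampleBounds p m K (fun i : Fin n => X i ω) f x c₁ C₁ τ} ≤ Θ / τ := by
  have := L.isProb
  set w := max 1 (max p m) with hw
  have hw0 : 0 < w := by omega
  set q := 1 - c₁ / (2 * C₁) with hq
  have hC₁ : 0 < C₁ := hc₁.trans_le hcC
  have hq0 : 0 ≤ q := by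
    rw [hq, sub_nonneg, div_le_one (by positivity)]
    linarith
  have hq1 : q < 1 := by
    have : 0 < c₁ / (2 * C₁) := by positivity
    rw [hq]; linarith
  set D := 2 * ((w : ℝ) / (1 - q)) with hD
  have hD0 : 0 ≤ D := mul_nonneg (by norm_num) (div_nonneg (Nat.cast_nonneg w) (by linarith))
  have hp : (0 : ℝ) ≤ p := Nat.cast_nonneg p
  have hC := L.C_pos
  set Θ1 := D * (C * (p + 1)) with hΘ1
  set Θ2 := D * ((p + 1) * (2 * (C * (p + 1) ^ 2) + 2 * (C * (p + 1) ^ 2) ^ 2)) with hΘ2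
  set Θ3 := D * D * (C * (p + 1) ^ 2) with hΘ3
  have hΘ20 : 0 ≤ Θ2 := by positivity
  refine ⟨2 * Θ1 + 4 * Θ2 + Θ3 + R ^ 2, fun τ hτ n K hK hKn => ?_⟩
  have hτ0 : 0 < τ := by linarith
  have hK' : (0 : ℝ) < K := by exact_mod_cast hK
  have hn : (0 : ℝ) < n := by
    have : (K : ℝ) ^ 2 ≤ n := by exact_mod_cast hKn
    exact lt_of_lt_of_le (by positivity) this
  set om : Fin 2 → Fin (K + p) → ℝ := fun j => decayWeight q w (basis p K (x j)) with hom
  have hB : ∀ j k, 0 ≤ basis p K (x j) k := fun j k => basis_nonneg hK _ _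
  have hom0 : ∀ j k, 0 ≤ om j k := fun j k => decayWeight_nonneg hq0 w (hB j) k
  have homs : ∀ j, ∑ k, om j k ≤ D := fun j =>
    sum_decayWeight_le hq0 hq1 hw0 (hB j) (sum_basis hK (apply_mem_Ioc hx j))
  have homs0 : ∀ j, 0 ≤ ∑ k, om j k := fun j => Finset.sum_nonneg fun k _ => hom0 j k
  have hNn : ∀ ω (j j' : Fin 2) k l, 0 ≤ ((designMatrix p K (fun i : Fin n => X i ω) j)ᵀ *
      designMatrix p K (fun i : Fin n => X i ω) j') k l := fun ω j j' k l => by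
    rw [Matrix.mul_apply]
    exact Finset.sum_nonneg fun i _ => mul_nonneg (basis_nonneg hK _ _) (basis_nonneg hK _ _)
  set S1 : Fin 2 → Set Ω := fun j => {ω | ¬ ∑ k, om j k *
    ((designMatrix p K (fun i : Fin n => X i ω) j)ᵀ *ᵥ 1) k ≤ τ * ((n : ℝ) / K)} with hS1
  set S2 : Fin 2 × Fin 2 → Set Ω := fun jj => {ω | jj.1 ≠ jj.2 ∧ ¬ ∑ k, om jj.1 k *
    ∑ l, (((designMatrix p K (fun i : Fin n => X i ω) jj.1)ᵀ *
      designMatrix p K (fun i : Fin n => X i ω) jj.2) k l) ^ 2 ≤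
      τ * ((n : ℝ) ^ 2 / (K : ℝ) ^ 3)} with hS2
  set S3 : Set Ω := {ω | ¬ ∑ k, ∑ l, om 0 k * om 1 l *
    ((designMatrix p K (fun i : Fin n => X i ω) 0)ᵀ *
      designMatrix p K (fun i : Fin n => X i ω) 1) k l ≤ τ * ((n : ℝ) / (K : ℝ) ^ 2)} with hS3
  set S4 : Set Ω := {ω | ¬ (∑ i : Fin n, f 1 (X i ω 1)) ^ 2 ≤ τ * n} with hS4
  have hsub : {ω | ¬ SampleBounds p m K (fun i : Fin n => X i ω) f x c₁ C₁ τ} ⊆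
      (((⋃ j, S1 j) ∪ ⋃ jj, S2 jj) ∪ S3) ∪ S4 := by
    intro ω hω
    by_contra hne
    simp only [mem_union, mem_iUnion, not_or, not_exists] at hne
    obtain ⟨⟨⟨h1, h2⟩, h3⟩, h4⟩ := hne
    refine hω ⟨fun j => not_not.mp (h1 j), fun j j' hjj => ?_, not_not.mp h3, ?_⟩
    · by_contra hc
      exact h2 (j, j') ⟨hjj, hc⟩
    · have h5 : (∑ i : Fin n, f 1 (X i ω 1)) ^ 2 ≤ τ * n := not_not.mp h4
      refine abs_le_of_sq_le_sq ?_ (by positivity)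
      rw [mul_pow, Real.sq_sqrt hn.le]
      -- The event gives τn for the squared sum, and τ ≤ τ² since τ ≥ 1.
      refine h5.trans (mul_le_mul_of_nonneg_right ?_ hn.le)
      nlinarith
  have b1 : ∀ j, μ.real (S1 j) ≤ Θ1 / τ := fun j => by
    have h := integral_mass_le L hX hlaw (p := p) hK n j (hom0 j)
    refine measureReal_not_le_le (fun ω => Finset.sum_nonneg fun k _ => mul_nonneg (hom0 j k) ?_)
      h.1 (by positivity) hτ0 (h.2.trans ?_)
    · simp only [Matrix.mulVec, dotProduct]
      exact Finset.sum_nonneg fun (i : Fin n) _ => mul_nonneg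
        (basis_nonneg (p := p) hK (X i ω j) k) zero_le_one
    · have := homs j
      rw [hΘ1]; gcongr
  have b2 : ∀ jj, μ.real (S2 jj) ≤ Θ2 / τ := fun jj => by
    by_cases hjj : jj.1 = jj.2
    · have : S2 jj = ∅ := by ext ω; simp [hS2, hjj]
      rw [this, measureReal_empty]
      positivity
    · have h := integral_cross_le L hX hlaw (p := p) hK hind hKn hjj (hom0 jj.1)
      refine (measureReal_mono fun ω hω => hω.2).trans (measureReal_not_le_le (fun ω =>
        Finset.sum_nonneg fun k _ => mul_nonneg (hom0 _ k) (Finset.sum_nonneg fun l _ => sq_nonneg _))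
        h.1 (by positivity) hτ0 (h.2.trans ?_))
      have := homs jj.1
      rw [hΘ2]; gcongr
  have b3 : μ.real S3 ≤ Θ3 / τ := by
    have h := integral_overlap_le L hX hlaw (p := p) hK n (hom0 0) (hom0 1)
    refine measureReal_not_le_le (fun ω => Finset.sum_nonneg fun k _ => Finset.sum_nonneg fun l _ =>
      mul_nonneg (mul_nonneg (hom0 _ k) (hom0 _ l)) (hNn ω 0 1 k l))
      h.1 (by positivity) hτ0 (h.2.trans ?_)
    have h0 := homs 0
    have h1 := homs 1
    have h00 := homs0 0
    have h10 := homs0 1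
    rw [hΘ3]; gcongr
  have b4 : μ.real S4 ≤ R ^ 2 / τ := by
    have hRb : ∀ z ∈ unitSquare, |f 1 (z 1)| ≤ R := fun z hz =>
      hR _ (Ioo_subset_Icc_self (hz 1 (mem_univ 1)))
    have hm : Measurable fun z : Fin 2 → ℝ => f 1 (z 1) := hf.comp (measurable_pi_apply 1)
    have h := integral_sum_sub_sq_le L hX hlaw hind n hm hRb
    rw [hf0, mul_zero] at h
    simp only [sub_zero] at h
    refine measureReal_not_le_le (fun ω => sq_nonneg _) h.1 hn hτ0 (h.2.trans ?_)
    rw [mul_comm]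
    refine mul_le_mul_of_nonneg_right ?_ hn.le
    have hb2 : ∀ z ∈ unitSquare, |f 1 (z 1) ^ 2| ≤ R ^ 2 := fun z hz => by
      rw [abs_pow]; exact pow_le_pow_left₀ (abs_nonneg _) (hRb z hz) 2
    calc ∫ z, f 1 (z 1) ^ 2 ∂ν ≤ ∫ z, R ^ 2 ∂ν := by
          refine integral_mono_ae (L.integrable (hm.pow_const 2) hb2) (integrable_const _) ?_
          filter_upwards [L.ae_mem] with z hz using (le_abs_self _).trans (hb2 z hz)
      _ = R ^ 2 := by simp
  have s1 : μ.real (⋃ j, S1 j) ≤ 2 * (Θ1 / τ) :=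
    (measureReal_iUnion_fintype_le S1).trans ((Finset.sum_le_sum fun j _ => b1 j).trans (by simp))
  have s2 : μ.real (⋃ jj, S2 jj) ≤ 4 * (Θ2 / τ) :=
    (measureReal_iUnion_fintype_le S2).trans ((Finset.sum_le_sum fun j _ => b2 j).trans
      (by simp))
  have u1 := measureReal_union_le (μ := μ) (⋃ j, S1 j) (⋃ jj, S2 jj)
  have u2 := measureReal_union_le (μ := μ) ((⋃ j, S1 j) ∪ ⋃ jj, S2 jj) S3
  have u3 := measureReal_union_le (μ := μ) (((⋃ j, S1 j) ∪ ⋃ jj, S2 jj) ∪ S3) S4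
  have u0 := measureReal_mono (μ := μ) hsub
  calc _ ≤ 2 * (Θ1 / τ) + 4 * (Θ2 / τ) + Θ3 / τ + R ^ 2 / τ := by linarith
    _ = _ := by ring

/-! ### Consequences of the growth rate of K -/

section Rates
variable {K : ℕ → ℕ} {γ : ℝ} (hK : (fun n => (K n : ℝ)) =Θ[atTop] fun n : ℕ => (n : ℝ) ^ γ)
include hK

theorem tendsto_knots (hγ : 1 / 3 < γ) : Tendsto (fun n => (K n : ℝ)) atTop atTop := by
  have h1 : Tendsto (fun n : ℕ => (n : ℝ) ^ γ) atTop atTop :=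
    (tendsto_rpow_atTop (by linarith)).comp tendsto_natCast_atTop_atTop
  have h2 := hK.tendsto_norm_atTop_iff.mpr (tendsto_norm_atTop_atTop.comp h1)
  refine h2.congr fun n => ?_
  simp

/-- This is where γ < 1/2 is needed: it makes the deviation, of order √n, negligible against h. -/
theorem tendsto_knots_sq_div (hγ' : γ < 1 / 2) :
    Tendsto (fun n : ℕ => (K n : ℝ) ^ 2 / n) atTop (𝓝 0) := by
  have h1 : Tendsto (fun n : ℕ => (n : ℝ) ^ (-(1 - 2 * γ))) atTop (𝓝 0) :=
    (tendsto_rpow_neg_atTop (by linarith)).comp tendsto_natCast_atTop_atTop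
  have h2 : (fun n : ℕ => (K n : ℝ) ^ 2 * (n : ℝ)⁻¹) =O[atTop]
      fun n : ℕ => ((n : ℝ) ^ γ) ^ 2 * (n : ℝ)⁻¹ :=
    (hK.1.pow 2).mul (isBigO_refl _ _)
  have h3 : (fun n : ℕ => ((n : ℝ) ^ γ) ^ 2 * (n : ℝ)⁻¹) =ᶠ[atTop]
      fun n : ℕ => (n : ℝ) ^ (-(1 - 2 * γ)) := by
    filter_upwards [eventually_gt_atTop 0] with n hn
    have hn' : (0 : ℝ) < n := by exact_mod_cast hn
    rw [← Real.rpow_natCast, ← Real.rpow_mul hn'.le, ← Real.rpow_neg_one, ← Real.rpow_add hn']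
    congr 1
    push_cast
    ring
  exact h2.trans_tendsto (h1.congr' h3.symm)

/-- This is where γ > 1/3 is needed: the approximation bias 1/K becomes negligible against the
standard deviation h^(-1/2). -/
theorem tendsto_div_knots_cube (hγ : 1 / 3 < γ) :
    Tendsto (fun n : ℕ => (n : ℝ) / (K n : ℝ) ^ 3) atTop (𝓝 0) := by
  have h1 : Tendsto (fun n : ℕ => (n : ℝ) ^ (-(3 * γ - 1))) atTop (𝓝 0) :=
    (tendsto_rpow_neg_atTop (by linarith)).comp tendsto_natCast_atTop_atTop
  have h2 : (fun n : ℕ => (n : ℝ) * ((K n : ℝ)⁻¹) ^ 3) =O[atTop]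
      fun n : ℕ => (n : ℝ) * (((n : ℝ) ^ γ)⁻¹) ^ 3 :=
    (isBigO_refl _ _).mul (hK.inv.1.pow 3)
  have h3 : (fun n : ℕ => (n : ℝ) * (((n : ℝ) ^ γ)⁻¹) ^ 3) =ᶠ[atTop]
      fun n : ℕ => (n : ℝ) ^ (-(3 * γ - 1)) := by
    filter_upwards [eventually_gt_atTop 0] with n hn
    have hn' : (0 : ℝ) < n := by exact_mod_cast hn
    rw [← Real.rpow_neg hn'.le, ← Real.rpow_natCast, ← Real.rpow_mul hn'.le]
    nth_rw 1 [← Real.rpow_one (n : ℝ)]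
    rw [← Real.rpow_add hn']
    congr 1
    push_cast
    ring
  refine (h2.trans_tendsto (h1.congr' h3.symm)).congr fun n => ?_
  rw [inv_pow]
  rfl

variable (hKpos : ∀ n, 0 < K n)
include hKpos

theorem tendsto_div_knots (hγ' : γ < 1 / 2) :
    Tendsto (fun n : ℕ => (n : ℝ) / K n) atTop atTop := by
  have h1 : Tendsto (fun n : ℕ => (K n : ℝ) / n) atTop (𝓝[>] 0) := by
    refine tendsto_nhdsWithin_iff.mpr ⟨?_, ?_⟩
    · refine squeeze_zero (fun n => by positivity) (fun n => ?_) (tendsto_knots_sq_div hK hγ')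
      have : (1 : ℝ) ≤ K n := by exact_mod_cast hKpos n
      gcongr
      nlinarith
    · filter_upwards [eventually_gt_atTop 0] with n hn
      have hn' : (0 : ℝ) < n := by exact_mod_cast hn
      have : (0 : ℝ) < K n := by exact_mod_cast hKpos n
      exact div_pos this hn'
  refine h1.inv_tendsto_nhdsGT_zero.congr fun n => ?_
  simp

/-- The limit is η and not 0: η is the tolerance granted to the smoothing parameters and to the
initial value, chosen small afterwards. -/
theorem tendsto_errorOrder (hγ : 1 / 3 < γ) (hγ' : γ < 1 / 2) (η : ℝ) :
    Tendsto (fun n => errorOrder n (K n) η) atTop (𝓝 η) := by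
  have h1 : Tendsto (fun n : ℕ => √((n : ℝ) / K n) / K n) atTop (𝓝 0) := by
    have h := (tendsto_div_knots_cube hK hγ).sqrt
    rw [Real.sqrt_zero] at h
    refine h.congr fun n => ?_
    have hk : (0 : ℝ) < K n := by exact_mod_cast hKpos n
    have e : (n : ℝ) / (K n : ℝ) ^ 3 = (n : ℝ) / K n / (K n : ℝ) ^ 2 := by field_simp
    rw [e, Real.sqrt_div (by positivity), Real.sqrt_sq hk.le]
  have h2 : Tendsto (fun n : ℕ => (√(K n : ℝ))⁻¹) atTop (𝓝 0) :=
    (Real.tendsto_sqrt_atTop.comp (tendsto_knots hK hγ)).inv_tendsto_atTop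
  have h3 : Tendsto (fun n : ℕ => (√((n : ℝ) / K n))⁻¹) atTop (𝓝 0) :=
    (Real.tendsto_sqrt_atTop.comp (tendsto_div_knots hK hKpos hγ')).inv_tendsto_atTop
  simpa [errorOrder] using ((h1.const_add η).add h2).add h3

end Rates

theorem Linearized.mono {n : ℕ} {T : (Fin n → ℝ) → Fin 2 → ℝ} {g : Fin 2 → ℝ} {σ : Fin n → ℝ}
    {h c C ε ε' : ℝ} {α : Fin 2 → ℝ} {w : Fin 2 → Fin n → ℝ} (H : Linearized T g σ h c C ε α w)
    (hε : ε ≤ ε') : Linearized T g σ h c C ε' α w :=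
  ⟨H.eq, fun j => (H.offset j).trans hε, fun j i => (H.weight_le j i).trans hε,
    fun j => by linarith [H.le_variance j], H.variance_le, H.covariance_le.trans hε⟩

/-- With probability tending to one, the estimator is affine in the errors up to negligible
terms. -/
theorem exists_eventually_linearized {Ω : Type*} [MeasurableSpace Ω] {μ : Measure Ω}
    [IsProbabilityMeasure μ] {X : ℕ → Ω → Fin 2 → ℝ} {ν : Measure (Fin 2 → ℝ)} {c C : ℝ}
    (L : SquareLaw ν c C) (hX : ∀ i, Measurable (X i)) (hlaw : ∀ i, μ.map (X i) = ν)
    (hind : iIndepFun X μ) (p : ℕ) {m : ℕ} (hm : 1 ≤ m) {f : Fin 2 → ℝ → ℝ} (hf : Measurable (f 1))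
    {R Lip : ℝ} (hLip : 0 ≤ Lip)
    (hfL : ∀ j, ∀ u ∈ Icc (0 : ℝ) 1, ∀ v ∈ Icc (0 : ℝ) 1, |f j u - f j v| ≤ Lip * |u - v|)
    (hfR : ∀ j, ∀ u ∈ Icc (0 : ℝ) 1, |f j u| ≤ R) (hf0 : ∫ z, f 1 (z 1) ∂ν = 0)
    {x : Fin 2 → ℝ} (hx : x ∈ unitSquare) {σsq : (Fin 2 → ℝ) → ℝ} {S₀ S : ℝ} (hS₀ : 0 < S₀)
    (hσ : ∀ z ∈ unitSquare, S₀ ≤ σsq z ∧ σsq z ≤ S)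
    {K : ℕ → ℕ} (hKpos : ∀ n, 0 < K n) {γ : ℝ} (hγ : 1 / 3 < γ) (hγ' : γ < 1 / 2)
    (hK : (fun n => (K n : ℝ)) =Θ[atTop] fun n : ℕ => (n : ℝ) ^ γ)
    {lam : Fin 2 → ℕ → ℝ} (hlam0 : ∀ j n, 0 ≤ lam j n)
    (hlam : ∀ j, (fun n => lam j n) =o[atTop] fun n : ℕ => √((n : ℝ) / (K n : ℝ)))
    {b0 : ∀ n, (Fin n → Fin 2 → ℝ) → Fin (K n + p) → ℝ}
    (hb0 : TendstoInMeasure μ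
      (fun (n : ℕ) ω => √((n : ℝ) / (K n : ℝ)) * ((1 / (n : ℝ)) *
        ∑ i : Fin n, basis p (K n) (X i ω 1) ⬝ᵥ b0 n (fun i => X i ω)))
      atTop (fun _ => (0 : ℝ))) :
    ∃ c₂ > 0, ∃ C₂ : ℝ, ∀ ε > 0, ∀ᶠ n in atTop, μ.real {ω | ¬ ∃ α w, Linearized
      (fun e => estimator p m (K n) (fun j => lam j n) (fun i : Fin n => X i ω)
        (response f (fun i : Fin n => X i ω) e) (b0 n fun i => X i ω) x)
      (fun j => f j (x j)) (fun i : Fin n => σsq (X i ω)) ((n : ℝ) / K n) c₂ C₂ ε α w} ≤ ε := by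
  obtain ⟨κ, hκ, c₁, C₁, hWC⟩ := L.exists_wellConditioned p hm
  -- The signs of the constants are only visible in a well-conditioned sample. One exists: with K =
  -- 1 and n > 6/κ², deviations exceeding κ²n² everywhere would contradict the expectation bound 6n.
  by_cases hcC : 0 < c₁ ∧ c₁ ≤ C₁
  swap
  · refine ⟨1, one_pos, 1, fun ε hε => ?_⟩
    exfalso
    refine hcC ?_
    have hprob : 0 < μ.real univ := by simp
    obtain ⟨n, K', hn, hK', z, hz, hd⟩ : ∃ n K' : ℕ, 0 < n ∧ ∃ hK' : 0 < K', ∃ z : Fin n → Fin 2 → ℝ,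
        (∀ i, z i ∈ unitSquare) ∧ deviation p K' ν z ≤ (κ * ((n : ℝ) / K')) ^ 2 := by
      by_contra hne
      push Not at hne
      have h1 : ∀ᶠ n : ℕ in atTop, 6 / κ ^ 2 < (n : ℝ) :=
        tendsto_natCast_atTop_atTop.eventually_gt_atTop _
      obtain ⟨n, hn1, hn0⟩ := (h1.and (eventually_gt_atTop 0)).exists
      have hn' : (0 : ℝ) < n := by exact_mod_cast hn0
      have h2 := integral_deviation_le L hX hlaw hind one_pos p n
      have h3 : (κ * ((n : ℝ) / (1 : ℕ))) ^ 2 ≤ 6 * n := by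
        calc _ = ∫ ω, (κ * ((n : ℝ) / (1 : ℕ))) ^ 2 ∂μ := by simp
          _ ≤ _ := by
            refine le_trans (integral_mono_ae (integrable_const _) h2.1 ?_) h2.2
            filter_upwards [ae_forall_mem L hX hlaw] with ω hω
            exact (hne n 1 hn0 one_pos (fun i => X i ω) fun i => hω i).le
      rw [div_lt_iff₀ (by positivity)] at hn1
      simp only [Nat.cast_one, div_one] at h3
      nlinarith
    have W := hWC n K' hn hK' (fun _ => 0) (fun _ => le_rfl) (fun _ => by positivity) z hz hd
    exact ⟨W.c_pos, W.c_le⟩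
  obtain ⟨hc₁, hcC⟩ := hcC
  obtain ⟨Θ, hΘ⟩ := exists_measureReal_not_sampleBounds_le L hX hlaw hind p m hf (hfR 1) hf0 hx hc₁ hcC
  have hC₁ : 0 < C₁ := hc₁.trans_le hcC
  refine ⟨S₀ * (c₁ / (4 * C₁ ^ 2 * (p + 1))), by positivity, S / c₁, fun ε hε => ?_⟩
  obtain ⟨τ, hτ1, hτ⟩ : ∃ τ : ℝ, 1 ≤ τ ∧ Θ / τ ≤ ε / 3 := by
    refine ⟨max 1 (3 * |Θ| / ε), le_max_left _ _, ?_⟩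
    have h1 : 0 < max 1 (3 * |Θ| / ε) := lt_max_of_lt_left one_pos
    rw [div_le_iff₀ h1]
    have h2 := le_max_right 1 (3 * |Θ| / ε)
    rw [div_le_iff₀ hε] at h2
    linarith [le_abs_self Θ]
  obtain ⟨Γ, hΓ0, hΓ⟩ := exists_linearized (p := p) (m := m) (S := S) (τ := τ) hx hS₀.le hLip (by linarith)
    hc₁ hcC hfL hfR
  -- Chosen so that Γη < ε, hence the linearization error is eventually at most ε.
  set η := ε / (2 * (Γ + 1)) with hη
  have hη0 : 0 < η := by positivity
  have e1 : ∀ᶠ n in atTop, Γ * errorOrder n (K n) η ≤ ε := by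
    have h := (tendsto_errorOrder hK hKpos hγ hγ' η).const_mul Γ
    refine (h.eventually_lt_const (u := ε) ?_).mono fun n hn => hn.le
    rw [hη, mul_div_assoc', div_lt_iff₀ (by positivity)]
    nlinarith
  have e2 : ∀ᶠ n : ℕ in atTop, 6 / κ ^ 2 * ((K n : ℝ) ^ 2 / n) ≤ ε / 3 := by
    have h := (tendsto_knots_sq_div hK hγ').const_mul (6 / κ ^ 2)
    rw [mul_zero] at h
    exact (h.eventually_lt_const (by positivity)).mono fun n hn => hn.le
  have e3 : ∀ᶠ n : ℕ in atTop, K n ^ 2 ≤ n := by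
    filter_upwards [(tendsto_knots_sq_div hK hγ').eventually_lt_const one_pos,
      eventually_gt_atTop 0] with n hn hn0
    have hn' : (0 : ℝ) < n := by exact_mod_cast hn0
    rw [div_lt_one hn'] at hn
    exact_mod_cast hn.le
  have e4 : ∀ᶠ n : ℕ in atTop, ∀ j, lam j n ≤ η * √((n : ℝ) / K n) := by
    rw [eventually_all]
    intro j
    filter_upwards [(hlam j).def hη0] with n hn
    rw [Real.norm_eq_abs, Real.norm_eq_abs, abs_of_nonneg (Real.sqrt_nonneg _)] at hn
    exact (le_abs_self _).trans hn
  have e5 : ∀ᶠ n : ℕ in atTop, ∀ j, lam j n ≤ (n : ℝ) / K n := by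
    rw [eventually_all]
    intro j
    filter_upwards [(hlam j).def one_pos, (tendsto_div_knots hK hKpos hγ').eventually_ge_atTop 1]
      with n hn hn1
    rw [Real.norm_eq_abs, Real.norm_eq_abs, abs_of_nonneg (Real.sqrt_nonneg _), one_mul] at hn
    refine (le_abs_self _).trans (hn.trans ?_)
    rw [Real.sqrt_le_left (by linarith)]
    nlinarith
  have e6 : ∀ᶠ n : ℕ in atTop, μ.real {ω | η ≤ |√((n : ℝ) / (K n : ℝ)) * ((1 / (n : ℝ)) *
        ∑ i : Fin n, basis p (K n) (X i ω 1) ⬝ᵥ b0 n (fun i => X i ω))|} ≤ ε / 3 := by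
    have h := tendstoInMeasure_iff_norm.mp hb0 η hη0
    filter_upwards [h.eventually_le_const (u := ENNReal.ofReal (ε / 3))
      (by rw [ENNReal.ofReal_pos]; positivity)] with n hn
    simp only [sub_zero, Real.norm_eq_abs] at hn
    exact ENNReal.toReal_le_of_le_ofReal (by positivity) hn
  filter_upwards [e1, e2, e3, e4, e5, e6, eventually_gt_atTop 0] with n h1 h2 h3 h4 h5 h6 hn
  have hn' : (0 : ℝ) < n := by exact_mod_cast hn
  have hK' : (0 : ℝ) < K n := by exact_mod_cast hKpos n
  set B1 : Set Ω := {ω | ¬ SampleBounds p m (K n) (fun i : Fin n => X i ω) f x c₁ C₁ τ}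
  set B2 : Set Ω := {ω | ¬ deviation p (K n) ν (fun i : Fin n => X i ω) ≤
    κ ^ 2 * ((n : ℝ) / K n) ^ 2}
  set B3 : Set Ω := {ω | η ≤ |√((n : ℝ) / (K n : ℝ)) * ((1 / (n : ℝ)) *
        ∑ i : Fin n, basis p (K n) (X i ω 1) ⬝ᵥ b0 n (fun i => X i ω))|}
  set B4 : Set Ω := {ω | ¬ ∀ i, X i ω ∈ unitSquare}
  have b1 : μ.real B1 ≤ ε / 3 := (hΘ τ hτ1 n (K n) (hKpos n) h3).trans hτ
  -- Markov's inequality for the deviation gives 6n/(κh)² = 6K²/(κ²n).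
  have b2 : μ.real B2 ≤ ε / 3 := by
    have h := integral_deviation_le L hX hlaw hind (hKpos n) p n
    refine (measureReal_not_le_le (θ := 6 * ((K n : ℝ) ^ 2 / n)) (fun ω => add_nonneg
      (Finset.sum_nonneg fun _ _ => sq_nonneg _) (Finset.sum_nonneg fun _ _ => sq_nonneg _)) h.1
      (by positivity) (by positivity) (h.2.trans (le_of_eq ?_))).trans (le_trans (le_of_eq ?_) h2)
    · field_simp
    · ring
  have b4 : μ.real B4 = 0 := by
    rw [measureReal_eq_zero_iff]
    exact ae_forall_mem L hX hlaw
  have hsub : {ω | ¬ ∃ α w, Linearized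
      (fun e => estimator p m (K n) (fun j => lam j n) (fun i : Fin n => X i ω)
        (response f (fun i : Fin n => X i ω) e) (b0 n fun i => X i ω) x)
      (fun j => f j (x j)) (fun i : Fin n => σsq (X i ω)) ((n : ℝ) / K n)
      (S₀ * (c₁ / (4 * C₁ ^ 2 * (p + 1)))) (S / c₁) ε α w} ⊆ ((B1 ∪ B2) ∪ B3) ∪ B4 := by
    intro ω hω
    by_contra hne
    simp only [mem_union, not_or] at hne
    obtain ⟨⟨⟨g1, g2⟩, g3⟩, g4⟩ := hne
    have g1 := not_not.mp g1
    have g2 := not_not.mp g2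
    simp only [B3, mem_ofPred_eq, not_le] at g3
    have g4 := not_not.mp g4
    rw [← mul_pow] at g2
    have W := hWC n (K n) hn (hKpos n) (fun j => lam j n) (fun j => hlam0 j n) h5
      (fun i : Fin n => X i ω) (fun i => g4 i) g2
    rw [abs_mul, abs_of_nonneg (Real.sqrt_nonneg _)] at g3
    obtain ⟨α, w, H⟩ := hΓ n (K n) (fun j => lam j n) (fun i : Fin n => X i ω) (b0 n fun i => X i ω)
      (fun i : Fin n => σsq (X i ω)) η hη0.le (fun i => g4 i) (fun i => hσ _ (g4 i)) W
      (fun j => hlam0 j n) h4 g1 g3.le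
    exact hω ⟨α, w, H.mono h1⟩
  have u1 := measureReal_union_le (μ := μ) B1 B2
  have u2 := measureReal_union_le (μ := μ) (B1 ∪ B2) B3
  have u3 := measureReal_union_le (μ := μ) ((B1 ∪ B2) ∪ B3) B4
  have u0 := measureReal_mono (μ := μ) hsub
  linarith

/-! ### Standardization of nearly diagonal covariance matrices -/

section Normalizer

/-- `N` approximately standardizes a vector with covariance matrix `V`. -/
structure Standardizes (N V : Matrix (Fin 2) (Fin 2) ℝ) (h a δ : ℝ) : Prop where
  entry_le : ∀ j k, |N j k| ≤ a * √h
  form : ∀ t, |(Nᵀ *ᵥ t) ⬝ᵥ V *ᵥ (Nᵀ *ᵥ t) - t ⬝ᵥ t| ≤ δ * (t ⬝ᵥ t)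

variable {V : Matrix (Fin 2) (Fin 2) ℝ} {h c C ε : ℝ}

/-- Here NVN = 1 exactly, so the form has no error; near-diagonality only serves to keep V positive
definite, through (3c/4)² - (c/4)² = c²/2 for the determinant. An entry of N is bounded by a
diagonal entry of N² = V⁻¹, a cofactor over the determinant. -/
theorem standardizes_invSqrt (hh : 0 < h) (hc : 0 < c) (hε : ε ≤ c / 4) (hs : V 0 1 = V 1 0)
    (hV : ∀ j, c - ε ≤ h * V j j) (hVC : ∀ j, h * V j j ≤ C) (hcov : h * |V 0 1| ≤ ε) :
    Standardizes (invSqrt V) V h (√(2 * C) / c) ε := by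
  have hε0 : 0 ≤ ε := le_trans (by positivity) hcov
  have hd : ∀ j, 3 / 4 * c ≤ h * V j j := fun j => by linarith [hV j]
  have hdpos : ∀ j, 0 < V j j := fun j => by
    have := hd j
    exact pos_of_mul_pos_right (lt_of_lt_of_le (by positivity) this) hh.le
  have hdet : c ^ 2 / 2 ≤ h ^ 2 * V.det := by
    rw [Matrix.det_fin_two, ← hs]
    have h1 : (3 / 4 * c) * (3 / 4 * c) ≤ (h * V 0 0) * (h * V 1 1) :=
      mul_le_mul (hd 0) (hd 1) (by positivity) ((by positivity : 0 ≤ 3 / 4 * c).trans (hd 0))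
    have h2 : (h * |V 0 1|) ^ 2 ≤ (c / 4) ^ 2 := pow_le_pow_left₀ (by positivity) (hcov.trans hε) 2
    rw [mul_pow, sq_abs] at h2
    nlinarith
  have hdet0 : 0 < V.det := by
    have h2 : 0 < h ^ 2 * V.det := lt_of_lt_of_le (by positivity) hdet
    exact pos_of_mul_pos_right h2 (by positivity)
  have hunit : IsUnit V.det := isUnit_iff_ne_zero.mpr hdet0.ne'
  have hinv : V⁻¹ = V.det⁻¹ • !![V 1 1, -V 0 1; -V 1 0, V 0 0] := by
    rw [Matrix.inv_def, Matrix.adjugate_fin_two, Ring.inverse_eq_inv']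
  have hps : (V⁻¹).PosSemidef := by
    rw [posSemidef_fin_two_iff, Matrix.det_nonsing_inv, Ring.inverse_eq_inv', hinv]
    simp only [Matrix.smul_apply, smul_eq_mul, Matrix.of_apply, Matrix.cons_val', Matrix.cons_val_zero,
      Matrix.cons_val_one, Matrix.cons_val_fin_one]
    refine ⟨by rw [hs], ?_, ?_, by positivity⟩
    · have := hdpos 1; positivity
    · have := hdpos 0; positivity
  have hnn : 0 ≤ V⁻¹ := Matrix.nonneg_iff_posSemidef.mpr hps
  set N := invSqrt V with hN
  have hNN : N * N = V⁻¹ := CFC.sqrt_mul_sqrt_self _ hnn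
  have hNps : N.PosSemidef := Matrix.nonneg_iff_posSemidef.mp (CFC.sqrt_nonneg _)
  have hNT : Nᵀ = N := by
    have := hNps.1
    rwa [Matrix.IsHermitian, Matrix.conjTranspose_eq_transpose_of_trivial] at this
  have hNVN : N * V * N = 1 := by
    have h1 : N * (N * V) = 1 := by
      rw [← mul_assoc, hNN, Matrix.nonsing_inv_mul _ hunit]
    exact mul_eq_one_comm.mp h1
  refine ⟨fun j k => ?_, fun t => ?_⟩
  · have h1 : N j k ^ 2 ≤ (V⁻¹) j j := by
      rw [← hNN, Matrix.mul_apply]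
      have e : ∀ l, N j l * N l j = N j l ^ 2 := fun l => by
        rw [sq]; congr 1; exact congrFun (congrFun hNT j) l
      simp_rw [e]
      exact Finset.single_le_sum (f := fun l => N j l ^ 2) (fun l _ => sq_nonneg _)
        (Finset.mem_univ k)
    have h2 : (V⁻¹) j j ≤ 2 * C * h / c ^ 2 := by
      obtain ⟨k, hk⟩ : ∃ k, (V⁻¹) j j = V.det⁻¹ * V k k := by
        fin_cases j
        · exact ⟨1, by rw [hinv]; simp⟩
        · exact ⟨0, by rw [hinv]; simp⟩
      rw [hk, inv_mul_eq_div, div_le_div_iff₀ hdet0 (by positivity)]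
      have h3 := mul_le_mul (hVC k) hdet (by positivity) ((mul_pos hh (hdpos k)).le.trans (hVC k))
      have h4 : h * (V k k * c ^ 2) ≤ h * (2 * C * h * V.det) := by nlinarith
      exact le_of_mul_le_mul_left h4 hh
    have hC : 0 ≤ C := (mul_pos hh (hdpos 0)).le.trans (hVC 0)
    refine abs_le_of_sq_le_sq ?_ (by positivity)
    rw [mul_pow, Real.sq_sqrt hh.le, div_pow, Real.sq_sqrt (by positivity)]
    calc _ ≤ _ := h1
      _ ≤ _ := h2
      _ = _ := by ring
  · have e : (Nᵀ *ᵥ t) ⬝ᵥ V *ᵥ (Nᵀ *ᵥ t) = t ⬝ᵥ t := by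
      rw [hNT, Matrix.mulVec_mulVec]
      calc (N *ᵥ t) ⬝ᵥ (V * N) *ᵥ t = (Nᵀ *ᵥ t) ⬝ᵥ (V * N) *ᵥ t := by rw [hNT]
        _ = t ⬝ᵥ (N * V * N) *ᵥ t := by
          rw [transpose_mulVec_dotProduct, Matrix.mulVec_mulVec, mul_assoc]
        _ = _ := by rw [hNVN, Matrix.one_mulVec]
    rw [e, sub_self, abs_zero]
    exact mul_nonneg hε0 (dotProduct_self_nonneg' t)

/-- Dividing by standard deviations leaves the identity plus the correlation off the diagonal, and
the correlation is at most ε/(c/2). -/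
theorem standardizes_diagonal (hh : 0 < h) (hc : 0 < c) (hε : ε ≤ c / 4) (hs : V 0 1 = V 1 0)
    (hV : ∀ j, c - ε ≤ h * V j j) (hcov : h * |V 0 1| ≤ ε) :
    Standardizes (Matrix.diagonal fun j => (√(V j j))⁻¹) V h (√(2 / c)) (2 / c * ε) := by
  have hε0 : 0 ≤ ε := le_trans (by positivity) hcov
  have hd : ∀ j, c / 2 ≤ h * V j j := fun j => by linarith [hV j]
  have hdpos : ∀ j, 0 < V j j := fun j => by
    have := hd j
    exact pos_of_mul_pos_right (lt_of_lt_of_le (by positivity) this) hh.le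
  refine ⟨fun j k => ?_, fun t => ?_⟩
  · by_cases hjk : j = k
    · subst hjk
      rw [Matrix.diagonal_apply_eq, abs_of_nonneg (by positivity), ← Real.sqrt_inv,
        ← Real.sqrt_mul (by positivity)]
      refine Real.sqrt_le_sqrt ?_
      have hd' := hd j
      rw [inv_eq_one_div, div_le_iff₀ (hdpos j)]
      have : 2 / c * h * V j j = 2 / c * (h * V j j) := by ring
      rw [this]
      calc (1 : ℝ) = 2 / c * (c / 2) := by field_simp
        _ ≤ _ := by gcongr
    · rw [Matrix.diagonal_apply_ne _ hjk, abs_zero]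
      positivity
  · have e1 : ∀ j : Fin 2, 0 < √(V j j) := fun j => Real.sqrt_pos.mpr (hdpos j)
    set s : Fin 2 → ℝ := fun j => √(V j j) with hsdef
    have hss : ∀ j, s j * s j = V j j := fun j => Real.mul_self_sqrt (hdpos j).le
    have e : ((Matrix.diagonal fun j => (s j)⁻¹)ᵀ *ᵥ t) ⬝ᵥ V *ᵥ
        ((Matrix.diagonal fun j => (s j)⁻¹)ᵀ *ᵥ t) - t ⬝ᵥ t =
        2 * (t 0 * t 1) * (V 0 1 / (s 0 * s 1)) := by
      have h0 := (e1 0).ne'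
      have h1 := (e1 1).ne'
      change s 0 ≠ 0 at h0
      change s 1 ≠ 0 at h1
      rw [Matrix.diagonal_transpose]
      simp only [dotProduct, Matrix.mulVec, Fin.sum_univ_two, ← hs, ← hss, Matrix.diagonal_apply]
      simp
      field_simp
      ring
    rw [e, abs_mul, abs_div, abs_of_pos (mul_pos (e1 0) (e1 1))]
    have h3 : |V 0 1| / (s 0 * s 1) ≤ 2 / c * ε := by
      rw [div_le_iff₀ (mul_pos (e1 0) (e1 1))]
      have h4 : c / 2 ≤ h * (s 0 * s 1) := by
        refine le_of_sq_le_sq ?_ (by have := e1 0; have := e1 1; positivity)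
        calc (c / 2) ^ 2 = c / 2 * (c / 2) := sq _
          _ ≤ (h * V 0 0) * (h * V 1 1) := mul_le_mul (hd 0) (hd 1) (by positivity)
              ((by positivity : 0 ≤ c / 2).trans (hd 0))
          _ = _ := by rw [← hss, ← hss]; ring
      have h5 : h * |V 0 1| ≤ h * (2 / c * ε * (s 0 * s 1)) := by
        calc _ ≤ ε := hcov
          _ = 2 / c * ε * (c / 2) := by field_simp
          _ ≤ 2 / c * ε * (h * (s 0 * s 1)) := by gcongr
          _ = _ := by ring
      exact le_of_mul_le_mul_left h5 hh
    have h6 : |2 * (t 0 * t 1)| ≤ t ⬝ᵥ t := by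
      simp only [dotProduct, Fin.sum_univ_two]
      rw [abs_le]
      constructor <;> nlinarith [sq_nonneg (t 0 + t 1), sq_nonneg (t 0 - t 1)]
    calc _ ≤ (t ⬝ᵥ t) * (2 / c * ε) := mul_le_mul h6 h3 (by
            have := e1 0; have := e1 1; positivity) (dotProduct_self_nonneg' t)
      _ = _ := mul_comm _ _

end Normalizer

/-! ### Conditional normal approximation -/

section Conditional

/-- A law of a sequence of independent centred variables with variances `s i` and bounded moments of
order `2 + δ`. -/
structure IndependentErrors (P : Measure (ℕ → ℝ)) (s : ℕ → ℝ) (δ M : ℝ) : Prop where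
  isProb : IsProbabilityMeasure P
  indep : iIndepFun (fun (i : ℕ) (e : ℕ → ℝ) => e i) P
  mean : ∀ i, ∫ e, e i ∂P = 0
  var : ∀ i, Var[fun e : ℕ → ℝ => e i; P] = s i
  integrable : ∀ i, Integrable (fun e : ℕ → ℝ => |e i| ^ (2 + δ)) P
  moment : ∀ i, ∫ e, |e i| ^ (2 + δ) ∂P ≤ M

/-- The Taylor estimate needs δ ≤ 1; this lowers the moment exponent accordingly at the cost of an
additive constant. -/
theorem rpow_two_add_min_le {x δ : ℝ} (hx : 0 ≤ x) :
    x ^ (2 + min δ 1) ≤ 1 + x ^ (2 + δ) := by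
  rcases le_total x 1 with h | h
  · by_cases hδ : 0 ≤ 2 + min δ 1
    · have h1 := Real.rpow_le_one hx h hδ
      have h2 := Real.rpow_nonneg hx (2 + δ)
      linarith
    · have e : min δ 1 = δ := by
        refine min_eq_left ?_
        by_contra! h1
        rw [min_eq_right h1.le] at hδ
        norm_num at hδ
      rw [e]; linarith
  · have h1 := Real.rpow_le_rpow_of_exponent_le h (show 2 + min δ 1 ≤ 2 + δ by
      linarith [min_le_left δ 1])
    linarith

theorem independentErrors_of_lintegral {P : Measure (ℕ → ℝ)} [IsProbabilityMeasure P] {s : ℕ → ℝ}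
    {δ : ℝ} {M : ℝ≥0} (hindep : iIndepFun (fun (i : ℕ) (e : ℕ → ℝ) => e i) P)
    (hmean : ∀ i : ℕ, ∫ e, e i ∂P = 0) (hvar : ∀ i : ℕ, Var[fun e : ℕ → ℝ => e i; P] = s i)
    (hM : ∀ i : ℕ, ∫⁻ e, ENNReal.ofReal (|e i| ^ (2 + δ)) ∂P ≤ M) :
    IndependentErrors P s (min δ 1) (1 + M) := by
  have hmeas : ∀ (i : ℕ) (r : ℝ), Measurable fun e : ℕ → ℝ => |e i| ^ r := fun i r => by fun_prop
  have hint : ∀ i, Integrable (fun e : ℕ → ℝ => |e i| ^ (2 + δ)) P := fun i => by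
    refine ⟨(hmeas i _).aestronglyMeasurable, ?_⟩
    rw [hasFiniteIntegral_iff_ofReal (ae_of_all _ fun e => by positivity)]
    exact (hM i).trans_lt ENNReal.coe_lt_top
  have hint' : ∀ i, Integrable (fun e : ℕ → ℝ => |e i| ^ (2 + min δ 1)) P := fun i => by
    refine Integrable.mono' ((integrable_const (1 : ℝ)).add (hint i)) (hmeas i _).aestronglyMeasurable
      (ae_of_all _ fun e => ?_)
    rw [Real.norm_of_nonneg (by positivity)]
    exact rpow_two_add_min_le (abs_nonneg _)
  refine ⟨inferInstance, hindep, hmean, hvar, hint', fun i => ?_⟩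
  calc ∫ e, |e i| ^ (2 + min δ 1) ∂P ≤ ∫ e, (1 + |e i| ^ (2 + δ)) ∂P :=
        integral_mono (hint' i) ((integrable_const (1 : ℝ)).add (hint i)) fun e =>
          rpow_two_add_min_le (abs_nonneg _)
    _ = 1 + ∫ e, |e i| ^ (2 + δ) ∂P := by
        rw [integral_add (integrable_const _) (hint i)]; simp
    _ ≤ 1 + M := by
        gcongr
        rw [integral_eq_lintegral_of_nonneg_ae (ae_of_all _ fun e => by positivity)
          (hmeas i _).aestronglyMeasurable]
        exact ENNReal.toReal_le_coe_of_le_coe (hM i)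

variable {P : Measure (ℕ → ℝ)} {s : ℕ → ℝ} {δ M : ℝ} (H : IndependentErrors P s δ M)
include H

theorem IndependentErrors.memLp (hδ : 0 < δ) (i : ℕ) : MemLp (fun e : ℕ → ℝ => e i) 2 P := by
  have := H.isProb
  have hm : Measurable fun e : ℕ → ℝ => e i := measurable_pi_apply i
  rw [memLp_two_iff_integrable_sq hm.aestronglyMeasurable]
  refine Integrable.mono' ((integrable_const (1 : ℝ)).add (H.integrable i))
    (hm.pow_const 2).aestronglyMeasurable (ae_of_all _ fun e => ?_)
  rw [Real.norm_of_nonneg (by positivity), ← sq_abs]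
  simp only [Pi.add_apply]
  have h0 := abs_nonneg (e i)
  rcases le_total |e i| 1 with h | h
  · have : 0 ≤ |e i| ^ (2 + δ) := by positivity
    nlinarith
  · have h1 := Real.rpow_le_rpow_of_exponent_le h (show (2 : ℝ) ≤ 2 + δ by linarith)
    rw [Real.rpow_two] at h1
    linarith

theorem IndependentErrors.covMatrix_apply (hδ : 0 < δ) {n : ℕ} {T : (Fin n → ℝ) → Fin 2 → ℝ}
    {α : Fin 2 → ℝ} {w : Fin 2 → Fin n → ℝ} (hT : ∀ e j, T e j = α j + w j ⬝ᵥ e) (j k : Fin 2) :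
    covMatrix (fun e : ℕ → ℝ => T fun i => e i) P j k = ∑ i : Fin n, s i * w j i * w k i := by
  have := H.isProb
  have hmem : ∀ j (i : Fin n), MemLp (fun e : ℕ → ℝ => w j i * e i) 2 P := fun j i =>
    (H.memLp hδ i).const_mul _
  have hsum : ∀ j, Integrable (fun e : ℕ → ℝ => ∑ i : Fin n, w j i * e i) P := fun j =>
    integrable_finsetSum _ fun i _ => (hmem j i).integrable one_le_two
  simp only [covMatrix, Matrix.of_apply, hT, dotProduct]
  rw [covariance_const_add_left (hsum j), covariance_const_add_right (hsum k),
    covariance_fun_sum_fun_sum (hmem j) (hmem k)]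
  refine Finset.sum_congr rfl fun i _ => ?_
  rw [Finset.sum_eq_single i]
  · rw [covariance_const_mul_left, covariance_const_mul_right,
      covariance_self (measurable_pi_apply _).aemeasurable, H.var]
    ring
  · intro l _ hl
    rw [covariance_const_mul_left, covariance_const_mul_right,
      (H.indep.indepFun (i := (i : ℕ)) (j := (l : ℕ)) fun h => hl (Fin.ext h.symm)).covariance_eq_zero
        (H.memLp hδ i) (H.memLp hδ l)]
    ring
  · intro h
    exact absurd (Finset.mem_univ _) h

omit H in
theorem abs_exp_neg_sub_exp_neg_le {x y : ℝ} (hx : 0 ≤ x) (hy : 0 ≤ y) :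
    |Real.exp (-x) - Real.exp (-y)| ≤ |x - y| := by
  wlog hxy : x ≤ y generalizing x y
  · rw [abs_sub_comm, abs_sub_comm x]
    exact this hy hx (le_of_not_ge hxy)
  have h1 : Real.exp (-y) ≤ Real.exp (-x) := Real.exp_le_exp.mpr (by linarith)
  rw [abs_of_nonneg (by linarith), abs_of_nonpos (by linarith)]
  have h2 : Real.exp (-y) = Real.exp (-x) * Real.exp (x - y) := by rw [← Real.exp_add]; ring_nf
  have h3 := Real.add_one_le_exp (x - y)
  have h4 : Real.exp (-x) ≤ 1 := Real.exp_le_one_iff.mpr (by linarith)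
  have h5 := Real.exp_pos (-x)
  rw [h2]
  nlinarith

/-- The error in the normal approximation of the conditional characteristic function. -/
noncomputable def charFunError (M δ s₀ s₁ a : ℝ) (t : Fin 2 → ℝ) (ε δ' : ℝ) : ℝ :=
  2 * (a * (|t 0| + |t 1|)) * ε +
    (4 * M * (2 * (a * (|t 0| + |t 1|)) * ε) ^ δ / s₀ + (2 * (a * (|t 0| + |t 1|)) * ε) ^ 2 * s₁) *
      ((1 + δ') * (t ⬝ᵥ t)) + δ' * (t ⬝ᵥ t) / 2

/-- Three errors add up: the phase from the offset, the Lyapunov error for the weighted sum of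
errors, and the distance of the standardized covariance from the identity. -/
theorem IndependentErrors.norm_integral_exp_sub_le (hδ : 0 < δ) (hδ1 : δ ≤ 1) (hM : 0 ≤ M)
    {n : ℕ} {T : (Fin n → ℝ) → Fin 2 → ℝ} {g : Fin 2 → ℝ} {h c C ε : ℝ} {α : Fin 2 → ℝ}
    {w : Fin 2 → Fin n → ℝ} (hT : Linearized T g (fun i : Fin n => s i) h c C ε α w) {s₀ s₁ : ℝ}
    (hs₀ : 0 < s₀) (hs : ∀ i, s₀ ≤ s i ∧ s i ≤ s₁) {N : Matrix (Fin 2) (Fin 2) ℝ} {a δ' : ℝ}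
    (ha : 0 ≤ a) (hε : 0 ≤ ε)
    (hN : Standardizes N (covMatrix (fun e : ℕ → ℝ => T fun i => e i) P) h a δ') (t : Fin 2 → ℝ) :
    ‖∫ e : ℕ → ℝ, Complex.exp (((t ⬝ᵥ N *ᵥ (fun j => T (fun i => e i) j - g j) : ℝ) : ℂ) *
        Complex.I) ∂P - (Real.exp (-(t ⬝ᵥ t) / 2) : ℂ)‖ ≤ charFunError M δ s₀ s₁ a t ε δ' := by
  have := H.isProb
  set v := Nᵀ *ᵥ t with hv
  set u : Fin n → ℝ := fun i => ∑ j, v j * w j i with hu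
  set b := ∑ j, v j * (α j - g j) with hb
  set r := a * (|t 0| + |t 1|) with hr
  have hr0 : 0 ≤ r := by positivity
  set V := covMatrix (fun e : ℕ → ℝ => T fun i => e i) P with hV
  have hvle : ∀ j, |v j| ≤ r * √h := by
    intro j
    have e : v j = N 0 j * t 0 + N 1 j * t 1 := by
      simp only [hv, Matrix.mulVec, dotProduct, Fin.sum_univ_two, Matrix.transpose_apply]
    rw [e]
    refine (abs_add_le _ _).trans ?_
    rw [abs_mul, abs_mul]
    calc _ ≤ a * √h * |t 0| + a * √h * |t 1| :=
          add_le_add (mul_le_mul_of_nonneg_right (hN.entry_le 0 j) (abs_nonneg _))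
            (mul_le_mul_of_nonneg_right (hN.entry_le 1 j) (abs_nonneg _))
      _ = _ := by rw [hr]; ring
  -- The normalizer grows at most like √h, which matches the factor √h in the bounds of the
  -- linearization; the same estimate serves offset and weights.
  have hlin : ∀ x : Fin 2 → ℝ, (∀ j, √h * |x j| ≤ ε) → |∑ j, v j * x j| ≤ 2 * r * ε := by
    intro x hx
    have h1 : ∀ j, |v j * x j| ≤ r * ε := fun j => by
      rw [abs_mul]
      calc _ ≤ r * √h * |x j| := mul_le_mul_of_nonneg_right (hvle j) (abs_nonneg _)
        _ = r * (√h * |x j|) := by ring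
        _ ≤ _ := mul_le_mul_of_nonneg_left (hx j) hr0
    refine (Finset.abs_sum_le_sum_abs _ _).trans ?_
    rw [Fin.sum_univ_two]
    linarith [h1 0, h1 1]
  have hble : |b| ≤ 2 * r * ε := hlin _ hT.offset
  have hule : ∀ i, |u i| ≤ 2 * r * ε := fun i => hlin (fun j => w j i) fun j => hT.weight_le j i
  have hlinear : ∀ e : ℕ → ℝ, t ⬝ᵥ N *ᵥ (fun j => T (fun i => e i) j - g j) =
      b + ∑ i : Fin n, u i * e i := by
    intro e
    rw [← transpose_mulVec_dotProduct, ← hv]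
    simp only [hT.eq, hb, hu, dotProduct, Fin.sum_univ_two, add_mul, Finset.sum_add_distrib]
    have e1 : ∀ j, v j * ∑ i : Fin n, w j i * e i = ∑ i : Fin n, v j * w j i * e i := fun j => by
      rw [Finset.mul_sum]; exact Finset.sum_congr rfl fun i _ => by ring
    rw [← e1, ← e1]
    ring
  have hquad : ∑ i : Fin n, u i ^ 2 * s i = v ⬝ᵥ V *ᵥ v := by
    have eV : ∀ j k, V j k = ∑ i : Fin n, s i * w j i * w k i := fun j k =>
      H.covMatrix_apply hδ hT.eq j k
    simp only [hu, dotProduct, Matrix.mulVec, Fin.sum_univ_two, eV, Finset.sum_mul, Finset.mul_sum,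
      ← Finset.sum_add_distrib]
    exact Finset.sum_congr rfl fun i _ => by ring
  have hform := hN.form t
  rw [← hv, ← hquad] at hform
  set Qs := ∑ i : Fin n, u i ^ 2 * s i with hQs
  have htt := dotProduct_self_nonneg' t
  have hQ : Qs ≤ (1 + δ') * (t ⬝ᵥ t) := by linarith [le_abs_self (Qs - t ⬝ᵥ t)]
  have hQ0 : 0 ≤ Qs := Finset.sum_nonneg fun i _ => mul_nonneg (sq_nonneg _) (hs₀.le.trans (hs i).1)
  have hs₁ : 0 ≤ s₁ := hs₀.le.trans ((hs 0).1.trans (hs 0).2)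
  have hclt := norm_integral_exp_sum_sub_le (P := P) (e := fun (i : Fin n) (e : ℕ → ℝ) => e i)
    (fun i => measurable_pi_apply _)
    (H.indep.precomp (g := fun i : Fin n => (i : ℕ)) Fin.val_injective)
    (fun i => H.memLp hδ i) (fun i => H.mean i) hδ hδ1 (fun i => H.integrable i)
    (fun i => H.moment i) (s := fun i : Fin n => s i) (fun i => H.var i) (u := u) (τ := 2 * r * ε)
    hs₀ hs₁ (by positivity) (fun i => hs i) hule hM hQ
  rw [← hQs] at hclt
  set I1 := ∫ e : ℕ → ℝ, Complex.exp (((∑ i : Fin n, u i * e i : ℝ) : ℂ) * Complex.I) ∂P with hI1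
  have hfac : ∫ e : ℕ → ℝ, Complex.exp (((t ⬝ᵥ N *ᵥ (fun j => T (fun i => e i) j - g j) : ℝ) : ℂ) *
        Complex.I) ∂P = Complex.exp ((b : ℂ) * Complex.I) * I1 := by
    rw [hI1, ← integral_const_mul]
    congr 1
    funext e
    rw [hlinear, ← Complex.exp_add]
    push_cast
    ring_nf
  have hI1n : ‖I1‖ ≤ 1 := by
    refine (norm_integral_le_of_norm_le_const (C := 1) (ae_of_all _ fun e => ?_)).trans (by simp)
    rw [Complex.norm_exp_ofReal_mul_I]
  have hb1 : ‖Complex.exp ((b : ℂ) * Complex.I) - 1‖ ≤ |b| := by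
    have := Real.norm_exp_I_mul_ofReal_sub_one_le (x := b)
    rwa [mul_comm, Real.norm_eq_abs] at this
  have hexp : ‖(Real.exp (-Qs / 2) : ℂ) - (Real.exp (-(t ⬝ᵥ t) / 2) : ℂ)‖ ≤ δ' * (t ⬝ᵥ t) / 2 := by
    rw [← Complex.ofReal_sub, Complex.norm_real, Real.norm_eq_abs, neg_div, neg_div]
    refine (abs_exp_neg_sub_exp_neg_le (by positivity) (by positivity)).trans ?_
    rw [← sub_div, abs_div, abs_of_pos (by norm_num : (0 : ℝ) < 2)]
    linarith
  rw [hfac]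
  have split : Complex.exp ((b : ℂ) * Complex.I) * I1 - (Real.exp (-(t ⬝ᵥ t) / 2) : ℂ) =
      (Complex.exp ((b : ℂ) * Complex.I) - 1) * I1 + (I1 - (Real.exp (-Qs / 2) : ℂ)) +
        ((Real.exp (-Qs / 2) : ℂ) - (Real.exp (-(t ⬝ᵥ t) / 2) : ℂ)) := by ring
  rw [split]
  refine (norm_add₃_le).trans ?_
  unfold charFunError
  rw [← hr]
  refine add_le_add (add_le_add ?_ hclt) hexp
  rw [norm_mul]
  exact (mul_le_of_le_one_right (norm_nonneg _) hI1n).trans (hb1.trans hble)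

end Conditional

/-! ### From conditional to unconditional convergence -/

section Disintegration

/-- Off the bad set the error is η; on it the integrand is at most 2. The bad set is replaced by a
measurable hull of the same measure, as its measurability is not available. -/
theorem norm_integral_sub_le_of_measureReal_le {Ω : Type*} [MeasurableSpace Ω] {μ : Measure Ω}
    [IsProbabilityMeasure μ] {G : Ω → ℂ} (hG : AEStronglyMeasurable G μ) {c : ℂ}
    (hG1 : ∀ ω, ‖G ω‖ ≤ 1) (hc : ‖c‖ ≤ 1) {η : ℝ} (hη : 0 ≤ η)
    (h : μ.real {ω | ¬ ‖G ω - c‖ ≤ η} ≤ η) : ‖∫ ω, G ω ∂μ - c‖ ≤ 3 * η := by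
  set B := toMeasurable μ {ω | ¬ ‖G ω - c‖ ≤ η} with hB
  have hBm : MeasurableSet B := measurableSet_toMeasurable _ _
  have hGi : Integrable G μ := Integrable.of_bound hG 1 (ae_of_all _ hG1)
  have e : ∫ ω, G ω ∂μ - c = ∫ ω, (G ω - c) ∂μ := by
    rw [integral_sub hGi (integrable_const _)]; simp
  have hBi : Integrable (B.indicator fun _ => (2 : ℝ)) μ := (integrable_const _).indicator hBm
  rw [e]
  calc ‖∫ ω, (G ω - c) ∂μ‖ ≤ ∫ ω, (η + B.indicator (fun _ => (2 : ℝ)) ω) ∂μ := by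
        refine norm_integral_le_of_norm_le ((integrable_const _).add hBi) (ae_of_all _ fun ω => ?_)
        by_cases hω : ω ∈ B
        · rw [indicator_of_mem hω]
          linarith [norm_sub_le (G ω) c, hG1 ω]
        · rw [indicator_of_notMem hω, add_zero]
          by_contra h1
          exact hω (subset_toMeasurable μ _ h1)
    _ = η + 2 * μ.real B := by
        rw [integral_add (integrable_const _) hBi, integral_indicator_const _ hBm]
        simp [mul_comm]
    _ ≤ 3 * η := by
        have : μ.real B = μ.real {ω | ¬ ‖G ω - c‖ ≤ η} := by
          rw [Measure.real, Measure.real, hB, measure_toMeasurable]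
        linarith

variable {Ω α β : Type*} [MeasurableSpace Ω] [MeasurableSpace α] [MeasurableSpace β]
  [StandardBorelSpace β] [Nonempty β] {μ : Measure Ω} [IsProbabilityMeasure μ] {X : Ω → α}
  {Y : Ω → β}

theorem integral_condDistrib (hX : Measurable X) (hY : Measurable Y) {φ : α × β → ℂ}
    (hφ : Measurable φ) (hφ1 : ∀ a, ‖φ a‖ ≤ 1) :
    ∫ ω, φ (X ω, Y ω) ∂μ = ∫ ω, ∫ e, φ (X ω, e) ∂(condDistrib Y X μ (X ω)) ∂μ := by
  have := Measure.isProbabilityMeasure_map (μ := μ) hX.aemeasurable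
  have h1 : (μ.map X) ⊗ₘ condDistrib Y X μ = μ.map fun ω => (X ω, Y ω) :=
    compProd_map_condDistrib hY.aemeasurable
  have h2 : ∫ ω, φ (X ω, Y ω) ∂μ = ∫ a, φ a ∂(μ.map fun ω => (X ω, Y ω)) :=
    (integral_map (hX.prodMk hY).aemeasurable hφ.aestronglyMeasurable).symm
  rw [h2, ← h1, Measure.integral_compProd
    (Integrable.of_bound hφ.aestronglyMeasurable 1 (ae_of_all _ hφ1)),
    integral_map hX.aemeasurable
      (hφ.stronglyMeasurable.integral_kernel_prod_right').aestronglyMeasurable]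

/-- Conditional characteristic functions converging in probability to a deterministic limit have
convergent means, being bounded by one. The means are the unconditional characteristic functions,
and Lévy's theorem applies. -/
theorem tendstoInDistribution_of_conditional_charFun (hX : Measurable X) (hY : Measurable Y)
    {S : ℕ → α → β → Fin 2 → ℝ} (hS : ∀ n, Measurable (Function.uncurry (S n)))
    (h : ∀ t : Fin 2 → ℝ, ∀ η > 0, ∀ᶠ n in atTop, μ.real {ω | ¬ ‖∫ e, Complex.exp
      (((t ⬝ᵥ S n (X ω) e : ℝ) : ℂ) * Complex.I) ∂(condDistrib Y X μ (X ω)) -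
        (Real.exp (-(t ⬝ᵥ t) / 2) : ℂ)‖ ≤ η} ≤ η) :
    TendstoInDistribution (fun n ω => WithLp.toLp 2 (S n (X ω) (Y ω))) atTop
      (id : EuclideanSpace ℝ (Fin 2) → EuclideanSpace ℝ (Fin 2)) (fun _ => μ)
      (multivariateGaussian 0 1) := by
  have hXY : ∀ n, Measurable fun ω => S n (X ω) (Y ω) := fun n => (hS n).comp (hX.prodMk hY)
  have hm : ∀ n, Measurable fun ω => WithLp.toLp 2 (S n (X ω) (Y ω)) := fun n =>
    (WithLp.measurable_toLp 2 _).comp (hXY n)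
  refine ⟨fun n => (hm n).aemeasurable, aemeasurable_id, ?_⟩
  refine ProbabilityMeasure.tendsto_of_tendsto_charFun fun t => ?_
  have hlim : charFun ((multivariateGaussian (0 : EuclideanSpace ℝ (Fin 2)) 1).map id) t =
      (Real.exp (-(t.ofLp ⬝ᵥ t.ofLp) / 2) : ℂ) := by
    rw [Measure.map_id, multivariateGaussian_zero_one, charFun_stdGaussian,
      ← Complex.ofReal_pow, EuclideanSpace.real_norm_sq_eq]
    push_cast [dotProduct]
    simp only [sq]
  have hn : ∀ n, charFun (μ.map fun ω => WithLp.toLp 2 (S n (X ω) (Y ω))) t =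
      ∫ ω, ∫ e, Complex.exp (((t.ofLp ⬝ᵥ S n (X ω) e : ℝ) : ℂ) * Complex.I)
        ∂(condDistrib Y X μ (X ω)) ∂μ := by
    intro n
    rw [charFun_apply, integral_map (hm n).aemeasurable (by fun_prop)]
    have hφ : Measurable fun a : α × β =>
        Complex.exp (((t.ofLp ⬝ᵥ S n a.1 a.2 : ℝ) : ℂ) * Complex.I) := by
      have h1 : Measurable fun a : α × β => t.ofLp ⬝ᵥ S n a.1 a.2 :=
        (by fun_prop : Continuous fun v : Fin 2 → ℝ => t.ofLp ⬝ᵥ v).measurable.comp (hS n)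
      fun_prop
    rw [← integral_condDistrib (φ := fun a => Complex.exp
      (((t.ofLp ⬝ᵥ S n a.1 a.2 : ℝ) : ℂ) * Complex.I)) hX hY hφ
      fun a => (Complex.norm_exp_ofReal_mul_I _).le]
    rfl
  change Tendsto (fun n => charFun (μ.map fun ω => WithLp.toLp 2 (S n (X ω) (Y ω))) t) atTop
    (𝓝 (charFun ((multivariateGaussian (0 : EuclideanSpace ℝ (Fin 2)) 1).map id) t))
  rw [hlim, Metric.tendsto_nhds]
  intro r hr
  filter_upwards [h t.ofLp (r / 4) (by positivity)] with n hη
  rw [dist_eq_norm, hn]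
  have hφ : Measurable fun a : α × β =>
      Complex.exp (((t.ofLp ⬝ᵥ S n a.1 a.2 : ℝ) : ℂ) * Complex.I) := by
    have h1 : Measurable fun a : α × β => t.ofLp ⬝ᵥ S n a.1 a.2 :=
      (by fun_prop : Continuous fun v : Fin 2 → ℝ => t.ofLp ⬝ᵥ v).measurable.comp (hS n)
    fun_prop
  refine (norm_integral_sub_le_of_measureReal_le ?_ (fun ω => ?_) ?_ (by positivity) hη).trans_lt
    (by linarith)
  · exact ((hφ.stronglyMeasurable.integral_kernel_prod_right'
      (κ := condDistrib Y X μ)).comp_measurable hX).aestronglyMeasurable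
  · refine (norm_integral_le_of_norm_le_const (C := 1) (ae_of_all _ fun e => ?_)).trans (by simp)
    rw [Complex.norm_exp_ofReal_mul_I]
  · rw [Complex.norm_real, Real.norm_of_nonneg (Real.exp_pos _).le, Real.exp_le_one_iff]
    have : 0 ≤ t.ofLp ⬝ᵥ t.ofLp := dotProduct_self_nonneg' _
    linarith

end Disintegration

/-! ### Choice of the tolerance, and Lipschitz bounds -/

section ErrorLimit

theorem tendsto_charFunError (M δ s₀ s₁ a k : ℝ) (hδ : 0 < δ) (t : Fin 2 → ℝ) :
    Tendsto (fun ε => charFunError M δ s₀ s₁ a t ε (k * ε)) (𝓝 0) (𝓝 0) := by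
  have hc : Continuous fun ε : ℝ => charFunError M δ s₀ s₁ a t ε (k * ε) := by
    unfold charFunError
    have := Real.continuous_rpow_const hδ.le
    fun_prop
  have h := hc.tendsto 0
  have e : charFunError M δ s₀ s₁ a t 0 (k * 0) = 0 := by
    simp [charFunError, Real.zero_rpow hδ.ne']
  rwa [e] at h

theorem exists_charFunError_le (M δ s₀ s₁ a k : ℝ) (hδ : 0 < δ) (t : Fin 2 → ℝ) {η b : ℝ}
    (hη : 0 < η) (hb : 0 < b) :
    ∃ ε > 0, ε ≤ η ∧ ε ≤ b ∧ charFunError M δ s₀ s₁ a t ε (k * ε) ≤ η := by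
  have h := (tendsto_charFunError M δ s₀ s₁ a k hδ t).eventually_le_const hη
  have h' : ∀ᶠ ε : ℝ in 𝓝[>] 0, charFunError M δ s₀ s₁ a t ε (k * ε) ≤ η :=
    h.filter_mono nhdsWithin_le_nhds
  have hI : ∀ᶠ ε : ℝ in 𝓝[>] 0, ε ∈ Ioc 0 (min η b) := Ioc_mem_nhdsGT (lt_min hη hb)
  obtain ⟨ε, h1, h2⟩ := (h'.and hI).exists
  exact ⟨ε, h2.1, h2.2.trans (min_le_left _ _), h2.2.trans (min_le_right _ _), h1⟩

/-- A C¹ function is locally Lipschitz on the convex interval, and compactness makes the constant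
global. -/
theorem exists_lipschitz_of_contDiffOn {f : ℝ → ℝ} {k : ℕ}
    (hf : ContDiffOn ℝ ((k + 1 : ℕ) : ℕ∞) f (Icc 0 1)) :
    ∃ L, 0 ≤ L ∧ ∀ u ∈ Icc (0 : ℝ) 1, ∀ v ∈ Icc (0 : ℝ) 1, |f u - f v| ≤ L * |u - v| := by
  have h1 : ContDiffOn ℝ 1 f (Icc 0 1) := hf.of_le (by exact_mod_cast Nat.le_add_left 1 k)
  have hll : LocallyLipschitzOn (Icc 0 1) f := fun u hu => by
    obtain ⟨K, t, ht, h⟩ := (h1 u hu).exists_lipschitzOnWith (convex_Icc 0 1)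
    exact ⟨K, t, ht, h⟩
  obtain ⟨K, hK⟩ := hll.exists_lipschitzOnWith_of_compact isCompact_Icc
  refine ⟨K, K.2, fun u hu v hv => ?_⟩
  have := hK.dist_le_mul u hu v hv
  rwa [Real.dist_eq, Real.dist_eq] at this

end ErrorLimit

/-! ### The standard Gaussian law of the plane as a product -/

section Gaussian

theorem tendstoInDistribution_finTwo {Ω : Type*} [MeasurableSpace Ω] {μ : Measure Ω}
    [IsProbabilityMeasure μ] {Z : ℕ → Ω → Fin 2 → ℝ}
    (h : TendstoInDistribution (fun n ω => WithLp.toLp 2 (Z n ω)) atTop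
      (id : EuclideanSpace ℝ (Fin 2) → EuclideanSpace ℝ (Fin 2)) (fun _ => μ)
      (multivariateGaussian 0 1)) :
    TendstoInDistribution (fun n ω => (Z n ω 0, Z n ω 1)) atTop (id : ℝ × ℝ → ℝ × ℝ) (fun _ => μ)
      ((gaussianReal 0 1).prod (gaussianReal 0 1)) := by
  have hc : Continuous fun v : EuclideanSpace ℝ (Fin 2) => (v 0, v 1) := by fun_prop
  have h1 := h.continuous_comp hc
  have hlaw : (multivariateGaussian (0 : EuclideanSpace ℝ (Fin 2)) 1).map
      ((fun v : EuclideanSpace ℝ (Fin 2) => (v 0, v 1)) ∘ id) =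
      (gaussianReal 0 1).prod (gaussianReal 0 1) := by
    rw [multivariateGaussian_zero_one, ← map_pi_eq_stdGaussian, Function.comp_id,
      Measure.map_map hc.measurable (WithLp.measurable_toLp 2 _)]
    exact (measurePreserving_finTwoArrow (gaussianReal 0 1)).map_eq
  refine ⟨h1.forall_aemeasurable, aemeasurable_id, ?_⟩
  have h2 := h1.tendsto
  have e : (⟨_, Measure.isProbabilityMeasure_map h1.aemeasurable_limit⟩ :
      ProbabilityMeasure (ℝ × ℝ)) =
      ⟨_, Measure.isProbabilityMeasure_map (μ := (gaussianReal 0 1).prod (gaussianReal 0 1))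
        aemeasurable_id⟩ := Subtype.ext (hlaw.trans Measure.map_id.symm)
  rwa [e] at h2

end Gaussian

/-! ### Asymptotic normality -/

section Normality

/-- `A V` standardizes every vector whose covariance matrix `V` is nearly diagonal. -/
structure IsStandardizer (A : Matrix (Fin 2) (Fin 2) ℝ → Matrix (Fin 2) (Fin 2) ℝ) : Prop where
  measurable : ∀ {V : (ℕ → Fin 2 → ℝ) → Matrix (Fin 2) (Fin 2) ℝ},
    (∀ i j, Measurable fun a => V a i j) → ∀ i j, Measurable fun a => A (V a) i j
  standardizes : ∀ c > 0, ∀ C : ℝ, ∃ a ≥ 0, ∃ k : ℝ, ∀ (V : Matrix (Fin 2) (Fin 2) ℝ) (h ε : ℝ),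
    0 < h → ε ≤ c / 4 → V 0 1 = V 1 0 → (∀ j, c - ε ≤ h * V j j) → (∀ j, h * V j j ≤ C) →
      h * |V 0 1| ≤ ε → Standardizes (A V) V h a (k * ε)

theorem isStandardizer_invSqrt : IsStandardizer invSqrt where
  measurable hV i j := measurable_invSqrt_apply hV i j
  standardizes c hc C := ⟨√(2 * C) / c, by positivity, 1, fun V h ε hh hε hs hV hVC hcov => by
    rw [one_mul]; exact standardizes_invSqrt hh hc hε hs hV hVC hcov⟩

theorem isStandardizer_diagonal :
    IsStandardizer fun V => Matrix.diagonal fun j => (√(V j j))⁻¹ where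
  measurable hV i j := by
    by_cases hij : i = j
    · subst hij
      simp only [Matrix.diagonal_apply_eq]
      exact (hV i i).sqrt.inv
    · simp only [Matrix.diagonal_apply_ne _ hij]
      exact measurable_const
  standardizes c hc C := ⟨√(2 / c), by positivity, 2 / c, fun V h ε hh hε hs hV _ hcov =>
    standardizes_diagonal hh hc hε hs hV hcov⟩

variable {Ω : Type*} [MeasurableSpace Ω] {μ : Measure Ω} [IsProbabilityMeasure μ]
  {X : ℕ → Ω → Fin 2 → ℝ} {ε : ℕ → Ω → ℝ}

instance : IsMarkovKernel (errorLaw μ X ε) := by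
  unfold errorLaw; infer_instance

/-- Outside an event of small probability the statistic is linearized, so its conditional covariance
matrix is nearly diagonal after scaling by h, the normalizer applies, and the conditional
characteristic function is close to the Gaussian one. -/
theorem tendstoInDistribution_standardized
    {A : Matrix (Fin 2) (Fin 2) ℝ → Matrix (Fin 2) (Fin 2) ℝ} (hA : IsStandardizer A)
    (hX : ∀ i, Measurable (X i)) (hε : ∀ i, Measurable (ε i)) {s : Ω → ℕ → ℝ} {s₀ s₁ δ M : ℝ}
    (hs₀ : 0 < s₀) (hs : ∀ᵐ ω ∂μ, ∀ i, s₀ ≤ s ω i ∧ s ω i ≤ s₁) (hδ : 0 < δ) (hδ1 : δ ≤ 1)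
    (hM : 0 ≤ M)
    (herr : ∀ᵐ ω ∂μ, IndependentErrors (errorLaw μ X ε fun i => X i ω) (s ω) δ M)
    {T : ∀ n, (ℕ → Fin 2 → ℝ) → (Fin n → ℝ) → Fin 2 → ℝ}
    (hT : ∀ n, Measurable fun a : (ℕ → Fin 2 → ℝ) × (ℕ → ℝ) => T n a.1 fun i => a.2 i)
    {g : Fin 2 → ℝ} {h : ℕ → ℝ} (hh : ∀ᶠ n in atTop, 0 < h n) {c C : ℝ} (hc : 0 < c)
    (hlin : ∀ ε > 0, ∀ᶠ n in atTop, μ.real {ω | ¬ ∃ α w, Linearized (T n fun i => X i ω) g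
      (fun i : Fin n => s ω i) (h n) c C ε α w} ≤ ε) :
    TendstoInDistribution (fun n ω => WithLp.toLp 2
      (A (covMatrix (fun e : ℕ → ℝ => T n (fun i => X i ω) fun i => e i)
        (errorLaw μ X ε fun i => X i ω)) *ᵥ
          fun j => T n (fun i => X i ω) (fun i => ε i ω) j - g j)) atTop
      (id : EuclideanSpace ℝ (Fin 2) → EuclideanSpace ℝ (Fin 2)) (fun _ => μ)
      (multivariateGaussian 0 1) := by
  set V : ∀ _ : ℕ, (ℕ → Fin 2 → ℝ) → Matrix (Fin 2) (Fin 2) ℝ := fun n z =>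
    covMatrix (fun e : ℕ → ℝ => T n z fun i => e i) (errorLaw μ X ε z) with hV
  have hVm : ∀ n i j, Measurable fun z => V n z i j := fun n i j =>
    measurable_covMatrix_apply (κ := errorLaw μ X ε) (T := fun z e => T n z fun i => e i) (hT n) i j
  refine tendstoInDistribution_of_conditional_charFun (μ := μ) (X := fun ω i => X i ω)
    (Y := fun ω i => ε i ω) (measurable_pi_lambda _ hX) (measurable_pi_lambda _ hε)
    (S := fun n z e => A (V n z) *ᵥ fun j => T n z (fun i => e i) j - g j) (fun n => ?_)
    fun t η hη => ?_
  · refine measurable_pi_lambda _ fun i => measurable_mulVec_apply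
      (A := fun a : (ℕ → Fin 2 → ℝ) × (ℕ → ℝ) => A (V n a.1))
      (fun i j => (hA.measurable (hVm n) i j).comp measurable_fst) (fun j => ?_) i
    exact ((measurable_pi_apply j).comp (hT n)).sub measurable_const
  obtain ⟨a, ha, k, hstd⟩ := hA.standardizes c hc C
  obtain ⟨r, hr, hrη, hrc, hrE⟩ := exists_charFunError_le M δ s₀ s₁ a k hδ t hη
    (show 0 < c / 4 by positivity)
  filter_upwards [hlin r hr, hh] with n hn hhn
  refine le_trans (ENNReal.toReal_mono (measure_ne_top _ _) (measure_mono_ae ?_)) (hn.trans hrη)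
  filter_upwards [hs, herr] with ω hsω H hbad
  rintro ⟨α, w, hL⟩
  refine hbad ?_
  have hcov : ∀ j k, V n (fun i => X i ω) j k = ∑ i : Fin n, s ω i * w j i * w k i := fun j k =>
    H.covMatrix_apply hδ hL.eq j k
  refine (H.norm_integral_exp_sub_le hδ hδ1 hM hL hs₀ hsω ha hr.le
    (hstd (V n fun i => X i ω) (h n) r hhn hrc ?_ (fun j => ?_) (fun j => ?_) ?_) t).trans hrE
  · rw [hcov, hcov]; exact Finset.sum_congr rfl fun i _ => by ring
  · rw [hcov]
    refine (hL.le_variance j).trans (le_of_eq ?_)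
    congr 1; exact Finset.sum_congr rfl fun i _ => by ring
  · rw [hcov]
    refine le_trans (le_of_eq ?_) (hL.variance_le j)
    congr 1; exact Finset.sum_congr rfl fun i _ => by ring
  · rw [hcov]
    exact hL.covariance_le

theorem tendstoInDistribution_fhat
    {A : Matrix (Fin 2) (Fin 2) ℝ → Matrix (Fin 2) (Fin 2) ℝ} (hA : IsStandardizer A)
    (p : ℕ) {m : ℕ} (hm : 1 ≤ m) (hX : ∀ i, Measurable (X i)) {ν : Measure (Fin 2 → ℝ)} {c C : ℝ}
    (L : SquareLaw ν c C) (hlaw : ∀ i, μ.map (X i) = ν) (hind : iIndepFun X μ)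
    (hε : ∀ i, Measurable (ε i)) {σsq : (Fin 2 → ℝ) → ℝ} {S₀ S : ℝ} (hS₀ : 0 < S₀)
    (hσ : ∀ z ∈ unitSquare, S₀ ≤ σsq z ∧ σsq z ≤ S) {δ M : ℝ} (hδ : 0 < δ) (hδ1 : δ ≤ 1)
    (hM : 0 ≤ M) (herr : ∀ᵐ ω ∂μ,
      IndependentErrors (errorLaw μ X ε fun i => X i ω) (fun i => σsq (X i ω)) δ M)
    {f : Fin 2 → ℝ → ℝ} (hf : ∀ j, ContDiffOn ℝ ((p + 1 : ℕ) : ℕ∞) (f j) (Icc 0 1))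
    (hf0 : ∫ z, f 1 (z 1) ∂ν = 0)
    {K : ℕ → ℕ} (hKpos : ∀ n, 0 < K n) {γ : ℝ} (hγ : 1 / 3 < γ) (hγ' : γ < 1 / 2)
    (hK : (fun n => (K n : ℝ)) =Θ[atTop] fun n : ℕ => (n : ℝ) ^ γ)
    {lam : Fin 2 → ℕ → ℝ} (hlam0 : ∀ j n, 0 ≤ lam j n)
    (hlam : ∀ j, (fun n => lam j n) =o[atTop] fun n : ℕ => √((n : ℝ) / (K n : ℝ)))
    {b0 : ∀ n, (Fin n → Fin 2 → ℝ) → Fin (K n + p) → ℝ} (hb0 : ∀ n, Measurable (b0 n))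
    (hb0_mean : TendstoInMeasure μ
      (fun (n : ℕ) ω => √((n : ℝ) / (K n : ℝ)) * ((1 / (n : ℝ)) *
        ∑ i : Fin n, basis p (K n) (X i ω 1) ⬝ᵥ b0 n (fun i => X i ω)))
      atTop (fun _ => (0 : ℝ)))
    {x : Fin 2 → ℝ} (hx : x ∈ unitSquare) :
    TendstoInDistribution (fun n ω => WithLp.toLp 2
      (A (covMatrix (fhat p m K lam f b0 x n fun i => X i ω) (errorLaw μ X ε fun i => X i ω)) *ᵥ
          fun j => fhat p m K lam f b0 x n (fun i => X i ω) (fun i => ε i ω) j - f j (x j))) atTop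
      (id : EuclideanSpace ℝ (Fin 2) → EuclideanSpace ℝ (Fin 2)) (fun _ => μ)
      (multivariateGaussian 0 1) := by
  -- Outside [0, 1] nothing is known about f, not even measurability. Cutting it off there changes
  -- nothing almost surely, as all covariates lie in the open square.
  set f' : Fin 2 → ℝ → ℝ := fun j => (Icc 0 1).indicator (f j) with hf'
  have hff : ∀ j, ∀ u ∈ Icc (0 : ℝ) 1, f' j u = f j u := fun j u hu => indicator_of_mem hu _
  have hmem : ∀ z ∈ unitSquare, ∀ j, z j ∈ Icc (0 : ℝ) 1 := fun z hz j =>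
    Ioo_subset_Icc_self (hz j (mem_univ j))
  have hfm : ∀ j, Measurable (f' j) := fun j => by
    have := (hf j).continuousOn.measurable_piecewise (g := 0) continuousOn_const
      measurableSet_Icc
    rwa [piecewise_eq_indicator] at this
  choose Lp hLp0 hLp using fun j => exists_lipschitz_of_contDiffOn (hf j)
  choose R hR using fun j => isCompact_Icc.exists_bound_of_continuousOn (hf j).continuousOn
  have hLp' : ∀ j, ∀ u ∈ Icc (0 : ℝ) 1, ∀ v ∈ Icc (0 : ℝ) 1,
      |f' j u - f' j v| ≤ (Lp 0 + Lp 1) * |u - v| := fun j u hu v hv => by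
    rw [hff j u hu, hff j v hv]
    refine (hLp j u hu v hv).trans (mul_le_mul_of_nonneg_right ?_ (abs_nonneg _))
    fin_cases j
    · exact le_add_of_nonneg_right (hLp0 1)
    · exact le_add_of_nonneg_left (hLp0 0)
  have hR' : ∀ j, ∀ u ∈ Icc (0 : ℝ) 1, |f' j u| ≤ max (R 0) (R 1) := fun j u hu => by
    rw [hff j u hu]
    refine (hR j u hu).trans ?_
    fin_cases j
    · exact le_max_left _ _
    · exact le_max_right _ _
  have hf0' : ∫ z, f' 1 (z 1) ∂ν = 0 := by
    rw [← hf0]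
    refine integral_congr_ae ?_
    filter_upwards [L.ae_mem] with z hz using hff 1 _ (hmem z hz 1)
  have hXmem := ae_forall_mem L hX hlaw
  have hX' := (hXmem.mono fun ω hω i => hσ _ (hω i) :
    ∀ᵐ ω ∂μ, ∀ i, S₀ ≤ σsq (X i ω) ∧ σsq (X i ω) ≤ S)
  obtain ⟨c₂, hc₂, C₂, hlin⟩ := exists_eventually_linearized L hX hlaw hind p hm (hfm 1)
    (add_nonneg (hLp0 0) (hLp0 1)) hLp' hR' hf0' hx hS₀ hσ hKpos hγ hγ' hK hlam0 hlam hb0_mean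
  have hpos : ∀ᶠ n : ℕ in atTop, 0 < (n : ℝ) / K n := by
    filter_upwards [eventually_gt_atTop 0] with n hn
    have h1 : (0 : ℝ) < n := by exact_mod_cast hn
    have h2 : (0 : ℝ) < K n := by exact_mod_cast hKpos n
    positivity
  have main := tendstoInDistribution_standardized hA hX hε hS₀ hX' hδ hδ1 hM herr
    (T := fun n z e => estimator p m (K n) (fun j => lam j n) (fun i : Fin n => z i)
      (response f' (fun i : Fin n => z i) e) (b0 n fun i => z i) x)
    (fun n => measurable_fhat hfm hb0 x n) hpos hc₂ hlin
  refine main.congr (fun n => ?_) (ae_of_all _ fun _ => rfl)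
  filter_upwards [hXmem] with ω hω
  have hfhat : ∀ e : ℕ → ℝ, fhat p m K lam f b0 x n (fun i => X i ω) e =
      fhat p m K lam f' b0 x n (fun i => X i ω) e := fun e => by
    have e1 : response f (fun i : Fin n => X i ω) (fun i => e i) =
        response f' (fun i : Fin n => X i ω) fun i => e i := by
      funext i
      simp only [response]
      rw [hff 0 _ (hmem _ (hω i) 0), hff 1 _ (hmem _ (hω i) 1)]
    simp only [fhat, e1]
  have hfx : ∀ j, f' j (x j) = f j (x j) := fun j => hff j _ (hmem x hx j)
  rw [funext hfhat]
  simp only [← hfx]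
  rfl

end Normality
end PSpline

/-! ### The main theorem -/

theorem theorem2
    {Ω : Type*} [MeasurableSpace Ω] (μ : Measure Ω) [IsProbabilityMeasure μ]
    (p m : ℕ) (hm : 1 ≤ m)
    -- the covariates are independent with a joint density `q` on the open unit square
    (X : ℕ → Ω → Fin 2 → ℝ) (hX : ∀ i, Measurable (X i))
    (q : (Fin 2 → ℝ) → ℝ) (hq : Measurable q)
    (hq_bdd : ∃ c C : ℝ, 0 < c ∧ ∀ z ∈ PSpline.unitSquare, c ≤ q z ∧ q z ≤ C)
    (hX_indep : iIndepFun X μ)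
    (hX_law : ∀ i, μ.map (X i) =
      (volume.restrict PSpline.unitSquare).withDensity (fun z => ENNReal.ofReal (q z)))
    -- the errors are, given the covariates, independent and centred with variance `σ²(X_i)`
    (ε : ℕ → Ω → ℝ) (hε : ∀ i, Measurable (ε i))
    (σsq : (Fin 2 → ℝ) → ℝ) (hσ : Measurable σsq)
    (hσ_bdd : ∃ c C : ℝ, 0 < c ∧ ∀ z ∈ PSpline.unitSquare, c ≤ σsq z ∧ σsq z ≤ C)
    (hε_indep : ∀ᵐ ω ∂μ, iIndepFun (fun (i : ℕ) (e : ℕ → ℝ) => e i)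
      (PSpline.errorLaw μ X ε (fun i => X i ω)))
    (hε_mean : ∀ᵐ ω ∂μ, ∀ i : ℕ,
      ∫ e, e i ∂(PSpline.errorLaw μ X ε (fun i => X i ω)) = 0)
    (hε_var : ∀ᵐ ω ∂μ, ∀ i : ℕ,
      Var[fun e : ℕ → ℝ => e i; PSpline.errorLaw μ X ε (fun i => X i ω)] = σsq (X i ω))
    (δ : ℝ) (hδ : 0 < δ) (M : ℝ≥0)
    (hε_moment : ∀ᵐ ω ∂μ, ∀ i : ℕ,
      ∫⁻ e, ENNReal.ofReal (|e i| ^ (2 + δ)) ∂(PSpline.errorLaw μ X ε (fun i => X i ω)) ≤ M)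
    -- the component functions
    (f : Fin 2 → ℝ → ℝ) (hf : ∀ j, ContDiffOn ℝ ((p + 1 : ℕ) : ℕ∞) (f j) (Set.Icc 0 1))
    (hf_mean : ∀ j i, ∫ ω, f j (X i ω j) ∂μ = 0)
    -- the number of knots and the smoothing parameters
    (K : ℕ → ℕ) (hK_pos : ∀ n, 0 < K n) (γ : ℝ) (hγ : 1 / 3 < γ) (hγ' : γ < 1 / 2)
    (hK : (fun n => (K n : ℝ)) =Θ[atTop] fun n : ℕ => (n : ℝ) ^ γ)
    (lam : Fin 2 → ℕ → ℝ) (hlam_nonneg : ∀ j n, 0 ≤ lam j n)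
    (hlam : ∀ j, (fun n => lam j n) =o[atTop] fun n : ℕ => Real.sqrt ((n : ℝ) / (K n : ℝ)))
    -- the initial value of the backfitting algorithm, asymptotically centred
    (b0 : ∀ n, (Fin n → Fin 2 → ℝ) → Fin (K n + p) → ℝ) (hb0 : ∀ n, Measurable (b0 n))
    (hb0_mean : TendstoInMeasure μ
      (fun (n : ℕ) ω => Real.sqrt ((n : ℝ) / (K n : ℝ)) * ((1 / (n : ℝ)) *
        ∑ i : Fin n, PSpline.basis p (K n) (X i ω 1) ⬝ᵥ b0 n (fun i => X i ω)))
      atTop (fun _ => (0 : ℝ)))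
    -- the point of estimation
    (x : Fin 2 → ℝ) (hx : x ∈ PSpline.unitSquare)
    -- the estimator and its covariance matrix given the covariates
    (F : ℕ → Ω → Fin 2 → ℝ)
    (hF : F = fun n ω => PSpline.fhat p m K lam f b0 x n (fun i => X i ω) (fun i => ε i ω))
    (V : ℕ → Ω → Matrix (Fin 2) (Fin 2) ℝ)
    (hV : V = fun n ω => PSpline.covMatrix
      (PSpline.fhat p m K lam f b0 x n (fun i => X i ω))
      (PSpline.errorLaw μ X ε (fun i => X i ω))) :
    TendstoInDistribution
      (fun n ω => WithLp.toLp 2 (PSpline.invSqrt (V n ω) *ᵥ (fun j => F n ω j - f j (x j))))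
      atTop (id : EuclideanSpace ℝ (Fin 2) → EuclideanSpace ℝ (Fin 2)) (fun _ => μ)
      (multivariateGaussian 0 1) ∧
    TendstoInDistribution
      (fun n ω => ((F n ω 0 - f 0 (x 0)) / Real.sqrt (V n ω 0 0),
        (F n ω 1 - f 1 (x 1)) / Real.sqrt (V n ω 1 1)))
      atTop (id : ℝ × ℝ → ℝ × ℝ) (fun _ => μ)
      ((gaussianReal 0 1).prod (gaussianReal 0 1)) := by
  obtain ⟨c, C, hc, hqc⟩ := hq_bdd
  obtain ⟨S₀, S, hS₀, hσS⟩ := hσ_bdd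
  set ν := (volume.restrict PSpline.unitSquare).withDensity fun z => ENNReal.ofReal (q z) with hν
  have hprob : IsProbabilityMeasure ν := by
    rw [← hX_law 0]
    exact Measure.isProbabilityMeasure_map (hX 0).aemeasurable
  have L : PSpline.SquareLaw ν c C := PSpline.squareLaw_withDensity hc hqc hprob
  have herr : ∀ᵐ ω ∂μ, PSpline.IndependentErrors (PSpline.errorLaw μ X ε fun i => X i ω)
      (fun i => σsq (X i ω)) (min δ 1) (1 + M) := by
    filter_upwards [hε_indep, hε_mean, hε_var, hε_moment] with ω h1 h2 h3 h4
    exact PSpline.independentErrors_of_lintegral h1 h2 h3 h4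
  have hf0 : ∫ z, f 1 (z 1) ∂ν = 0 := by
    -- The transfer of the mean condition to the law needs measurability, which continuity provides
    -- on [0, 1] only; the law does not charge the rest.
    have hmeas : AEStronglyMeasurable (fun z : Fin 2 → ℝ => f 1 (z 1)) ν := by
      have h1 : Measurable ((Set.Icc (0 : ℝ) 1).piecewise (f 1) 0) :=
        (hf 1).continuousOn.measurable_piecewise continuousOn_const measurableSet_Icc
      refine ⟨_, (h1.comp (measurable_pi_apply 1)).stronglyMeasurable, ?_⟩
      filter_upwards [L.ae_mem] with z hz
      exact (Set.piecewise_eq_of_mem _ _ _ (Set.Ioo_subset_Icc_self (hz 1 (Set.mem_univ 1)))).symm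
    rw [← hX_law 0] at hmeas ⊢
    rw [integral_map (hX 0).aemeasurable hmeas, hf_mean 1 0]
  -- One limit theorem for all standardizers: the inverse root of V gives the first claim, the
  -- diagonal of inverse standard deviations the second. The moment exponent is lowered to min δ 1.
  have key := fun {A} (hA : PSpline.IsStandardizer A) =>
    PSpline.tendstoInDistribution_fhat hA p hm hX L hX_law hX_indep hε hS₀ hσS
      (lt_min hδ one_pos) (min_le_right δ 1) (by positivity) herr hf hf0 hK_pos hγ hγ' hK
      hlam_nonneg hlam hb0 hb0_mean hx
  subst hF hV
  refine ⟨key PSpline.isStandardizer_invSqrt, ?_⟩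
  refine (PSpline.tendstoInDistribution_finTwo (key PSpline.isStandardizer_diagonal)).congr
    (fun n => ae_of_all _ fun ω => ?_) (ae_of_all _ fun _ => rfl)
  simp only [Matrix.mulVec_diagonal, inv_mul_eq_div]
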